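/- Let $G$ be a finite graph (multiple edges and loops allowed; in particular, $G$ may be any planar graph) with vertex set $V(G)$ and edge set $E(G)$, and let $D$ be a diagram in the plane of a spatial embedding of $G$; circle components are regarded as loops with one vertex. Then, as an identity of rational functions in $A$ (and, more generally, for every element $A$ of a field with $A\neq 0$ and $A^4\neq\pm1$), $$Y(D;A^4)=-(A^2+A^{-2})^{|E(G)|-|V(G)|+1}\,\mathfrak J(D;A).$$ Here the two polynomials are defined as follows. *Yamada polynomial.* For a finite graph $H$ with $\mu(H)$ connected components and first Betti number $\beta(H)$ let $h(H;x,y)=\sum_{F\subseteq E(H)}(-x)^{-|F|}x^{\mu(H-F)}y^{\beta(H-F)}$. A state $s$ assigns $+$, $-$ or $0$ to every crossing of $D$, and $D_s$ is the plane graph obtained from $D$ by replacing each crossing by its $A$-smoothing (the one that joins the two regions swept out by the over-strand when it is turned counterclockwise), by its other smoothing, or by a vertex of degree $4$, respectively. Then $Y(D;A)=\sum_s A^{p(s)-m(s)}\,h(D_s;-1,-A-2-A^{-1})$, where $p(s)$ and $m(s)$ are the numbers of crossings with the values $+$ and $-$. *Jaeger polynomial.* Replace every vertex of $D$ by a disc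 and every arc of $D$ between vertices and crossings by a strip with one bar, where the strips cross each other at the crossings as the arcs do. For the resulting bar diagram $B_D$, $R(B_D)$ is computed by applying to every bar the relation $$R(\text{strip with a bar})=\frac1{t+t^{-1}}\Bigl(R(\text{half-twisted strip})+t^{-1}R(\text{strip without bar})+\frac{t-t^{-1}}{1-at}R(\text{strip cut open})\Bigr),$$ where the half twist is the one whose $A$-smoothing is the strip without bar, and by setting $R(B)=\mathfrak D(L_B;a,z=t-t^{-1})$ for a band diagram $B$ without bars, where $L_B$ is the link diagram bounding $B$ and $\mathfrak D$ is Kauffman's Dubrovnik polynomial of link diagrams. The latter is the regular isotopy invariant with value $1$ on the simple circle which is multiplied by $a^{\pm1}$ by a curl of sign $\pm1$ and satisfies $\mathfrak D(X)-\mathfrak D(X')=z\,(\mathfrak D(X_A)-\mathfrak D(X_B))$, where $X'$ is $X$ with one crossing switched, $X_A$ is the $A$-smoothing and $X_B$ the other smoothing of $X$ at this crossing. Then $J(D;a,t)=R(B_D)$ and $\mathfrak J(D;A)=J(D;a=-A^3,t=A)$. -/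

import Mathlib

open scoped Graph

/-! ### Abstract graphs: connected components, first Betti number, the polynomial `h` -/

namespace Graph

variable {α β : Type*}

/-- The number `μ(G)` of connected components. -/
noncomputable def numComponents (G : Graph α β) : ℕ :=
  Nat.card (Quot fun x y : V(G) => G.Adj x y)

open Classical in
/-- The boundary map `C₁(G; 𝔽₂) → C₀(G; 𝔽₂)`: an edge which is not a loop goes to the sum of its two
ends, and a loop goes to `0`. -/
noncomputable def boundary (G : Graph α β) [Finite β] :
    (E(G) → ZMod 2) →ₗ[ZMod 2] (V(G) → ZMod 2) :=
  letI := Fintype.ofFinite E(G)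
  Matrix.mulVecLin (Matrix.of fun v e => if G.IsNonloopAt (e : β) (v : α) then 1 else 0)

/-- The first Betti number `β(G) = dim H₁(G)`. The homology of a graph is torsion free, so this
does not depend on the field of coefficients. -/
noncomputable def bettiOne (G : Graph α β) [Finite β] : ℕ :=
  Module.finrank (ZMod 2) (LinearMap.ker G.boundary)

/-- `h(G; x, y) = ∑_{F ⊆ E(G)} (-x)^{-|F|} x^{μ(G - F)} y^{β(G - F)}`. -/
noncomputable def hPoly {K : Type*} [Field K] (G : Graph α β) [Finite β] (x y : K) : K :=
  ∑ F ∈ (Set.toFinite E(G)).toFinset.powerset,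
    (-x) ^ (-(F.card : ℤ)) *
      x ^ (G.deleteEdges (F : Set β)).numComponents * y ^ (G.deleteEdges (F : Set β)).bettiOne

end Graph

/-! ### Link diagrams and the Dubrovnik polynomial -/

/-- What is seen at a site of a link diagram. A site has four slots `0, 1, 2, 3` in
counterclockwise order. It is either a crossing of the strands `0–2` and `1–3`, with the named
strand passing under, or a smoothed crossing, where two disjoint arcs join the named slots. -/
inductive SiteState
  /-- a crossing where the strand `0–2` passes under the strand `1–3` -/
  | under02
  /-- a crossing where the strand `1–3` passes under the strand `0–2` -/
  | under13
  /-- two arcs `0–1` and `2–3` -/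
  | smooth01
  /-- two arcs `0–3` and `1–2` -/
  | smooth03
  deriving DecidableEq

namespace SiteState

/-- The site is a crossing. -/
def IsCrossing : SiteState → Prop
  | under02 | under13 => True
  | smooth01 | smooth03 => False

/-- The slot at which a strand entering at slot `i` leaves. -/
def pairing : SiteState → Fin 4 → Fin 4
  | under02, i | under13, i => i + 2
  | smooth01, i => 1 - i
  | smooth03, i => 3 - i

/-- Exchange of over- and underpass. -/
def switch : SiteState → SiteState
  | under02 => under13
  | under13 => under02
  | s => s

/-- The `A`-smoothing of a crossing: it joins the two regions swept out by the over-strand when it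
is turned counterclockwise. -/
def smoothA : SiteState → SiteState
  | under02 => smooth01
  | under13 => smooth03
  | s => s

/-- The other smoothing of a crossing. -/
def smoothB : SiteState → SiteState
  | under02 => smooth03
  | under13 => smooth01
  | s => s

theorem pairing_switch (s : SiteState) : s.switch.pairing = s.pairing := by
  cases s <;> rfl

theorem isCrossing_switch (s : SiteState) : s.switch.IsCrossing ↔ s.IsCrossing := by
  cases s <;> simp [switch, IsCrossing]

theorem not_isCrossing_smoothA (s : SiteState) : ¬ s.smoothA.IsCrossing := by
  cases s <;> simp [smoothA, IsCrossing]

theorem not_isCrossing_smoothB (s : SiteState) : ¬ s.smoothB.IsCrossing := by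
  cases s <;> simp [smoothB, IsCrossing]

end SiteState

/-- The combinatorial projection of a link: finitely many sites with four slots each, arcs which
connect the slots in pairs, and a number of simple closed curves which meet no site.
A link diagram (unoriented, possibly with some crossings already smoothed) is such a projection
`L` together with a map `m : L.Site → SiteState`. -/
structure LinkProjection where
  /-- the sites -/
  Site : Type
  [fintypeSite : Fintype Site]
  [decidableEqSite : DecidableEq Site]
  /-- the slot at the other end of the arc which leaves from a slot -/
  glue : Site × Fin 4 → Site × Fin 4
  glue_glue : ∀ d, glue (glue d) = d
  glue_ne : ∀ d, glue d ≠ d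
  /-- the number of simple closed curves which meet no site -/
  circles : ℕ

namespace LinkProjection

attribute [instance] fintypeSite decidableEqSite

variable (L : LinkProjection)

/-- The slots. -/
abbrev Slot : Type := L.Site × Fin 4

/-- The slot at which a strand entering a site at the slot `d` leaves this site. -/
def turn (m : L.Site → SiteState) (d : L.Slot) : L.Slot :=
  (d.1, (m d.1).pairing d.2)

/-- The set of link components (without the circles which meet no site), for a map `τ` which
describes how strands pass through the sites. -/
def Component (τ : L.Slot → L.Slot) : Type :=
  Quot fun d e : L.Slot => e = L.glue d ∨ e = τ d

/-- The component through a slot. -/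
def component (τ : L.Slot → L.Slot) (d : L.Slot) : L.Component τ := Quot.mk _ d

/-- The number of components of a link diagram. -/
noncomputable def numComponents (m : L.Site → SiteState) : ℕ :=
  Nat.card (L.Component (L.turn m)) + L.circles

/-- An (arbitrary) numbering of the slots, used to order, orient and base the components. -/
noncomputable def rank (d : L.Slot) : ℕ := Fintype.equivFin L.Slot d

/-- The base point of the component through `d`: its slot of least rank. The component is
traversed starting by entering a site at the base slot. -/
noncomputable def base (τ : L.Slot → L.Slot) (d : L.Slot) : L.Slot :=
  Function.argminOn L.rank {e | L.component τ e = L.component τ d} ⟨d, rfl⟩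

/-- The slot at which the `k`-th site is entered on the traversal of the component of `d`
(starting with `k = 0`). -/
noncomputable def entry (τ : L.Slot → L.Slot) (d : L.Slot) (k : ℕ) : L.Slot :=
  (fun e => L.glue (τ e))^[k] (L.base τ d)

/-- The strand at slot `d` enters its site there (rather than leaving it). -/
def IsEntry (τ : L.Slot → L.Slot) (d : L.Slot) : Prop := ∃ k, L.entry τ d k = d

/-- The time at which, on the traversal of its component, the strand piece of the slots
`d` and `τ d` is passed. -/
noncomputable def time (τ : L.Slot → L.Slot) (d : L.Slot) : ℕ :=
  sInf {k | L.entry τ d k = d ∨ L.entry τ d k = τ d}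

/-- When the components are traversed one after the other, the strand piece at slot `d` is passed
before the one at slot `e`. -/
def PassedBefore (τ : L.Slot → L.Slot) (d e : L.Slot) : Prop :=
  L.rank (L.base τ d) < L.rank (L.base τ e) ∨
    L.base τ d = L.base τ e ∧ L.time τ d < L.time τ e

/-- A crossing is ascending if it is passed on its under-strand first. -/
def IsAscending (m : L.Site → SiteState) (x : L.Site) : Prop :=
  match m x with
  | .under02 => L.PassedBefore (L.turn m) (x, 0) (x, 1)
  | .under13 => L.PassedBefore (L.turn m) (x, 1) (x, 0)
  | .smooth01 | .smooth03 => False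

open Classical in
/-- The contribution of a site to the self-writhe: the sign of the crossing if it is a crossing of
a component with itself, and `0` otherwise. -/
noncomputable def selfSign (m : L.Site → SiteState) (x : L.Site) : ℤ :=
  if L.component (L.turn m) (x, 0) = L.component (L.turn m) (x, 1) then
    match m x with
    | .under02 =>
      if L.IsEntry (L.turn m) (x, 0) ↔ L.IsEntry (L.turn m) (x, 1) then -1 else 1
    | .under13 =>
      if L.IsEntry (L.turn m) (x, 0) ↔ L.IsEntry (L.turn m) (x, 1) then 1 else -1
    | .smooth01 | .smooth03 => 0
  else 0

/-- The self-writhe: the sum of the signs of the self-crossings of all components. -/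
noncomputable def selfWrithe (m : L.Site → SiteState) : ℤ := ∑ x, L.selfSign m x

/-- Replace what is seen at the site `x`. -/
def modify (m : L.Site → SiteState) (x : L.Site) (f : SiteState → SiteState) :
    L.Site → SiteState :=
  Function.update m x (f (m x))

open Classical in
/-- The number of crossings. -/
noncomputable def numCrossings (m : L.Site → SiteState) : ℕ :=
  (Finset.univ.filter fun x => (m x).IsCrossing).card

open Classical in
/-- The number of ascending crossings. -/
noncomputable def numAscending (m : L.Site → SiteState) : ℕ :=
  (Finset.univ.filter fun x => L.IsAscending m x).card

theorem turn_modify_switch (m : L.Site → SiteState) (x : L.Site) :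
    L.turn (L.modify m x SiteState.switch) = L.turn m := by
  funext ⟨y, i⟩
  by_cases h : y = x
  · subst h; simp [turn, modify, SiteState.pairing_switch]
  · simp [turn, modify, h]

theorem isCrossing_of_isAscending {m : L.Site → SiteState} {x : L.Site}
    (h : L.IsAscending m x) : (m x).IsCrossing := by
  unfold IsAscending at h
  cases hx : m x <;> simp_all [SiteState.IsCrossing]

theorem numCrossings_modify_lt {m : L.Site → SiteState} {x : L.Site}
    {f : SiteState → SiteState} (hf : ∀ s, ¬ (f s).IsCrossing) (h : L.IsAscending m x) :
    L.numCrossings (L.modify m x f) < L.numCrossings m := by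
  classical
  apply Finset.card_lt_card
  rw [Finset.ssubset_iff_of_subset]
  · refine ⟨x, Finset.mem_filter.2 ⟨Finset.mem_univ _, L.isCrossing_of_isAscending h⟩, ?_⟩
    rw [Finset.mem_filter]
    simp [modify, hf]
  · intro y hy
    rw [Finset.mem_filter] at hy ⊢
    by_cases hyx : y = x
    · subst hyx; simp [modify, hf] at hy
    · simpa [modify, hyx] using hy

theorem numCrossings_modify_switch (m : L.Site → SiteState) (x : L.Site) :
    L.numCrossings (L.modify m x SiteState.switch) = L.numCrossings m := by
  classical
  unfold numCrossings
  congr 1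
  ext y
  rw [Finset.mem_filter, Finset.mem_filter]
  by_cases hyx : y = x
  · subst hyx; simp [modify, SiteState.isCrossing_switch]
  · simp [modify, hyx]

theorem PassedBefore.asymm {τ : L.Slot → L.Slot} {d e : L.Slot}
    (h : L.PassedBefore τ d e) : ¬ L.PassedBefore τ e d := by
  rintro (h' | ⟨h', h''⟩)
  · rcases h with h | ⟨h, -⟩
    · omega
    · rw [h] at h'; omega
  · rcases h with h | ⟨-, h⟩
    · rw [h'] at h; omega
    · omega

theorem numAscending_modify_switch_lt {m : L.Site → SiteState} {x : L.Site}
    (h : L.IsAscending m x) :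
    L.numAscending (L.modify m x SiteState.switch) < L.numAscending m := by
  classical
  have key : ¬ L.IsAscending (L.modify m x SiteState.switch) x := by
    have hm : L.modify m x SiteState.switch x = (m x).switch := by simp [modify]
    unfold IsAscending at h ⊢
    rw [turn_modify_switch, hm]
    cases hx : m x <;> simp only [hx, SiteState.switch] at h ⊢
    · exact PassedBefore.asymm L h
    · exact PassedBefore.asymm L h
  apply Finset.card_lt_card
  rw [Finset.ssubset_iff_of_subset]
  · exact ⟨x, by simpa using h, by simpa using key⟩
  · intro y hy
    by_cases hyx : y = x
    · subst hyx; simp [key] at hy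
    · have hm : L.modify m x SiteState.switch y = m y := by simp [modify, hyx]
      simp only [Finset.mem_filter, Finset.mem_univ, true_and] at hy ⊢
      unfold IsAscending at hy ⊢
      rwa [turn_modify_switch, hm] at hy

open Classical in
/-- Kauffman's Dubrovnik polynomial `𝔇(L; a, z)` of a link diagram, an invariant of regular
isotopy, with the value `1` at the simple circle, computed from its skein relation
`𝔇(X) - 𝔇(X') = z (𝔇(X_A) - 𝔇(X_B))`, where `X'` is `X` with a crossing switched and
`X_A`, `X_B` are its two smoothings, and from its values `a ^ w * δ ^ (c - 1)`,
`δ = (a - a⁻¹) / z + 1`, on the descending diagrams with `c` components and self-writhe `w`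
(these diagrams represent trivial links; a curl of sign `±1` multiplies `𝔇` by `a ^ (±1)`
and a disjoint circle multiplies it by `δ`). -/
noncomputable def dubrovnik {K : Type*} [Field K] (a z : K) (m : L.Site → SiteState) : K :=
  if h : ∃ x, L.IsAscending m x then
    dubrovnik a z (L.modify m h.choose SiteState.switch) +
      z * (dubrovnik a z (L.modify m h.choose SiteState.smoothA) -
        dubrovnik a z (L.modify m h.choose SiteState.smoothB))
  else
    a ^ L.selfWrithe m * ((a - a⁻¹) / z + 1) ^ ((L.numComponents m : ℤ) - 1)
termination_by (L.numCrossings m, L.numAscending m)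
decreasing_by
  · rw [numCrossings_modify_switch]
    exact Prod.Lex.right _ (L.numAscending_modify_switch_lt h.choose_spec)
  · exact Prod.Lex.left _ _
      (L.numCrossings_modify_lt SiteState.not_isCrossing_smoothA h.choose_spec)
  · exact Prod.Lex.left _ _
      (L.numCrossings_modify_lt SiteState.not_isCrossing_smoothB h.choose_spec)

end LinkProjection

/-! ### Diagrams of spatial graphs -/

/-- Combinatorial data of a spatial graph diagram, without the condition that it lies in the plane.
The projection of the spatial graph is cut at the vertices and at the crossings into arcs.
The arc `e` has the two ends `(e, false)` and `(e, true)`.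
The vertex `v` has the ports `⟨v, 0⟩, …, ⟨v, deg v - 1⟩` in counterclockwise cyclic order.
The crossing `c` has the ports `(c, 0), (c, 1), (c, 2), (c, 3)` in counterclockwise
order, and the strand `0–2` passes under the strand `1–3`.
Every end of an arc is attached to one port. -/
structure DiagramData where
  /-- the vertices -/
  V : Type
  /-- the crossings -/
  C : Type
  /-- the arcs -/
  E : Type
  [fintypeV : Fintype V]
  [decidableEqV : DecidableEq V]
  [fintypeC : Fintype C]
  [decidableEqC : DecidableEq C]
  [fintypeE : Fintype E]
  [decidableEqE : DecidableEq E]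
  /-- the number of ends of arcs at a vertex -/
  deg : V → ℕ
  /-- the port to which an end of an arc is attached -/
  attach : E × Bool ≃ (Σ v, Fin (deg v)) ⊕ (C × Fin 4)

namespace DiagramData

attribute [instance] fintypeV decidableEqV fintypeC decidableEqC fintypeE decidableEqE

variable (D : DiagramData)

/-- The ports. -/
abbrev Port : Type := (Σ v, Fin (D.deg v)) ⊕ (D.C × Fin 4)

/-- The counterclockwise next port at the same vertex. -/
def rotVertex : Equiv.Perm (Σ v, Fin (D.deg v)) :=
  Equiv.sigmaCongrRight fun v => finRotate (D.deg v)

/-- The counterclockwise next port at the same vertex or crossing. -/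
def rot : Equiv.Perm D.Port :=
  Equiv.sumCongr D.rotVertex (Equiv.prodCongrRight fun _ => finRotate 4)

/-- The port at the other end of the arc. -/
def flip (p : D.Port) : D.Port :=
  D.attach ((D.attach.symm p).1, !(D.attach.symm p).2)

/-- The diagram lies in the plane (or sphere): Euler's formula
`#(vertices and crossings) - #arcs + #faces = 2 * #(connected components)` holds for the cellular
surface defined by the cyclic orders at the vertices and crossings. Here components are those of
the projection, and vertices of degree `0` are left out. -/
def IsPlane : Prop :=
  Nat.card (Quot fun p q : D.Port => q = D.rot p) +
      Nat.card (Quot fun p q : D.Port => q = D.rot (D.flip p)) =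
    Fintype.card D.E +
      2 * Nat.card (Quot fun p q : D.Port => q = D.rot p ∨ q = D.flip p)

/-- The edges of the spatial graph: the arcs, where the arcs which meet at opposite ports of a
crossing are identified. -/
def Strand : Type :=
  Quot fun e e' : D.E => ∃ (c : D.C) (i : Fin 4),
    (D.attach.symm (Sum.inr (c, i))).1 = e ∧ (D.attach.symm (Sum.inr (c, i + 2))).1 = e'

/-- The edge of the spatial graph which contains an arc. -/
def strand (e : D.E) : D.Strand := Quot.mk _ e

/-- The ports of vertices at which an edge of the spatial graph ends. -/
def endPorts (q : D.Strand) : Set (Σ v, Fin (D.deg v)) :=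
  {p | D.strand (D.attach.symm (Sum.inl p)).1 = q}

/-! #### The Yamada polynomial -/

/-- The vertex of the state graph at a port. At a crossing `c`, the state `1` replaces the crossing
by its `A`-smoothing with arcs `0–1` and `2–3`, the state `-1` by its smoothing with arcs `0–3` and
`1–2`, and the state `0` by a vertex of degree `4`. -/
def stateVertex (s : D.C → SignType) : D.Port → D.V ⊕ (D.C × Bool)
  | Sum.inl p => Sum.inl p.1
  | Sum.inr (c, i) => Sum.inr (c,
      match s c with
      | .pos => i = 2 ∨ i = 3
      | .neg => i = 1 ∨ i = 2
      | .zero => false)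

/-- The abstract graph represented by the diagram `D_s` without crossings, which is obtained from
`D` by replacing the crossings according to the state `s`. As a topological space it
is `D_s`; each of the two arcs at a smoothed crossing is marked by a vertex of degree `2`, so that
its edges are the arcs of `D`. -/
def stateGraph (s : D.C → SignType) : Graph (D.V ⊕ (D.C × Bool)) D.E where
  vertexSet := {x | ∀ c, x = Sum.inr (c, true) → s c ≠ 0}
  edgeSet := Set.univ
  IsLink e x y :=
    (x = D.stateVertex s (D.attach (e, false)) ∧ y = D.stateVertex s (D.attach (e, true))) ∨
    (x = D.stateVertex s (D.attach (e, true)) ∧ y = D.stateVertex s (D.attach (e, false)))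
  isLink_symm _ _ := ⟨fun _ _ h => h.symm.imp And.symm And.symm⟩
  eq_or_eq_of_isLink_of_isLink := by
    rintro e x y v w (⟨rfl, rfl⟩ | ⟨rfl, rfl⟩) (⟨rfl, rfl⟩ | ⟨rfl, rfl⟩) <;> simp
  edge_mem_iff_exists_isLink e := by
    simp only [Set.mem_univ, true_iff]
    exact ⟨_, _, Or.inl ⟨rfl, rfl⟩⟩
  left_mem_of_isLink := by
    have key : ∀ p c, D.stateVertex s p = Sum.inr (c, true) → s c ≠ 0 := by
      rintro (p | ⟨c', i⟩) c h
      · simp [stateVertex] at h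
      · simp only [stateVertex, Sum.inr.injEq, Prod.mk.injEq] at h
        obtain ⟨rfl, h⟩ := h
        intro h0
        have h0' : s c' = SignType.zero := h0
        rw [h0'] at h
        simp at h
    rintro e x y (⟨rfl, -⟩ | ⟨rfl, -⟩) c h
    · exact key _ c h
    · exact key _ c h

/-- The Yamada polynomial
`Y(D; A) = ∑_s A^{p(s) - m(s)} h(D_s; -1, -A - 2 - A⁻¹)`, the sum over all states `s`. -/
noncomputable def yamada {K : Type*} [Field K] (A : K) : K :=
  ∑ s : D.C → SignType,
    A ^ (((Finset.univ.filter fun c => s c = 1).card : ℤ) -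
        ((Finset.univ.filter fun c => s c = -1).card : ℤ)) *
      (D.stateGraph s).hPoly (-1) (-A - 2 - A⁻¹)

/-! #### The bar diagram and the Jaeger polynomial

Every vertex of the diagram is replaced by a disc and every arc by a strip, and the strips
cross each other at the crossings. The boundary of a strip consists of two strands, so a crossing
`c` gives four sites: the site `(c, k)` lies in the quadrant of `c` between the ports `k` and
`k + 1`, and its slots `0, 1, 2, 3` point to the same directions as the ports `0, 1, 2, 3` of `c`.
Every strip `e` has one bar, which is a site, too: if the strip is drawn horizontally with its
end `(e, false)` on the left, then the slots `0, 1, 2, 3` of this site are the lower left, lower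
right, upper right and upper left one. -/

/-- The slot of the bar of a strip which is on the given side (`true` for left, `false` for right)
at the given end, as seen when entering the strip at this end. -/
def stripCorner : (atEnd left : Bool) → Fin 4
  | false, true => 3
  | false, false => 0
  | true, true => 1
  | true, false => 2

/-- The end of the strip and the side (`true` for left, `false` for right, as seen when entering the
strip at this end) where the slot of a bar is. -/
def stripSide : Fin 4 → Bool × Bool
  | 0 => (false, false)
  | 1 => (true, true)
  | 2 => (true, false)
  | 3 => (false, true)

/-- The sites of the bar diagram. -/
abbrev BarSite : Type := (D.C × Fin 4) ⊕ D.E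

/-- The slot which the given side (`true` for left, `false` for right) of the strip starting at
the port `p` leads to. -/
def barSlot (p : D.Port) (left : Bool) : D.BarSite × Fin 4 :=
  (Sum.inr (D.attach.symm p).1, stripCorner (D.attach.symm p).2 left)

/-- The slot to which the given side (`true` for left, `false` for right) of the strip starting at
the port `p` is connected at the vertex or crossing of `p`: at a vertex the left side of a strip is
connected to the right side of the counterclockwise next strip. -/
def portSlot : D.Port → Bool → D.BarSite × Fin 4
  | Sum.inl p, true => D.barSlot (Sum.inl (D.rotVertex p)) false
  | Sum.inl p, false => D.barSlot (Sum.inl (D.rotVertex.symm p)) true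
  | Sum.inr (c, i), true => (Sum.inl (c, i), i)
  | Sum.inr (c, i), false => (Sum.inl (c, i - 1), i)

/-- How the slots of the bar diagram are connected. -/
def barGlue : D.BarSite × Fin 4 → D.BarSite × Fin 4
  | (Sum.inr e, j) => D.portSlot (D.attach (e, (stripSide j).1)) (stripSide j).2
  | (Sum.inl (c, k), j) =>
    match j - k with
    | 0 => D.barSlot (Sum.inr (c, k)) true
    | 1 => D.barSlot (Sum.inr (c, k + 1)) false
    | 2 => (Sum.inl (c, k + 1), k)
    | 3 => (Sum.inl (c, k - 1), k + 1)

theorem barGlue_barSlot (p : D.Port) (b : Bool) :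
    D.barGlue (D.barSlot p b) = D.portSlot p b := by
  have h : ∀ a b, stripSide (stripCorner a b) = (a, b) := by decide
  simp [barGlue, barSlot, h]

theorem barGlue_portSlot (p : D.Port) (b : Bool) :
    D.barGlue (D.portSlot p b) = D.barSlot p b := by
  rcases p with p | ⟨c, i⟩ <;> cases b
  · simp [portSlot, barGlue_barSlot]
  · simp [portSlot, barGlue_barSlot]
  · have h : ∀ i : Fin 4, i - (i - 1) = 1 := by decide
    have h' : ∀ i : Fin 4, i - 1 + 1 = i := by decide
    simp [portSlot, barGlue, h, h']
  · simp [portSlot, barGlue]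

theorem barSlot_stripSide (e : D.E) (j : Fin 4) :
    D.barSlot (D.attach (e, (stripSide j).1)) (stripSide j).2 = (Sum.inr e, j) := by
  have h : ∀ j, stripCorner (stripSide j).1 (stripSide j).2 = j := by decide
  simp [barSlot, h]

theorem barSlot_injective (p q : D.Port) (b b' : Bool) (h : D.barSlot p b = D.barSlot q b') :
    b = b' := by
  have h1 := D.barGlue_barSlot p b
  simp only [barSlot, Prod.mk.injEq, Sum.inr.injEq] at h
  have h2 : ∀ a a' b b', stripCorner a b = stripCorner a' b' → b = b' := by decide
  exact h2 _ _ _ _ h.2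

theorem barGlue_barGlue (d : D.BarSite × Fin 4) : D.barGlue (D.barGlue d) = d := by
  rcases d with ⟨⟨c, k⟩ | e, j⟩
  · obtain ⟨i, rfl⟩ : ∃ i, j = i + k := ⟨j - k, by simp⟩
    fin_cases i
    · have h1 : D.barGlue (Sum.inl (c, k), 0 + k) = D.barSlot (Sum.inr (c, k)) true := by
        simp [barGlue]
      simp only [Fin.zero_eta, h1, barGlue_barSlot]
      simp [portSlot]
    · have h1 : D.barGlue (Sum.inl (c, k), 1 + k) = D.barSlot (Sum.inr (c, k + 1)) false := by
        simp [barGlue]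
      simp only [Fin.mk_one, h1, barGlue_barSlot]
      simp [portSlot, add_comm]
    · have h1 : ∀ k : Fin 4, k - (k + 1) = 3 := by decide
      have h2 : ∀ k : Fin 4, k + 1 + 1 = 2 + k := by decide
      simp [barGlue, h1, h2]
    · have h2 : ∀ k : Fin 4, k - 1 = 3 + k := by decide
      have h3 : ∀ k : Fin 4, 3 + k + 1 = k := by decide
      have h4 : ∀ k : Fin 4, k + 1 - (3 + k) = 2 := by decide
      simp [barGlue, h2, h3, h4]
  · rw [← D.barSlot_stripSide e j, barGlue_barSlot, barGlue_portSlot]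

theorem barGlue_ne (d : D.BarSite × Fin 4) : D.barGlue d ≠ d := by
  rcases d with ⟨⟨c, k⟩ | e, j⟩
  · obtain ⟨i, rfl⟩ : ∃ i, j = i + k := ⟨j - k, by simp⟩
    fin_cases i <;> simp [barGlue, barSlot]
  · rw [← D.barSlot_stripSide e j, barGlue_barSlot]
    generalize D.attach (e, (stripSide j).1) = p
    generalize (stripSide j).2 = b
    intro h
    rcases p with p | ⟨c, i⟩ <;> cases b
    · simpa using D.barSlot_injective _ _ _ _ h
    · simpa using D.barSlot_injective _ _ _ _ h
    · simp [portSlot, barSlot] at h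
    · simp [portSlot, barSlot] at h

/-- The bar diagram `B_D`, as a projection whose sites are the crossings of strands and the bars.
The boundary of the disc of a vertex of degree `0` is a simple circle. -/
def barDiagram : LinkProjection where
  Site := D.BarSite
  glue := D.barGlue
  glue_glue := D.barGlue_barGlue
  glue_ne := D.barGlue_ne
  circles := Fintype.card {v // D.deg v = 0}

/-- The three ways to resolve a strip with a bar. -/
inductive BarChoice
  /-- a strip with a half twist -/
  | halfTwist
  /-- a strip without bar -/
  | plain
  /-- the smoothing, where the strip is cut -/
  | cut
  deriving DecidableEq

instance : Fintype BarChoice where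
  elems := {.halfTwist, .plain, .cut}
  complete x := by cases x <;> simp

/-- What is seen at the site of a bar which has been resolved. -/
def BarChoice.state : BarChoice → SiteState
  | halfTwist => .under02
  | plain => .smooth01
  | cut => .smooth03

/-- The coefficients of the defining relation for a bar,
`R(bar) = (R(half twist) + t⁻¹ R(no bar) + (t - t⁻¹) / (1 - a t) R(cut)) / (t + t⁻¹)`. -/
noncomputable def BarChoice.weight {K : Type*} [Field K] (a t : K) : BarChoice → K
  | halfTwist => 1 / (t + t⁻¹)
  | plain => 1 / (t + t⁻¹) * t⁻¹
  | cut => 1 / (t + t⁻¹) * ((t - t⁻¹) / (1 - a * t))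

/-- The diagram of the link bounding the band diagram without bars, which is obtained from the bar
diagram by resolving all bars as prescribed by `f`. -/
def resolve (f : D.E → BarChoice) : D.barDiagram.Site → SiteState
  | Sum.inl _ => .under02
  | Sum.inr e => (f e).state

/-- The Jaeger polynomial `J(D; a, t) = R(B_D)`: the defining relation is applied to all the bars,
and a band diagram without bars is evaluated by the Dubrovnik polynomial of its boundary
at `z = t - t⁻¹`. -/
noncomputable def jaeger {K : Type*} [Field K] (a t : K) : K :=
  ∑ f : D.E → BarChoice,
    (∏ e, (f e).weight a t) * D.barDiagram.dubrovnik a (t - t⁻¹) (D.resolve f)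

/-- Jaeger's version of the Yamada polynomial, `𝔍(D; A) = J(D; a = -A³, t = A)`. -/
noncomputable def jaegerYamada {K : Type*} [Field K] (A : K) : K :=
  D.jaeger (-A ^ 3) A

end DiagramData

/-- A diagram (in the plane) of a spatial graph. Every connected component of the spatial graph
has a vertex: a circle is a loop with one vertex. -/
structure SpatialGraphDiagram extends DiagramData where
  isPlane : toDiagramData.IsPlane

/-- `D` is a diagram of a spatial embedding of the graph `G`: the vertices and edges of the
spatial graph given by `D` correspond to the vertices and edges of `G`, so that every edge has two
ends and joins the right vertices. -/
def SpatialGraphDiagram.IsDiagramOf {α β : Type*} (D : SpatialGraphDiagram) (G : Graph α β) :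
    Prop :=
  ∃ (φ : D.V ≃ V(G)) (ψ : D.Strand ≃ E(G)), ∀ q : D.Strand,
    ∃ p p', p ≠ p' ∧ D.endPorts q = {p, p'} ∧ G.IsLink (ψ q) (φ p.1) (φ p'.1)

/-! At `a = -A³`, `z = A - A⁻¹` the Dubrovnik polynomial is the Kauffman bracket, normalized to `1`
at the circle and with loop value `δ = -(A² + A⁻²)` (`dubrovnik_eq_bracket`). Both obey the same
skein relation, so they need only be compared at the descending diagrams where the recursion stops:
there the bracket must be `(-A³)^w δ^(c-1)` (`bracket_eq_descendingValue`).

This is shown without Reidemeister moves, by induction on the number of crossings. One crossing is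
resolved, chosen so that both smoothings are again descending for a suitable traversal. At a
self-crossing which closes up a loop, one smoothing detaches the loop and the other reverses it; at
a crossing of two components without self-crossings, both smoothings merge them. The values of the
smoothings add up by `curl_identity` and `loop_identity`. Their writhes are known because two closed
curves in the plane cross algebraically zero times (`pairSum_formalSign`). Here planarity enters:
Euler's formula makes every cycle a boundary (`exists_potential_of_euler`), and this property passes
from `D` to its bar diagram (`hasPotentials`).

In the bracket, a bar becomes the Jones–Wenzl idempotent on two strands: the uncut strip minus `δ⁻¹`
times the cut strip (`sum_barChoice`). It vanishes when the strip turns back (`stripSum_eq_zero`).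
Among the 16 smoothings of the four sites where two strips cross, this leaves the two smoothings of
the crossing, with coefficients `A⁴` and `A⁻⁴`, and the patterns which fuse the strips into a vertex
of degree 4, with total coefficient `A² + A⁻²` (`stripSum_expand`, `sum_quadrantWeight`). Thus `𝔍`
becomes a sum over the states of the Yamada polynomial.

For a fixed state `s` and a set `F` of cut strips, the curves bound a plane ribbon surface with core
`D_s - F`, so there are `μ + β` of them (`numComponents_ribbonState_compl`). With the Euler relation
`β = |E| - |F| - |V| + μ`, the terms match those of `h(D_s; -1, -(A² + A⁻²)²)` one by one
(`hPoly_stateGraph`). The exponent of `A² + A⁻²` belonging to `D_s` exceeds the one belonging to `G`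
by the number of crossings in state `0`, which is the power contained in the crossing weights. -/

/-! ### Potentials on plane maps -/

/-- On a map (given by the rotation `r` and the edge involution `f` of its set `X` of darts) which
satisfies Euler's formula, every cycle is a boundary: a flow `z` on the darts which is conserved at
every vertex is the jump of a function `κ` on the faces. -/
theorem exists_potential_of_euler {X : Type*} [Fintype X] (r : Equiv.Perm X) (f : X → X)
    (hf : ∀ p, f (f p) = p) {n : ℕ}
    (euler : Nat.card (Quot fun p q : X => q = r p) + Nat.card (Quot fun p q : X => q = r (f p)) =
      n + 2 * Nat.card (Quot fun p q : X => q = r p ∨ q = f p))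
    (hn : ∀ A : Submodule ℚ (X → ℚ), (∀ z ∈ A, ∀ p, z (f p) = - z p) → Module.finrank ℚ A ≤ n)
    (z : X → ℚ) (hz : ∀ p, z (f p) = - z p)
    (hsum : ∀ g : X → ℚ, (∀ p, g (r p) = g p) → ∑ p, z p * g p = 0) :
    ∃ κ : X → ℚ, (∀ p, κ (r (f p)) = κ p) ∧ ∀ p, κ (r p) - κ p = z p := by
  classical
  set QV := Quot fun p q : X => q = r p
  set QF := Quot fun p q : X => q = r (f p)
  set QC := Quot fun p q : X => q = r p ∨ q = f p
  let _ : Fintype QV := Fintype.ofFinite _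
  let _ : Fintype QF := Fintype.ofFinite _
  let _ : Fintype QC := Fintype.ofFinite _
  let mV : X → QV := Quot.mk _
  let mF : X → QF := Quot.mk _
  let mC : X → QC := Quot.mk _
  have hmV : ∀ p, mV (r p) = mV p := fun p => Eq.symm (Quot.sound (r := fun p q => q = r p) rfl)
  have hmF : ∀ p, mF (r (f p)) = mF p := fun p => Eq.symm (Quot.sound (r := fun p q => q = r (f p)) rfl)
  have hmCr : ∀ p, mC (r p) = mC p := fun p => Eq.symm (Quot.sound (r := fun p q => q = r p ∨ q = f p) (Or.inl rfl))
  have hmCf : ∀ p, mC (f p) = mC p := fun p => Eq.symm (Quot.sound (r := fun p q => q = r p ∨ q = f p) (Or.inr rfl))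
  -- `T` is the jump of a face function across a dart, `d` the coboundary of a vertex function. The
  -- claim is that `T` maps onto the cycle space `Z`; it is obtained from ranks.
  let T : (QF → ℚ) →ₗ[ℚ] (X → ℚ) :=
    { toFun := fun κ p => κ (mF (r p)) - κ (mF p)
      map_add' := fun _ _ => by funext p; simp; ring
      map_smul' := fun _ _ => by funext p; simp; ring }
  let d : (QV → ℚ) →ₗ[ℚ] (X → ℚ) :=
    { toFun := fun g p => g (mV p) - g (mV (f p))
      map_add' := fun _ _ => by funext p; simp; ring
      map_smul' := fun _ _ => by funext p; simp; ring }
  let jF : QF → QC := Quot.lift mC (by rintro p _ rfl; rw [hmCr, hmCf])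
  let jV : QV → QC := Quot.lift mC (by rintro p _ rfl; rw [hmCr])
  -- A face function without jumps is constant on connected components; likewise for a vertex
  -- function with zero coboundary.
  have kerT : Module.finrank ℚ (LinearMap.ker T) ≤ Fintype.card QC := by
    rw [← Module.finrank_fintype_fun_eq_card ℚ (η := QC)]
    refine le_trans ?_ (LinearMap.finrank_range_le (LinearMap.funLeft ℚ ℚ jF))
    apply Submodule.finrank_mono
    intro κ hκ
    have h1 : ∀ p, κ (mF (r p)) = κ (mF p) := fun p => sub_eq_zero.1 (congrFun hκ p)
    refine ⟨Quot.lift (fun p => κ (mF p)) ?_, ?_⟩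
    · rintro p _ (rfl | rfl)
      · exact (h1 p).symm
      · exact (congrArg κ (hmF p)).symm.trans (h1 (f p))
    · funext q
      obtain ⟨p, rfl⟩ := Quot.exists_rep q
      rfl
  have kerd : Module.finrank ℚ (LinearMap.ker d) ≤ Fintype.card QC := by
    rw [← Module.finrank_fintype_fun_eq_card ℚ (η := QC)]
    refine le_trans ?_ (LinearMap.finrank_range_le (LinearMap.funLeft ℚ ℚ jV))
    apply Submodule.finrank_mono
    intro g hg
    have h1 : ∀ p, g (mV p) = g (mV (f p)) := fun p => sub_eq_zero.1 (congrFun hg p)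
    refine ⟨Quot.lift (fun p => g (mV p)) ?_, ?_⟩
    · rintro p _ (rfl | rfl)
      · exact (congrArg g (hmV p)).symm
      · exact h1 p
    · funext q
      obtain ⟨p, rfl⟩ := Quot.exists_rep q
      rfl
  let Z : Submodule ℚ (X → ℚ) :=
    { carrier := {z | (∀ p, z (f p) = - z p) ∧
        ∀ g : X → ℚ, (∀ p, g (r p) = g p) → ∑ p, z p * g p = 0}
      add_mem' := by
        rintro a b ⟨ha, ha'⟩ ⟨hb, hb'⟩
        refine ⟨fun p => by simp [ha, hb]; ring, fun g hg => ?_⟩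
        simp [add_mul, Finset.sum_add_distrib, ha' g hg, hb' g hg]
      zero_mem' := by simp
      smul_mem' := by
        rintro c a ⟨ha, ha'⟩
        refine ⟨fun p => by simp [ha], fun g hg => ?_⟩
        simp [mul_assoc, ← Finset.mul_sum, ha' g hg] }
  let F : Equiv.Perm X := ⟨f, f, hf, hf⟩
  have hF : ∀ g : X → ℚ, ∑ p, g (f p) = ∑ p, g p := fun g => Equiv.sum_comp F g
  have hTZ : LinearMap.range T ≤ Z := by
    rintro _ ⟨κ, rfl⟩
    have anti : ∀ p, T κ (f p) = - T κ p := by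
      intro p
      change κ (mF (r (f p))) - κ (mF (f p)) = -(κ (mF (r p)) - κ (mF p))
      have := hmF (f p)
      rw [hf] at this
      rw [hmF, ← this]; ring
    refine ⟨anti, fun g hg => ?_⟩
    change ∑ p, (κ (mF (r p)) - κ (mF p)) * g p = 0
    simp only [sub_mul, Finset.sum_sub_distrib]
    rw [sub_eq_zero, ← Equiv.sum_comp r fun p => κ (mF p) * g p]
    simp only [hg]
  -- Cycles are orthogonal to coboundaries. An element of both is orthogonal to itself, and over `ℚ`
  -- a vanishing sum of squares forces it to be zero.
  have hdisj : Disjoint Z (LinearMap.range d) := by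
    rw [Submodule.disjoint_def]
    rintro z ⟨hz1, hz2⟩ ⟨g, rfl⟩
    have h1 := hz2 (fun p => g (mV p)) (fun p => by rw [hmV])
    have h2 : ∑ p, d g p * g (mV (f p)) = 0 := by
      rw [← hF]
      simp only [hz1, hf, neg_mul, Finset.sum_neg_distrib, h1, neg_zero]
    have h3 : ∑ p, d g p * d g p = 0 := by
      have : ∀ p, d g p * d g p = d g p * g (mV p) - d g p * g (mV (f p)) := fun p => by
        rw [← mul_sub]; rfl
      simp only [this, Finset.sum_sub_distrib, h1, h2, sub_zero]
    funext p
    have := (Finset.sum_eq_zero_iff_of_nonneg fun p _ => mul_self_nonneg (d g p)).1 h3 p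
      (Finset.mem_univ _)
    simpa using this
  have e1 := Submodule.finrank_sup_add_finrank_inf_eq Z (LinearMap.range d)
  rw [hdisj.eq_bot, finrank_bot, add_zero] at e1
  -- Cycles and coboundaries are antisymmetric on darts, so together they span at most one dimension
  -- per edge.
  have e2 : Module.finrank ℚ ↥(Z ⊔ LinearMap.range d) ≤ n := by
    apply hn
    intro z hz
    obtain ⟨a, ha, b, ⟨g, rfl⟩, rfl⟩ := Submodule.mem_sup.1 hz
    intro p
    have : d g (f p) = - d g p := by
      change g (mV (f p)) - g (mV (f (f p))) = -(g (mV p) - g (mV (f p)))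
      rw [hf]; ring
    simp only [Pi.add_apply, ha.1 p, this]; ring
  have e3 := LinearMap.finrank_range_add_finrank_ker T
  have e4 := LinearMap.finrank_range_add_finrank_ker d
  rw [Module.finrank_fintype_fun_eq_card] at e3 e4
  simp only [Nat.card_eq_fintype_card] at euler
  -- By Euler's formula, `dim Z ≤ n - (#vertices - #components) = #faces - #components ≤ rank T`.
  have hZT : LinearMap.range T = Z := by
    apply Submodule.eq_of_le_of_finrank_le hTZ
    have : Fintype.card QV + Fintype.card QF = n + 2 * Fintype.card QC := euler
    omega
  have hzZ : z ∈ Z := ⟨hz, hsum⟩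
  rw [← hZT] at hzZ
  obtain ⟨κ, hκ⟩ := hzZ
  exact ⟨fun p => κ (mF p), fun p => congrArg κ (hmF p), fun p => congrFun hκ p⟩

/-- Every flow on the arcs of the projection which is conserved at the sites is the jump of a
function on the regions. The corner between the slots `j` and `j + 1` of the site `x` is denoted by
`(x, j)`. This holds for projections in the plane. -/
def LinkProjection.HasPotentials (L : LinkProjection) : Prop :=
  ∀ z : L.Slot → ℚ, (∀ d, z (L.glue d) = - z d) → (∀ x, ∑ j, z (x, j) = 0) →
    ∃ κ : L.Slot → ℚ, (∀ x j, κ (x, j) - κ (x, j - 1) = z (x, j)) ∧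
      ∀ d, κ d = κ ((L.glue d).1, (L.glue d).2 - 1)

/-! ### Potentials on the bar diagram of a plane diagram -/

namespace DiagramData

variable (D : DiagramData)

theorem flip_flip (p : D.Port) : D.flip (D.flip p) = p := by
  simp [flip]

/-- An antisymmetric function on the ports is determined by its values at the ends `(e, false)`,
which gives the dimension bound needed for `exists_potential_of_euler`. -/
theorem exists_port_potential (h : D.IsPlane) (z : D.Port → ℚ) (hz : ∀ p, z (D.flip p) = - z p)
    (hsum : ∀ g : D.Port → ℚ, (∀ p, g (D.rot p) = g p) → ∑ p, z p * g p = 0) :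
    ∃ κ : D.Port → ℚ, (∀ p, κ (D.rot (D.flip p)) = κ p) ∧ ∀ p, κ (D.rot p) - κ p = z p := by
  refine exists_potential_of_euler D.rot D.flip D.flip_flip h ?_ z hz hsum
  intro A hA
  rw [← Module.finrank_fintype_fun_eq_card ℚ (η := D.E)]
  let ev : A →ₗ[ℚ] (D.E → ℚ) :=
    { toFun := fun z e => (z : D.Port → ℚ) (D.attach (e, false))
      map_add' := fun _ _ => rfl
      map_smul' := fun _ _ => rfl }
  apply LinearMap.finrank_le_finrank_of_injective (f := ev)
  rw [injective_iff_map_eq_zero]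
  rintro ⟨z, hz⟩ h0
  ext p
  obtain ⟨⟨e, b⟩, rfl⟩ := D.attach.surjective p
  have h1 : z (D.attach (e, false)) = 0 := congrFun h0 e
  cases b
  · exact h1
  · have h2 := hA z hz (D.attach (e, false))
    simp only [flip, Equiv.symm_apply_apply, Bool.not_false] at h2
    simpa [h1] using h2

/-- The flow of a strip as seen from one of its ends. -/
def portFlow (z : D.BarSite × Fin 4 → ℚ) (p : D.Port) : ℚ :=
  -(z (D.barSlot p true) + z (D.barSlot p false))

theorem barSlot_attach (e : D.E) (b c : Bool) :
    D.barSlot (D.attach (e, b)) c = (Sum.inr e, stripCorner b c) := by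
  simp [barSlot]

theorem portFlow_flip (z : D.BarSite × Fin 4 → ℚ) (hs : ∀ x, ∑ j, z (x, j) = 0) (p : D.Port) :
    D.portFlow z (D.flip p) = - D.portFlow z p := by
  obtain ⟨⟨e, b⟩, rfl⟩ := D.attach.surjective p
  have h := hs (Sum.inr e)
  rw [Fin.sum_univ_four] at h
  cases b <;> simp [portFlow, flip, barSlot_attach, stripCorner] <;> linarith

/-- Conservation at the four sites is added up; the four arcs between neighbouring quadrants cancel,
and only the eight strip sides remain. -/
theorem sum_portFlow_crossing (z : D.BarSite × Fin 4 → ℚ) (hg : ∀ d, z (D.barGlue d) = - z d)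
    (hs : ∀ x, ∑ j, z (x, j) = 0) (c : D.C) :
    ∑ i, D.portFlow z (Sum.inr (c, i)) = 0 := by
  have hl : ∀ i : Fin 4, z (D.barSlot (Sum.inr (c, i)) true) = - z (Sum.inl (c, i), i) := by
    intro i
    rw [← hg]
    simp [barGlue]
  have hr : ∀ i : Fin 4, z (D.barSlot (Sum.inr (c, i)) false) = - z (Sum.inl (c, i - 1), i) := by
    intro i
    rw [← D.barGlue_portSlot, hg]
    rfl
  have hin : ∀ k : Fin 4, z (Sum.inl (c, k + 1), k) = - z (Sum.inl (c, k), k + 2) := by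
    intro k
    rw [← hg]
    simp [barGlue]
  have h0 := hs (Sum.inl (c, 0))
  have h1 := hs (Sum.inl (c, 1))
  have h2 := hs (Sum.inl (c, 2))
  have h3 := hs (Sum.inl (c, 3))
  have i0 := hin 0
  have i1 := hin 1
  have i2 := hin 2
  have i3 := hin 3
  simp only [portFlow, hl, hr]
  rw [Fin.sum_univ_four] at *
  simp only [Fin.reduceAdd, Fin.reduceSub] at *
  linarith

/-- At a vertex the sum telescopes under the rotation, because the left side of a strip is glued to
the right side of the next one. -/
theorem sum_portFlow_mul (z : D.BarSite × Fin 4 → ℚ) (hg : ∀ d, z (D.barGlue d) = - z d)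
    (hs : ∀ x, ∑ j, z (x, j) = 0) (g : D.Port → ℚ) (hgr : ∀ p, g (D.rot p) = g p) :
    ∑ p, D.portFlow z p * g p = 0 := by
  rw [Fintype.sum_sum_type]
  have h1 : ∑ p, D.portFlow z (Sum.inl p) * g (Sum.inl p) = 0 := by
    have hl : ∀ p, z (D.barSlot (Sum.inl p) true) = - z (D.barSlot (Sum.inl (D.rotVertex p)) false) := by
      intro p
      rw [← hg, barGlue_barSlot]
      simp [portSlot]
    have e : ∀ p, D.portFlow z (Sum.inl p) * g (Sum.inl p) =
        (fun p => z (D.barSlot (Sum.inl p) false) * g (Sum.inl p)) (D.rotVertex p) -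
        z (D.barSlot (Sum.inl p) false) * g (Sum.inl p) := by
      intro p
      have h := hgr (Sum.inl p)
      change g (Sum.inl (D.rotVertex p)) = _ at h
      simp only [portFlow, hl, h]
      ring
    rw [Finset.sum_congr rfl fun p _ => e p, Finset.sum_sub_distrib,
      Equiv.sum_comp D.rotVertex (fun p => z (D.barSlot (Sum.inl p) false) * g (Sum.inl p)), sub_self]
  have h2 : ∑ q : D.C × Fin 4, D.portFlow z (Sum.inr q) * g (Sum.inr q) = 0 := by
    rw [Fintype.sum_prod_type]
    refine Finset.sum_eq_zero fun c _ => ?_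
    have e : ∀ i : Fin 4, g (Sum.inr (c, i)) = g (Sum.inr (c, 0)) := by
      have s : ∀ i : Fin 4, g (Sum.inr (c, i + 1)) = g (Sum.inr (c, i)) := fun i => by
        have := hgr (Sum.inr (c, i))
        simpa [rot] using this
      have s0 := s 0
      have s1 := s 1
      have s2 := s 2
      simp only [Fin.reduceAdd] at *
      intro i
      fin_cases i
      · rfl
      · exact s0
      · exact s1.trans s0
      · exact s2.trans (s1.trans s0)
    simp only [e, ← Finset.sum_mul, D.sum_portFlow_crossing z hg hs c, zero_mul]
  rw [h1, h2, add_zero]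

/-- The potential on the corners of the bar diagram which belongs to a flow `z` and to a
potential `R` on the faces of `D`. -/
def barPotential (z : D.BarSite × Fin 4 → ℚ) (R : D.Port → ℚ) : D.BarSite × Fin 4 → ℚ
  | (Sum.inr e, j) =>
    if (stripSide j).2 then
      R (D.attach (e, (stripSide j).1)) - z (Sum.inr e, stripCorner (stripSide j).1 false)
    else R (D.attach (e, (stripSide j).1))
  | (Sum.inl (c, k), j) =>
    match j - k with
    | 0 => R (Sum.inr (c, k + 1))
    | 1 => R (Sum.inr (c, k + 1)) + z (Sum.inl (c, k), k + 1)
    | 2 => R (Sum.inr (c, k + 1)) + z (Sum.inl (c, k), k + 1) + z (Sum.inl (c, k), k + 2)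
    | 3 => R (Sum.inr (c, k + 1)) - z (Sum.inl (c, k), k)

/-- Adding the flows on the two sides of each strip gives a conserved flow on `D`, which has a
potential `R` on the faces of `D`. These faces are the regions outside the ribbons, where `R p`
belongs to the region on the right of the strip leaving `p`. Inside the ribbons the values are
forced by crossing strands, and it remains to check that they agree along every arc. -/
theorem hasPotentials (h : D.IsPlane) : D.barDiagram.HasPotentials := by
  intro z hg hs
  change D.BarSite × Fin 4 → ℚ at z
  change ∀ d, z (D.barGlue d) = - z d at hg
  change ∀ x : D.BarSite, ∑ j, z (x, j) = 0 at hs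
  obtain ⟨R, hR1, hR2⟩ := D.exists_port_potential h (D.portFlow z) (D.portFlow_flip z hs)
    (D.sum_portFlow_mul z hg hs)
  have hR3 : ∀ p, R (D.flip p) = R p + D.portFlow z p := by
    intro p
    have := hR1 (D.flip p)
    rw [flip_flip] at this
    rw [← this, ← hR2]; ring
  have jump : ∀ (x : D.BarSite) (j : Fin 4),
      D.barPotential z R (x, j) - D.barPotential z R (x, j - 1) = z (x, j) := by
    rintro (⟨c, k⟩ | e) j
    · have h := hs (Sum.inl (c, k))
      rw [Fin.sum_univ_four] at h
      fin_cases k <;> fin_cases j <;>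
        simp only [barPotential, Fin.zero_eta, Fin.mk_one, Fin.reduceFinMk, Fin.reduceAdd,
          Fin.reduceSub] at h ⊢ <;> linarith
    · have h := hs (Sum.inr e)
      rw [Fin.sum_univ_four] at h
      have h1 := hR3 (D.attach (e, false))
      simp only [portFlow, flip, barSlot_attach, stripCorner, Equiv.symm_apply_apply,
        Bool.not_false] at h1
      fin_cases j <;>
        simp [barPotential, stripSide, stripCorner, h1, Fin.reduceSub, -zero_sub] <;> linarith
  have hb : ∀ p b, D.barPotential z R (D.barSlot p b) =
      if b then R p - z (D.barSlot p false) else R p := by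
    intro p b
    obtain ⟨⟨e, a⟩, rfl⟩ := D.attach.surjective p
    rw [barSlot_attach, barSlot_attach]
    cases a <;> cases b <;> simp [barPotential, stripCorner, stripSide]
  have hb' : ∀ p b, D.barPotential z R ((D.barSlot p b).1, (D.barSlot p b).2 - 1) =
      (if b then R p - z (D.barSlot p false) else R p) - z (D.barSlot p b) := by
    intro p b
    rw [← hb]
    have := jump (D.barSlot p b).1 (D.barSlot p b).2
    linarith
  have hrot : ∀ p, R (D.rot p) = R p + D.portFlow z p := fun p => by rw [← hR2]; ring
  -- The arcs which join the side of a strip to its neighbour at a vertex or crossing, with the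
  -- regions on both of their sides.
  have both : ∀ p b,
      D.barPotential z R (D.barSlot p b) =
        D.barPotential z R ((D.portSlot p b).1, (D.portSlot p b).2 - 1) ∧
      D.barPotential z R (D.portSlot p b) =
        D.barPotential z R ((D.barSlot p b).1, (D.barSlot p b).2 - 1) := by
    intro p b
    have hzg := hg (D.barSlot p b)
    rw [barGlue_barSlot] at hzg
    rw [hb, hb']
    rcases p with p | ⟨c, k⟩
    · cases b
      · have h1 := hrot (Sum.inl (D.rotVertex.symm p))
        have e : D.rot (Sum.inl (D.rotVertex.symm p)) = Sum.inl p := by simp [rot]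
        rw [e] at h1
        simp only [portSlot] at hzg ⊢
        rw [hb, hb']
        simp [portFlow] at h1 hzg ⊢
        constructor <;> linarith
      · have h1 := hrot (Sum.inl p)
        have e : D.rot (Sum.inl p) = Sum.inl (D.rotVertex p) := by simp [rot]
        rw [e] at h1
        simp only [portSlot] at hzg ⊢
        rw [hb, hb']
        simp [portFlow] at h1 hzg ⊢
        constructor <;> linarith
    · cases b
      · have e : ∀ k : Fin 4, k - (k - 1) = 1 := by decide
        have j := jump (Sum.inl (c, k - 1)) k
        simp only [portSlot] at hzg ⊢
        simp [barPotential, e] at j ⊢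
        linarith
      · have h1 := hrot (Sum.inr (c, k))
        have e : D.rot (Sum.inr (c, k)) = Sum.inr (c, k + 1) := by simp [rot]
        have e' : ∀ k : Fin 4, k - 1 - k = 3 := by decide
        rw [e] at h1
        simp only [portSlot] at hzg ⊢
        simp [barPotential, e', portFlow] at h1 ⊢
        constructor <;> linarith
  -- The arcs between neighbouring quadrants, which bound the central square of a crossing of
  -- strips.
  have inner : ∀ c (k : Fin 4),
      D.barPotential z R (Sum.inl (c, k), 2 + k) = D.barPotential z R (Sum.inl (c, k + 1), k - 1) ∧
      D.barPotential z R (Sum.inl (c, k + 1), k) =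
        D.barPotential z R (Sum.inl (c, k), 2 + k - 1) := by
    intro c k
    have a1 : ∀ k : Fin 4, 2 + k - k = 2 := by decide
    have a2 : ∀ k : Fin 4, k - 1 - (k + 1) = 2 := by decide
    have a3 : ∀ k : Fin 4, k - (k + 1) = 3 := by decide
    have a4 : ∀ k : Fin 4, k + 2 - 1 - k = 1 := by decide
    have h1 := hrot (Sum.inr (c, k + 1))
    have e : D.rot (Sum.inr (c, k + 1)) = Sum.inr (c, k + 1 + 1) := by simp [rot]
    rw [e] at h1
    have g1 := hg (D.barSlot (Sum.inr (c, k + 1)) true)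
    have g2 := hg (D.barSlot (Sum.inr (c, k + 1)) false)
    have g3 := hg (Sum.inl (c, k), 2 + k)
    rw [barGlue_barSlot] at g1 g2
    simp only [barGlue, a1] at g3
    simp [portSlot] at g1 g2
    have s := hs (Sum.inl (c, k + 1))
    have s' : z (Sum.inl (c, k + 1), k) + z (Sum.inl (c, k + 1), k + 1) +
        z (Sum.inl (c, k + 1), k + 1 + 1) + z (Sum.inl (c, k + 1), k + 1 + 2) = 0 := by
      rw [Fin.sum_univ_four] at s
      fin_cases k <;> simp at s ⊢ <;> linarith
    rw [add_comm 2 k] at g3 ⊢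
    simp [barPotential, a2, a3, a4, portFlow] at h1 g3 ⊢
    constructor <;> linarith
  refine ⟨D.barPotential z R, jump, ?_⟩
  rintro ⟨⟨c, k⟩ | e, j⟩
  · obtain ⟨i, rfl⟩ : ∃ i, j = i + k := ⟨j - k, by simp⟩
    fin_cases i
    · have h1 : (Sum.inl (c, k), 0 + k) = D.portSlot (Sum.inr (c, k)) true := by simp [portSlot]
      change D.barPotential z R (Sum.inl (c, k), 0 + k) = D.barPotential z R
        ((D.barGlue (Sum.inl (c, k), 0 + k)).1, (D.barGlue (Sum.inl (c, k), 0 + k)).2 - 1)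
      rw [h1, barGlue_portSlot]
      exact (both _ _).2
    · have h1 : (Sum.inl (c, k), 1 + k) = D.portSlot (Sum.inr (c, k + 1)) false := by
        simp [portSlot, add_comm]
      change D.barPotential z R (Sum.inl (c, k), 1 + k) = D.barPotential z R
        ((D.barGlue (Sum.inl (c, k), 1 + k)).1, (D.barGlue (Sum.inl (c, k), 1 + k)).2 - 1)
      rw [h1, barGlue_portSlot]
      exact (both _ _).2
    · have h1 : D.barGlue (Sum.inl (c, k), 2 + k) = (Sum.inl (c, k + 1), k) := by simp [barGlue]
      change D.barPotential z R (Sum.inl (c, k), 2 + k) = D.barPotential z R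
        ((D.barGlue (Sum.inl (c, k), 2 + k)).1, (D.barGlue (Sum.inl (c, k), 2 + k)).2 - 1)
      rw [h1]
      exact (inner c k).1
    · have h2 : ∀ k : Fin 4, 3 + k = k - 1 := by decide
      have h1 : D.barGlue (Sum.inl (c, k), 3 + k) = (Sum.inl (c, k - 1), k + 1) := by simp [barGlue]
      change D.barPotential z R (Sum.inl (c, k), 3 + k) = D.barPotential z R
        ((D.barGlue (Sum.inl (c, k), 3 + k)).1, (D.barGlue (Sum.inl (c, k), 3 + k)).2 - 1)
      rw [h1, h2]
      have := (inner c (k - 1)).2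
      have h3 : ∀ k : Fin 4, 2 + (k - 1) - 1 = k + 1 - 1 := by decide
      simpa only [h3, sub_add_cancel] using this
  · change D.barPotential z R (Sum.inr e, j) = D.barPotential z R
        ((D.barGlue (Sum.inr e, j)).1, (D.barGlue (Sum.inr e, j)).2 - 1)
    rw [← D.barSlot_stripSide e j, barGlue_barSlot]
    exact (both _ _).1

end DiagramData

/-! ### Traversals of a system of curves

The curves are given by two involutions of the set `X` of their slots: `g` goes to the other end of
an arc, and `τ` passes through a site. -/

section Traversal

variable {X : Type*}

/-- Starting along the arc at `u`, sites are entered at the slots in `l`, and the last arc ends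
at `v`. -/
def ArcPath (g τ : X → X) : X → List X → X → Prop
  | u, [], v => g u = v
  | u, e :: l, v => g u = e ∧ ArcPath g τ (τ e) l v

/-- The slots in `l` are the successive entries on a closed curve. -/
def ClosedPath (g τ : X → X) : List X → Prop
  | [] => False
  | e :: t => ArcPath g τ (τ e) t e

/-- The list `F` contains one of the slots `d` and `τ d` of every strand piece. -/
def CoversStrands (τ : X → X) (F : List X) : Prop :=
  F.Nodup ∧ ∀ d, d ∈ F ↔ τ d ∉ F

/-- The lists in `ℓ` are the lists of entries on the curves of the system, each one traversed
once. -/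
structure IsTraversal (g τ : X → X) (ℓ : List (List X)) : Prop where
  closed : ∀ l ∈ ℓ, ClosedPath g τ l
  covers : CoversStrands τ ℓ.flatten

variable {g τ τ' : X → X}

theorem arcPath_append {u v e : X} {l₁ l₂ : List X} :
    ArcPath g τ u (l₁ ++ e :: l₂) v ↔ ArcPath g τ u l₁ e ∧ ArcPath g τ (τ e) l₂ v := by
  induction l₁ generalizing u with
  | nil => rfl
  | cons a l ih => simp only [List.cons_append, ArcPath, ih, and_assoc]

/-- A closed curve can be based at any of its entries; this reduces statements about closed curves
to arcs. -/
theorem closedPath_append {a : X} {P S : List X} :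
    ClosedPath g τ (P ++ a :: S) ↔ ArcPath g τ (τ a) (S ++ P) a := by
  cases P with
  | nil => simp [ClosedPath]
  | cons p P =>
    rw [arcPath_append]
    simp only [List.cons_append, ClosedPath, arcPath_append]
    exact and_comm

/-- Run backwards, a strand piece entered at `e` is entered at its other slot `τ e`. -/
theorem ArcPath.reverse (hg : ∀ d, g (g d) = d) (hτ : ∀ d, τ (τ d) = d) {u v : X} {l : List X}
    (h : ArcPath g τ u l v) : ArcPath g τ v (l.reverse.map τ) u := by
  induction l generalizing u with
  | nil => rw [← (show g u = v from h)]; exact hg u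
  | cons e l ih =>
    obtain ⟨rfl, h⟩ := h
    simp only [List.reverse_cons, List.map_append, List.map_cons, List.map_nil]
    rw [arcPath_append]
    refine ⟨ih h, ?_⟩
    simp [ArcPath, hτ, hg]

theorem ArcPath.congr {u v : X} {l : List X} (h : ArcPath g τ u l v) (hl : ∀ e ∈ l, τ e = τ' e) :
    ArcPath g τ' u l v := by
  induction l generalizing u with
  | nil => exact h
  | cons e l ih =>
    refine ⟨h.1, ?_⟩
    rw [← hl e (by simp)]
    exact ih h.2 fun e' he' => hl e' (by simp [he'])

theorem ArcPath.first_mem {u v : X} {l : List X} (h : ArcPath g τ u l v) : g u = v ∨ g u ∈ l := by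
  cases l with
  | nil => exact Or.inl h
  | cons e l => exact Or.inr (by simp [h.1])

theorem ArcPath.exists_last {u v : X} {l : List X} (h : ArcPath g τ u l v) :
    g u = v ∨ ∃ e ∈ l, g (τ e) = v := by
  induction l generalizing u with
  | nil => exact Or.inl h
  | cons e l ih =>
    rcases ih h.2 with h | ⟨e', he', h⟩
    · exact Or.inr ⟨e, by simp, h⟩
    · exact Or.inr ⟨e', by simp [he'], h⟩

theorem ClosedPath.next_mem {l : List X} (h : ClosedPath g τ l) {e : X} (he : e ∈ l) :
    g (τ e) ∈ l := by
  obtain ⟨P, S, rfl⟩ := List.append_of_mem he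
  rcases (closedPath_append.1 h).first_mem with h | h
  · rwa [h]
  · simp only [List.mem_append, List.mem_cons] at h ⊢
    tauto

theorem ClosedPath.exists_prev {l : List X} (h : ClosedPath g τ l) {e : X} (he : e ∈ l) :
    ∃ e' ∈ l, g (τ e') = e := by
  obtain ⟨P, S, rfl⟩ := List.append_of_mem he
  rcases (closedPath_append.1 h).exists_last with h | ⟨e', he', h⟩
  · exact ⟨e, he, h⟩
  · refine ⟨e', ?_, h⟩
    simp only [List.mem_append, List.mem_cons] at he' ⊢
    tauto

theorem ClosedPath.ne_nil {l : List X} (h : ClosedPath g τ l) : l ≠ [] := by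
  rintro rfl
  exact h

theorem ClosedPath.rotate {P S : List X} {a : X} (h : ClosedPath g τ (P ++ a :: S)) :
    ClosedPath g τ (a :: (S ++ P)) :=
  closedPath_append.1 h

theorem CoversStrands.perm {F F' : List X} (h : CoversStrands τ F) (hp : F.Perm F') :
    CoversStrands τ F' :=
  ⟨hp.nodup_iff.1 h.1, fun d => by rw [← hp.mem_iff, ← hp.mem_iff]; exact h.2 d⟩

theorem IsTraversal.perm {ℓ ℓ' : List (List X)} (h : IsTraversal g τ ℓ) (hp : ℓ.Perm ℓ') :
    IsTraversal g τ ℓ' :=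
  ⟨fun l hl => h.closed l (hp.mem_iff.2 hl), h.covers.perm hp.flatten⟩

theorem IsTraversal.rotate {ℓ : List (List X)} {P S : List X} {a : X}
    (h : IsTraversal g τ ((P ++ a :: S) :: ℓ)) : IsTraversal g τ ((a :: (S ++ P)) :: ℓ) := by
  refine ⟨?_, h.covers.perm ?_⟩
  · intro l hl
    rcases List.mem_cons.1 hl with rfl | hl
    · exact (h.closed _ (by simp)).rotate
    · exact h.closed l (by simp [hl])
  · simp only [List.flatten_cons]
    refine List.Perm.append_right _ ?_
    exact List.perm_append_comm (l₁ := P) (l₂ := a :: S)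

/-- The set of slots on a closed curve is closed under `g`. -/
theorem ClosedPath.mem_or_iff (hg : ∀ d, g (g d) = d) (hτ : ∀ d, τ (τ d) = d) {l : List X}
    (h : ClosedPath g τ l) (d : X) : (g d ∈ l ∨ τ (g d) ∈ l) ↔ (d ∈ l ∨ τ d ∈ l) := by
  have key : ∀ d, (d ∈ l ∨ τ d ∈ l) → (g d ∈ l ∨ τ (g d) ∈ l) := by
    rintro d (hd | hd)
    · obtain ⟨e, he, rfl⟩ := h.exists_prev hd
      right
      rwa [hg, hτ]
    · left
      have := h.next_mem hd
      rwa [hτ] at this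
  refine ⟨fun hd => ?_, key d⟩
  have := key (g d) hd
  rwa [hg] at this

theorem ArcPath.connected {R : X → X → Prop} (hRg : ∀ d, R d (g d)) (hRτ : ∀ d, R d (τ d))
    {u v : X} {l : List X} (h : ArcPath g τ u l v) :
    ∀ e ∈ l, (Quot.mk R e) = Quot.mk R u := by
  induction l generalizing u with
  | nil => simp
  | cons e l ih =>
    have h1 : Quot.mk R e = Quot.mk R u := by
      rw [← h.1]; exact (Quot.sound (hRg u)).symm
    intro e' he'
    rcases List.mem_cons.1 he' with rfl | he'
    · exact h1
    · rw [ih h.2 e' he', ← h1]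
      exact (Quot.sound (hRτ e)).symm

theorem ClosedPath.connected {R : X → X → Prop} (hRg : ∀ d, R d (g d)) (hRτ : ∀ d, R d (τ d))
    {l : List X} (h : ClosedPath g τ l) {e e' : X} (he : e ∈ l) (he' : e' ∈ l) :
    Quot.mk R e = Quot.mk R e' := by
  cases l with
  | nil => exact h.elim
  | cons a l =>
    have key : ∀ e ∈ a :: l, Quot.mk R e = Quot.mk R a := by
      intro e he
      rcases List.mem_cons.1 he with rfl | he
      · rfl
      · rw [ArcPath.connected hRg hRτ h e he]
        exact (Quot.sound (hRτ a)).symm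
    rw [key e he, key e' he']

/-- The set of the curves. -/
def StrandRel (g τ : X → X) (d e : X) : Prop := e = g d ∨ e = τ d

/-- The entries and exits of a closed curve form a set stable under both involutions, hence a union
of classes. -/
theorem mem_or_iff_of_mk_eq (hg : ∀ d, g (g d) = d) (hτ : ∀ d, τ (τ d) = d) {l : List X}
    (h : ClosedPath g τ l) {d e : X}
    (hde : (Quot.mk _ d : Quot (StrandRel g τ)) = Quot.mk _ e) :
    (d ∈ l ∨ τ d ∈ l) ↔ (e ∈ l ∨ τ e ∈ l) := by
  rw [Quot.eq] at hde
  induction hde with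
  | rel d e hde =>
    rcases hde with rfl | rfl
    · exact (h.mem_or_iff hg hτ _).symm
    · rw [hτ]; exact or_comm
  | refl => rfl
  | symm _ _ _ ih => exact ih.symm
  | trans _ _ _ _ _ ih1 ih2 => exact ih1.trans ih2

namespace IsTraversal

theorem mem_flatten {ℓ : List (List X)} (h : IsTraversal g τ ℓ) (d : X) :
    d ∈ ℓ.flatten ∨ τ d ∈ ℓ.flatten := by
  by_cases hd : d ∈ ℓ.flatten
  · exact Or.inl hd
  · exact Or.inr (not_not.1 fun hc => hd ((h.covers.2 d).2 hc))

theorem exists_mem {ℓ : List (List X)} (h : IsTraversal g τ ℓ) (d : X) :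
    ∃ l ∈ ℓ, d ∈ l ∨ τ d ∈ l := by
  rcases h.mem_flatten d with hd | hd
  · obtain ⟨l, hl, hd⟩ := List.mem_flatten.1 hd
    exact ⟨l, hl, Or.inl hd⟩
  · obtain ⟨l, hl, hd⟩ := List.mem_flatten.1 hd
    exact ⟨l, hl, Or.inr hd⟩

theorem eq_of_mem {ℓ : List (List X)} (h : IsTraversal g τ ℓ) {i j : Fin ℓ.length} {d : X}
    (hi : d ∈ ℓ[i]) (hj : d ∈ ℓ[j]) : i = j := by
  have h1 := (List.nodup_flatten.1 h.covers.1).2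
  rw [List.pairwise_iff_getElem] at h1
  by_contra hij
  rcases lt_or_gt_of_ne hij with hij | hij
  · exact h1 i j i.2 j.2 hij hi hj
  · exact h1 j i j.2 i.2 hij hj hi

/-- Each list represents the class of its first entry. Two lists in one class would share a strand
piece, against `covers`. -/
theorem card_eq (hg : ∀ d, g (g d) = d) (hτ : ∀ d, τ (τ d) = d) {ℓ : List (List X)}
    (h : IsTraversal g τ ℓ) : Nat.card (Quot (StrandRel g τ)) = ℓ.length := by
  have hc : ∀ i : Fin ℓ.length, ClosedPath g τ ℓ[i] := fun i => h.closed _ (List.getElem_mem _)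
  let f : Fin ℓ.length → Quot (StrandRel g τ) := fun i => Quot.mk _ (ℓ[i].head (hc i).ne_nil)
  have hf : Function.Bijective f := by
    constructor
    · intro i j hij
      have hi : ℓ[i].head (hc i).ne_nil ∈ ℓ[i] := List.head_mem _
      have hj : ℓ[j].head (hc j).ne_nil ∈ ℓ[j] := List.head_mem _
      rcases (mem_or_iff_of_mk_eq hg hτ (hc j) hij).2 (Or.inl hj) with h1 | h1
      · exact h.eq_of_mem hi h1
      · exact absurd (List.mem_flatten.2 ⟨_, List.getElem_mem j.2, h1⟩)
          ((h.covers.2 _).1 (List.mem_flatten.2 ⟨_, List.getElem_mem i.2, hi⟩))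
    · intro q
      obtain ⟨d, rfl⟩ := Quot.exists_rep q
      obtain ⟨l, hl, hd⟩ := h.exists_mem d
      obtain ⟨i, hi, rfl⟩ := List.getElem_of_mem hl
      refine ⟨⟨i, hi⟩, ?_⟩
      have hh : ℓ[i].head (hc ⟨i, hi⟩).ne_nil ∈ ℓ[i] := List.head_mem _
      have con : ∀ e ∈ ℓ[i], f ⟨i, hi⟩ = Quot.mk _ e := fun e he =>
        (hc ⟨i, hi⟩).connected (R := StrandRel g τ) (fun d => Or.inl rfl) (fun d => Or.inr rfl) hh he
      rcases hd with hd | hd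
      · exact con _ hd
      · rw [con _ hd]
        exact (Quot.sound (r := StrandRel g τ) (Or.inr rfl)).symm
  rw [← Nat.card_eq_of_bijective f hf, Nat.card_eq_fintype_card, Fintype.card_fin]

end IsTraversal

/-! #### Change of one site -/

/-- `τ'` arises from `τ` by pairing the four slots `a`, `τ a`, `c`, `τ c` differently: `a` with
`τ c` and `c` with `τ a`. -/
structure IsCrossSwap (τ τ' : X → X) (a c : X) : Prop where
  left : τ' a = τ c
  right : τ' c = τ a
  left' : τ' (τ a) = c
  right' : τ' (τ c) = a
  off : ∀ d, d ≠ a → d ≠ c → d ≠ τ a → d ≠ τ c → τ' d = τ d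

/-- `τ'` arises from `τ` by pairing the four slots `a`, `τ a`, `c`, `τ c` differently: `a` with
`c` and `τ a` with `τ c`. -/
structure IsEndSwap (τ τ' : X → X) (a c : X) : Prop where
  left : τ' a = c
  right : τ' c = a
  left' : τ' (τ a) = τ c
  right' : τ' (τ c) = τ a
  off : ∀ d, d ≠ a → d ≠ c → d ≠ τ a → d ≠ τ c → τ' d = τ d

/-- The new pairing respects the orientation: `a` and `c` remain entries and merely exchange their
exits. -/
theorem CoversStrands.crossSwap {a c : X} {F : List X}
    (hF : CoversStrands τ F) (ha : a ∈ F) (hc : c ∈ F) (h : IsCrossSwap τ τ' a c) :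
    CoversStrands τ' F := by
  refine ⟨hF.1, fun d => ?_⟩
  have ha' := (hF.2 a).1 ha
  have hc' := (hF.2 c).1 hc
  by_cases h1 : d = a
  · subst h1; simp [h.left, ha, hc']
  by_cases h2 : d = c
  · subst h2; simp [h.right, hc, ha']
  by_cases h3 : d = τ a
  · subst h3; simp [h.left', hc, ha']
  by_cases h4 : d = τ c
  · subst h4; simp [h.right', ha, hc']
  rw [h.off d h1 h2 h3 h4]
  exact hF.2 d

/-- The new pairing joins two entries, so the part `Q` has to be run backwards, and the second
passage through the site now enters at a former exit `x`. It is `τ a` when a self-crossing is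
smoothed and `τ c` when two curves are merged. -/
theorem CoversStrands.endSwap (hτ : ∀ d, τ (τ d) = d) {a c x : X} {Q R : List X}
    (hF : CoversStrands τ (a :: c :: (Q ++ R))) (h : IsEndSwap τ τ' a c)
    (hx : x = τ a ∨ x = τ c) : CoversStrands τ' (a :: x :: (Q.map τ ++ R)) := by
  have inj : Function.Injective τ := Function.LeftInverse.injective hτ
  obtain ⟨hn, hm⟩ := hF
  have ha := (hm a).1 (by simp)
  have hc := (hm c).1 (by simp)
  have hQ : ∀ e ∈ Q, τ e ∉ a :: c :: (Q ++ R) := fun e he => (hm e).1 (by simp [he])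
  simp only [List.nodup_cons, List.mem_cons, List.mem_append, List.nodup_append, not_or] at hn ha hc hQ
  obtain ⟨⟨hac, haQ, haR⟩, ⟨hcQ, hcR⟩, hQn, hRn, hdis⟩ := hn
  obtain ⟨ha1, ha2, ha3, ha4⟩ := ha
  obtain ⟨hc1, hc2, hc3, hc4⟩ := hc
  have hmap : ∀ d, d ∈ Q.map τ ↔ τ d ∈ Q := fun d => by
    rw [List.mem_map]
    constructor
    · rintro ⟨e, he, rfl⟩; rwa [hτ]
    · intro hd; exact ⟨_, hd, hτ d⟩
  have hτac : τ a ≠ τ c := fun h => hac (inj h)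
  have hτca : τ c ≠ τ a := hτac.symm
  have hxs : x ∉ a :: (Q.map τ ++ R) ∧ x ≠ a := by
    rcases hx with rfl | rfl <;> simp [*]
  refine ⟨?_, fun d => ?_⟩
  · simp only [List.nodup_cons, List.mem_cons, List.mem_append, List.nodup_append, not_or, hmap]
    simp only [List.mem_cons, List.mem_append, not_or, hmap] at hxs
    refine ⟨⟨hxs.2.symm, ha3, haR⟩, hxs.1.2, hQn.map inj, hRn, ?_⟩
    intro e he e' he' hee
    subst hee
    have := hQ (τ e) he
    rw [hτ] at this
    exact this.2.2.2 he'
  · simp only [List.mem_cons, List.mem_append, hmap]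
    by_cases h1 : d = a
    · subst h1; rcases hx with rfl | rfl <;> simp [h.left, *] <;> tauto
    by_cases h2 : d = c
    · subst h2; rcases hx with rfl | rfl <;> simp [h.right, *] <;> tauto
    by_cases h3 : d = τ a
    · subst h3; rcases hx with rfl | rfl <;> simp [h.left', *]
    by_cases h4 : d = τ c
    · subst h4; rcases hx with rfl | rfl <;> simp [h.right', *]
    have h1' : τ d ≠ a := fun h => h3 (by rw [← h, hτ])
    have h2' : τ d ≠ c := fun h => h4 (by rw [← h, hτ])
    have h3' : τ d ≠ τ a := fun h => h1 (inj h)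
    have h4' : τ d ≠ τ c := fun h => h2 (inj h)
    have hdx : d ≠ x := by rcases hx with rfl | rfl <;> assumption
    have hdx' : τ d ≠ x := by rcases hx with rfl | rfl <;> assumption
    rw [h.off d h1 h2 h3 h4]
    have hd := hm d
    simp only [List.mem_cons, List.mem_append, h1, h2, h1', h2', false_or] at hd
    simp only [h1, hdx, h1', hdx', hτ, false_or]
    have d1 : d ∈ Q → d ∉ R := fun h1 h2 => hdis _ h1 _ h2 rfl
    have d2 : τ d ∈ Q → τ d ∉ R := fun h1 h2 => hdis _ h1 _ h2 rfl
    tauto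

/-- The slots off the site in a traversal. -/
theorem CoversStrands.off {a c : X} {L : List X} (hF : CoversStrands τ (a :: c :: L)) {e : X}
    (he : e ∈ L) : e ≠ a ∧ e ≠ c ∧ e ≠ τ a ∧ e ≠ τ c := by
  obtain ⟨hn, hm⟩ := hF
  have ha := (hm a).1 (by simp)
  have hc := (hm c).1 (by simp)
  simp only [List.nodup_cons, List.mem_cons, not_or] at hn ha hc
  refine ⟨?_, ?_, ?_, ?_⟩ <;> rintro rfl <;> tauto

theorem perm_crossed {P Q S F : List X} {a c : X} :
    ((P ++ a :: Q ++ c :: S) ++ F).Perm (a :: c :: (Q ++ (P ++ S ++ F))) := by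
  classical
  rw [List.perm_iff_count]
  intro x
  simp only [List.count_append, List.count_cons]
  omega

theorem perm_split {P Q S F : List X} {a c : X} :
    ((Q ++ [c]) ++ ((P ++ a :: S) ++ F)).Perm (a :: c :: (Q ++ (P ++ S ++ F))) := by
  classical
  rw [List.perm_iff_count]
  intro x
  simp only [List.count_append, List.count_cons, List.count_nil]
  omega

namespace IsTraversal

variable {ℓ : List (List X)} {P Q S : List X} {a c : X}

theorem ClosedPath.of_off {l : List X} (h : ClosedPath g τ l) (hl : ∀ e ∈ l, τ e = τ' e) :
    ClosedPath g τ' l := by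
  cases l with
  | nil => exact h
  | cons e t =>
    have := ArcPath.congr (τ' := τ') h fun e' he' => hl e' (by simp [he'])
    rw [hl e (by simp)] at this
    exact this

/-- The smoothing along the orientation merges two curves: from `a` one continues along the curve of
`c` and comes back at `c`. -/
theorem crossed_of_split (h : IsTraversal g τ ((Q ++ [c]) :: (P ++ a :: S) :: ℓ)) (hs : IsCrossSwap τ τ' a c) :
    IsTraversal g τ' ((P ++ a :: Q ++ c :: S) :: ℓ) := by
  have hcov := h.covers
  simp only [List.flatten_cons] at hcov
  have hF := hcov.perm perm_split
  have off : ∀ e ∈ Q ++ (P ++ S ++ ℓ.flatten), τ e = τ' e := fun e he => by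
    obtain ⟨h1, h2, h3, h4⟩ := hF.off he
    exact (hs.off e h1 h2 h3 h4).symm
  refine ⟨?_, ?_⟩
  · intro l hl
    rcases List.mem_cons.1 hl with rfl | hl'
    · have h1 := closedPath_append.1 (h.closed (Q ++ [c]) (by simp))
      have h2 := closedPath_append.1 (h.closed (P ++ a :: S) (by simp))
      rw [List.append_assoc, List.cons_append, closedPath_append, List.append_assoc,
        List.cons_append, arcPath_append, hs.left, hs.right]
      exact ⟨h1.congr fun e he => off e (by simp at he ⊢; tauto),
        h2.congr fun e he => off e (by simp at he ⊢; tauto)⟩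
    · refine ClosedPath.of_off (h.closed l (by simp [hl'])) fun e he => off e ?_
      simp only [List.mem_append, List.mem_flatten]
      exact Or.inr (Or.inr ⟨l, hl', he⟩)
  · simp only [List.flatten_cons]
    exact (hF.crossSwap (by simp) (by simp) hs).perm perm_crossed.symm

/-- The smoothing along the orientation detaches the loop `Q` between two passages of the same
curve. -/
theorem split_of_crossed (h : IsTraversal g τ ((P ++ a :: Q ++ c :: S) :: ℓ)) (hs : IsCrossSwap τ τ' a c) :
    IsTraversal g τ' ((Q ++ [c]) :: (P ++ a :: S) :: ℓ) := by
  have hcov := h.covers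
  simp only [List.flatten_cons] at hcov
  have hF := hcov.perm perm_crossed
  have off : ∀ e ∈ Q ++ (P ++ S ++ ℓ.flatten), τ e = τ' e := fun e he => by
    obtain ⟨h1, h2, h3, h4⟩ := hF.off he
    exact (hs.off e h1 h2 h3 h4).symm
  have h1 := h.closed (P ++ a :: Q ++ c :: S) (by simp)
  rw [List.append_assoc, List.cons_append, closedPath_append, List.append_assoc,
        List.cons_append, arcPath_append] at h1
  refine ⟨?_, ?_⟩
  · intro l hl
    rcases List.mem_cons.1 hl with rfl | hl'
    · rw [closedPath_append, hs.right]
      exact h1.1.congr fun e he => off e (by simp at he ⊢; tauto)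
    rcases List.mem_cons.1 hl' with rfl | hl'
    · rw [closedPath_append, hs.left]
      exact h1.2.congr fun e he => off e (by simp at he ⊢; tauto)
    · refine ClosedPath.of_off (h.closed l (by simp [hl'])) fun e he => off e ?_
      simp only [List.mem_append, List.mem_flatten]
      exact Or.inr (Or.inr ⟨l, hl', he⟩)
  · simp only [List.flatten_cons]
    exact (hF.crossSwap (by simp) (by simp) hs).perm perm_split.symm

/-- The smoothing against the orientation keeps a single curve, which runs through the loop `Q`
backwards, from `c` to `τ a`. -/
theorem flipped_of_crossed (hg : ∀ d, g (g d) = d) (hτ : ∀ d, τ (τ d) = d)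
    (h : IsTraversal g τ ((P ++ a :: Q ++ c :: S) :: ℓ)) (hs : IsEndSwap τ τ' a c) :
    IsTraversal g τ' ((P ++ a :: Q.reverse.map τ ++ τ a :: S) :: ℓ) := by
  have hcov := h.covers
  simp only [List.flatten_cons] at hcov
  have hF := hcov.perm perm_crossed
  have off : ∀ e ∈ Q ++ (P ++ S ++ ℓ.flatten), τ e = τ' e := fun e he => by
    obtain ⟨h1, h2, h3, h4⟩ := hF.off he
    exact (hs.off e h1 h2 h3 h4).symm
  have hC := hF.endSwap hτ hs (Or.inl rfl)
  have off' : ∀ e ∈ Q.map τ, τ e = τ' e := by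
    intro e he
    obtain ⟨e', he', rfl⟩ := List.mem_map.1 he
    obtain ⟨h1, h2, h3, h4⟩ := hF.off (e := e') (by simp [he'])
    refine (hs.off _ ?_ ?_ ?_ ?_).symm
    · rintro rfl; exact h3 (hτ _).symm
    · rintro rfl; exact h4 (hτ _).symm
    · intro h; exact h1 (Function.LeftInverse.injective hτ h)
    · intro h; exact h2 (Function.LeftInverse.injective hτ h)
  have h1 := h.closed (P ++ a :: Q ++ c :: S) (by simp)
  rw [List.append_assoc, List.cons_append, closedPath_append, List.append_assoc,
        List.cons_append, arcPath_append] at h1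
  refine ⟨?_, ?_⟩
  · intro l hl
    rcases List.mem_cons.1 hl with rfl | hl'
    · rw [List.append_assoc, List.cons_append, closedPath_append, List.append_assoc,
        List.cons_append, arcPath_append, hs.left, hs.left']
      refine ⟨(h1.1.reverse hg hτ).congr fun e he => off' e ?_,
        h1.2.congr fun e he => off e (by simp at he ⊢; tauto)⟩
      simp only [List.mem_map, List.mem_reverse] at he ⊢
      exact he
    · refine ClosedPath.of_off (h.closed l (by simp [hl'])) fun e he => off e ?_
      simp only [List.mem_append, List.mem_flatten]
      exact Or.inr (Or.inr ⟨l, hl', he⟩)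
  · simp only [List.flatten_cons]
    refine (hC.perm ?_).perm perm_crossed.symm
    refine List.Perm.cons _ (List.Perm.cons _ (List.Perm.append_right _ ?_))
    exact ((List.reverse_perm Q).map τ).symm

/-- The smoothing against the orientation merges the two curves, one of them being run backwards,
from `c` to `τ c`. -/
theorem flipped_of_split (hg : ∀ d, g (g d) = d) (hτ : ∀ d, τ (τ d) = d)
    (h : IsTraversal g τ ((Q ++ [c]) :: (P ++ a :: S) :: ℓ)) (hs : IsEndSwap τ τ' a c) :
    IsTraversal g τ' ((P ++ a :: Q.reverse.map τ ++ τ c :: S) :: ℓ) := by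
  have hcov := h.covers
  simp only [List.flatten_cons] at hcov
  have hF := hcov.perm perm_split
  have off : ∀ e ∈ Q ++ (P ++ S ++ ℓ.flatten), τ e = τ' e := fun e he => by
    obtain ⟨h1, h2, h3, h4⟩ := hF.off he
    exact (hs.off e h1 h2 h3 h4).symm
  have hC := hF.endSwap hτ hs (Or.inr rfl)
  have off' : ∀ e ∈ Q.map τ, τ e = τ' e := by
    intro e he
    obtain ⟨e', he', rfl⟩ := List.mem_map.1 he
    obtain ⟨h1, h2, h3, h4⟩ := hF.off (e := e') (by simp [he'])
    refine (hs.off _ ?_ ?_ ?_ ?_).symm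
    · rintro rfl; exact h3 (hτ _).symm
    · rintro rfl; exact h4 (hτ _).symm
    · intro h; exact h1 (Function.LeftInverse.injective hτ h)
    · intro h; exact h2 (Function.LeftInverse.injective hτ h)
  have h1 := closedPath_append.1 (h.closed (Q ++ [c]) (by simp))
  have h2 := closedPath_append.1 (h.closed (P ++ a :: S) (by simp))
  refine ⟨?_, ?_⟩
  · intro l hl
    rcases List.mem_cons.1 hl with rfl | hl'
    · rw [List.append_assoc, List.cons_append, closedPath_append, List.append_assoc,
        List.cons_append, arcPath_append, hs.left, hs.right']
      refine ⟨(ArcPath.reverse hg hτ h1).congr fun e he => off' e ?_,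
        h2.congr fun e he => off e (by simp at he ⊢; tauto)⟩
      simpa only [List.nil_append, List.mem_map, List.mem_reverse] using he
    · refine ClosedPath.of_off (h.closed l (by simp [hl'])) fun e he => off e ?_
      simp only [List.mem_append, List.mem_flatten]
      exact Or.inr (Or.inr ⟨l, hl', he⟩)
  · simp only [List.flatten_cons]
    refine (hC.perm ?_).perm perm_crossed.symm
    refine List.Perm.cons _ (List.Perm.cons _ (List.Perm.append_right _ ?_))
    exact ((List.reverse_perm Q).map τ).symm

end IsTraversal

end Traversal

/-! ### The traversal of a link diagram given by its base points -/

theorem SiteState.pairing_pairing (s : SiteState) (i : Fin 4) : s.pairing (s.pairing i) = i := by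
  revert i; cases s <;> decide

theorem SiteState.pairing_ne (s : SiteState) (i : Fin 4) : s.pairing i ≠ i := by
  revert i; cases s <;> decide

theorem closedPath_iterate {X : Type*} {g τ : X → X} {b : X} {n : ℕ} (hn : 0 < n)
    (hb : (fun e => g (τ e))^[n] b = b) :
    ClosedPath g τ ((List.range n).map fun k => (fun e => g (τ e))^[k] b) := by
  have key : ∀ (n : ℕ) (e : X), ArcPath g τ (τ e)
      ((List.range n).map fun k => (fun e => g (τ e))^[k + 1] e) ((fun e => g (τ e))^[n + 1] e) := by
    intro n
    induction n with
    | zero => intro e; rfl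
    | succ n ih =>
      intro e
      rw [List.range_succ_eq_map]
      simp only [List.map_cons, List.map_map]
      exact ⟨rfl, ih (g (τ e))⟩
  obtain ⟨n, rfl⟩ := Nat.exists_eq_succ_of_ne_zero hn.ne'
  have h := key n b
  rw [hb] at h
  rw [List.range_succ_eq_map]
  simp only [List.map_cons, List.map_map]
  exact h

/-- A curve does not run through a strand piece in both directions. -/
theorem iterate_ne_turn {X : Type*} {g τ : X → X} (hg : ∀ d, g (g d) = d) (hg' : ∀ d, g d ≠ d)
    (hτ : ∀ d, τ (τ d) = d) (hτ' : ∀ d, τ d ≠ d) (k : ℕ) (e : X) :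
    (fun e => g (τ e))^[k] e ≠ τ e := by
  -- A path from `e` to `τ e` loses one step at each end and yields a path of the same kind shorter
  -- by two. In the end it would give a fixed point of `τ` or of `g`.
  induction k using Nat.twoStepInduction generalizing e with
  | zero => exact (hτ' e).symm
  | one => exact hg' _
  | more k ih _ =>
    intro h
    rw [Function.iterate_succ_apply, Function.iterate_succ_apply'] at h
    apply ih (g (τ e))
    have h1 := congrArg g h
    rw [hg] at h1
    exact (hτ _).symm.trans (congrArg τ h1)

namespace LinkProjection

variable (L : LinkProjection) (m : L.Site → SiteState)

theorem turn_turn (d : L.Slot) : L.turn m (L.turn m d) = d := by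
  simp [turn, SiteState.pairing_pairing]

theorem turn_ne (d : L.Slot) : L.turn m d ≠ d := by
  intro h
  exact SiteState.pairing_ne _ _ (congrArg Prod.snd h)

/-- The entry following a given one. -/
def next (e : L.Slot) : L.Slot := L.glue (L.turn m e)

theorem next_injective : Function.Injective (L.next m) := by
  intro d e h
  have h1 : L.turn m d = L.turn m e := Function.LeftInverse.injective L.glue_glue h
  exact Function.LeftInverse.injective (L.turn_turn m) h1

theorem isPeriodicPt (b : L.Slot) : 0 < Function.minimalPeriod (L.next m) b :=
  Function.minimalPeriod_pos_of_mem_periodicPts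
    ((L.next_injective m).mem_periodicPts b)

/-- The entries on the component with base point `b`. -/
noncomputable def cycle (b : L.Slot) : List L.Slot :=
  (List.range (Function.minimalPeriod (L.next m) b)).map fun k => (L.next m)^[k] b

theorem closedPath_cycle (b : L.Slot) : ClosedPath L.glue (L.turn m) (L.cycle m b) :=
  closedPath_iterate (L.isPeriodicPt m b) (Function.iterate_minimalPeriod (f := L.next m))

theorem mem_cycle {b d : L.Slot} : d ∈ L.cycle m b ↔ ∃ k, (L.next m)^[k] b = d := by
  constructor
  · intro h
    obtain ⟨k, -, hk⟩ := List.mem_map.1 h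
    exact ⟨k, hk⟩
  · rintro ⟨k, rfl⟩
    refine List.mem_map.2 ⟨k % Function.minimalPeriod (L.next m) b, ?_, ?_⟩
    · exact List.mem_range.2 (Nat.mod_lt _ (L.isPeriodicPt m b))
    · exact Function.iterate_mod_minimalPeriod_eq

theorem self_mem_cycle (b : L.Slot) : b ∈ L.cycle m b := (L.mem_cycle m).2 ⟨0, rfl⟩

theorem component_glue (τ : L.Slot → L.Slot) (d : L.Slot) :
    L.component τ (L.glue d) = L.component τ d :=
  (Quot.sound (r := fun d e : L.Slot => e = L.glue d ∨ e = τ d) (Or.inl rfl)).symm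

theorem component_turn (τ : L.Slot → L.Slot) (d : L.Slot) :
    L.component τ (τ d) = L.component τ d :=
  (Quot.sound (r := fun d e : L.Slot => e = L.glue d ∨ e = τ d) (Or.inr rfl)).symm

variable {L m}

theorem component_eq_of_mem_cycle {b d : L.Slot} (h : d ∈ L.cycle m b) :
    L.component (L.turn m) d = L.component (L.turn m) b := by
  obtain ⟨k, rfl⟩ := (L.mem_cycle m).1 h
  induction k with
  | zero => rfl
  | succ k ih =>
    rw [Function.iterate_succ_apply']
    have := ih ((L.mem_cycle m).2 ⟨k, rfl⟩)
    rw [← this, next, component_glue, component_turn]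

theorem component_base (τ : L.Slot → L.Slot) (d : L.Slot) :
    L.component τ (L.base τ d) = L.component τ d :=
  Function.argminOn_mem L.rank {e | L.component τ e = L.component τ d} ⟨d, rfl⟩

theorem base_eq_of_component_eq {τ : L.Slot → L.Slot} {d e : L.Slot}
    (h : L.component τ d = L.component τ e) : L.base τ d = L.base τ e := by
  unfold base
  congr 1
  rw [h]

theorem base_base (τ : L.Slot → L.Slot) (d : L.Slot) : L.base τ (L.base τ d) = L.base τ d :=
  base_eq_of_component_eq (component_base τ d)

theorem mem_cycle_or_of_component_eq {b d : L.Slot}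
    (h : L.component (L.turn m) d = L.component (L.turn m) b) :
    d ∈ L.cycle m b ∨ L.turn m d ∈ L.cycle m b :=
  (mem_or_iff_of_mk_eq L.glue_glue (L.turn_turn m) (L.closedPath_cycle m b) (d := d) (e := b) h).2
    (Or.inl (L.self_mem_cycle m b))

theorem turn_notMem_cycle {b d : L.Slot} (h : d ∈ L.cycle m b) : L.turn m d ∉ L.cycle m b := by
  intro h'
  obtain ⟨j, rfl⟩ := (L.mem_cycle m).1 h
  obtain ⟨k, hk⟩ := (L.mem_cycle m).1 h'
  have key := iterate_ne_turn L.glue_glue L.glue_ne (L.turn_turn m) (L.turn_ne m)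
  rcases le_total j k with hjk | hjk
  · obtain ⟨i, rfl⟩ := Nat.exists_eq_add_of_le' hjk
    rw [Function.iterate_add_apply] at hk
    exact key _ _ hk
  · obtain ⟨i, rfl⟩ := Nat.exists_eq_add_of_le' hjk
    rw [Function.iterate_add_apply] at hk
    apply key i ((L.next m)^[k] b)
    have := congrArg (L.turn m) hk
    rw [turn_turn] at this
    exact this.symm

variable (L m)

/-- The base points of the components, ordered by rank. -/
noncomputable def bases : List L.Slot :=
  open Classical in
  ((List.finRange (Fintype.card L.Slot)).map (Fintype.equivFin L.Slot).symm).filter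
    fun b => L.base (L.turn m) b = b

theorem mem_bases {b : L.Slot} : b ∈ L.bases m ↔ L.base (L.turn m) b = b := by
  classical
  simp only [bases, List.mem_filter, List.mem_map, List.mem_finRange, true_and, decide_eq_true_eq,
    and_iff_right_iff_imp]
  intro _
  exact ⟨Fintype.equivFin L.Slot b, by simp⟩

theorem pairwise_bases : (L.bases m).Pairwise fun b b' => L.rank b < L.rank b' := by
  classical
  refine List.Pairwise.filter _ ?_
  rw [List.pairwise_map]
  refine (List.pairwise_lt_finRange _).imp ?_
  intro i j hij
  simpa [rank] using hij

theorem nodup_cycle (b : L.Slot) : (L.cycle m b).Nodup := by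
  refine List.Nodup.map_on ?_ List.nodup_range
  intro i hi j hj hij
  exact Function.iterate_injOn_Iio_minimalPeriod (List.mem_range.1 hi) (List.mem_range.1 hj) hij

/-- The traversal of the components in the order of their base points. -/
noncomputable def baseTraversal : List (List L.Slot) := (L.bases m).map (L.cycle m)

variable {L m}

theorem mem_flatten_baseTraversal {d : L.Slot} :
    d ∈ (L.baseTraversal m).flatten ↔ d ∈ L.cycle m (L.base (L.turn m) d) := by
  constructor
  · intro h
    obtain ⟨l, hl, hd⟩ := List.mem_flatten.1 h
    obtain ⟨b, hb, rfl⟩ := List.mem_map.1 hl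
    have h1 := base_eq_of_component_eq (component_eq_of_mem_cycle hd)
    rw [(L.mem_bases m).1 hb] at h1
    rwa [h1]
  · intro h
    exact List.mem_flatten.2 ⟨_, List.mem_map.2 ⟨_, (L.mem_bases m).2 (base_base _ _), rfl⟩, h⟩

theorem base_turn (d : L.Slot) : L.base (L.turn m) (L.turn m d) = L.base (L.turn m) d :=
  base_eq_of_component_eq (component_turn L _ d)

variable (L m)

/-- Links the base points used in the definition of the Dubrovnik polynomial with the list calculus
of traversals. -/
theorem isTraversal_baseTraversal :
    IsTraversal L.glue (L.turn m) (L.baseTraversal m) := by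
  refine ⟨?_, ?_, ?_⟩
  · intro l hl
    obtain ⟨b, -, rfl⟩ := List.mem_map.1 hl
    exact L.closedPath_cycle m b
  · rw [List.nodup_flatten]
    refine ⟨?_, ?_⟩
    · intro l hl
      obtain ⟨b, -, rfl⟩ := List.mem_map.1 hl
      exact L.nodup_cycle m b
    · rw [baseTraversal, List.pairwise_map]
      refine (L.pairwise_bases m).imp_of_mem ?_
      intro b b' hb hb' h d hd hd'
      have h1 := base_eq_of_component_eq
        ((component_eq_of_mem_cycle hd).symm.trans (component_eq_of_mem_cycle hd'))
      rw [(L.mem_bases m).1 hb, (L.mem_bases m).1 hb'] at h1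
      rw [h1] at h
      exact lt_irrefl _ h
  · intro d
    rw [mem_flatten_baseTraversal, mem_flatten_baseTraversal, base_turn]
    constructor
    · exact turn_notMem_cycle
    · intro h
      exact (mem_cycle_or_of_component_eq (component_base _ d).symm).resolve_right h

theorem isEntry_iff (d : L.Slot) :
    L.IsEntry (L.turn m) d ↔ d ∈ (L.baseTraversal m).flatten := by
  rw [mem_flatten_baseTraversal, mem_cycle]
  rfl

variable {L m}

/-- The traversal never enters at the other slot of a strand piece, so the second alternative in
`time` does not occur; below the minimal period the iterates are distinct. -/
theorem time_iterate {b : L.Slot} (hb : L.base (L.turn m) b = b) {k : ℕ}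
    (hk : k < Function.minimalPeriod (L.next m) b) :
    L.time (L.turn m) ((L.next m)^[k] b) = k := by
  have hmem : (L.next m)^[k] b ∈ L.cycle m b := (L.mem_cycle m).2 ⟨k, rfl⟩
  have hbase : L.base (L.turn m) ((L.next m)^[k] b) = b := by
    rw [base_eq_of_component_eq (component_eq_of_mem_cycle hmem), hb]
  have hset : {j | L.entry (L.turn m) ((L.next m)^[k] b) j = (L.next m)^[k] b ∨
      L.entry (L.turn m) ((L.next m)^[k] b) j = L.turn m ((L.next m)^[k] b)} =
      {j | (L.next m)^[j] b = (L.next m)^[k] b} := by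
    ext j
    simp only [Set.mem_ofPred_eq, entry, hbase]
    constructor
    · rintro (h | h)
      · exact h
      · exact absurd ((L.mem_cycle m).2 ⟨j, h⟩) (turn_notMem_cycle hmem)
    · exact Or.inl
  unfold time
  rw [hset]
  apply le_antisymm
  · exact Nat.sInf_le rfl
  · refine le_csInf ⟨k, rfl⟩ ?_
    intro j hj
    by_contra hlt
    push Not at hlt
    have := Function.iterate_injOn_Iio_minimalPeriod (hlt.trans hk) hk hj
    omega

theorem time_turn (d : L.Slot) : L.time (L.turn m) (L.turn m d) = L.time (L.turn m) d := by
  unfold time entry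
  rw [base_turn, turn_turn]
  congr 1
  ext k
  exact or_comm

theorem passedBefore_turn_left {d e : L.Slot} :
    L.PassedBefore (L.turn m) (L.turn m d) e ↔ L.PassedBefore (L.turn m) d e := by
  unfold PassedBefore
  rw [base_turn, time_turn]

theorem passedBefore_turn_right {d e : L.Slot} :
    L.PassedBefore (L.turn m) d (L.turn m e) ↔ L.PassedBefore (L.turn m) d e := by
  unfold PassedBefore
  rw [base_turn, time_turn]

variable (L m)

/-- The order of the list is the order of passing. Hence a diagram without ascending crossings is
descending along this list. -/
theorem pairwise_baseTraversal :
    (L.baseTraversal m).flatten.Pairwise (L.PassedBefore (L.turn m)) := by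
  rw [List.pairwise_flatten]
  refine ⟨?_, ?_⟩
  · intro l hl
    obtain ⟨b, hb, rfl⟩ := List.mem_map.1 hl
    rw [mem_bases] at hb
    rw [cycle, List.pairwise_map]
    refine List.pairwise_lt_range.imp_of_mem ?_
    intro i j hi hj hij
    refine Or.inr ⟨?_, ?_⟩
    · refine base_eq_of_component_eq ?_
      rw [component_eq_of_mem_cycle ((L.mem_cycle m).2 ⟨i, rfl⟩),
        component_eq_of_mem_cycle ((L.mem_cycle m).2 ⟨j, rfl⟩)]
    · rw [time_iterate hb (List.mem_range.1 hi), time_iterate hb (List.mem_range.1 hj)]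
      exact hij
  · rw [baseTraversal, List.pairwise_map]
    refine (L.pairwise_bases m).imp_of_mem ?_
    intro b b' hb hb' h d hd e he
    rw [mem_bases] at hb hb'
    left
    rw [base_eq_of_component_eq (component_eq_of_mem_cycle hd),
      base_eq_of_component_eq (component_eq_of_mem_cycle he), hb, hb']
    exact h

variable {L m}

theorem numComponents_eq {ℓ : List (List L.Slot)} (h : IsTraversal L.glue (L.turn m) ℓ) :
    L.numComponents m = ℓ.length + L.circles := by
  rw [← h.card_eq L.glue_glue (L.turn_turn m)]
  rfl

theorem component_eq_iff_of_mem {ℓ : List (List L.Slot)} (h : IsTraversal L.glue (L.turn m) ℓ)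
    {l : List L.Slot} (hl : l ∈ ℓ) {d e : L.Slot} (hd : d ∈ l) (he : e ∈ ℓ.flatten) :
    L.component (L.turn m) d = L.component (L.turn m) e ↔ e ∈ l := by
  constructor
  · intro hde
    rcases (mem_or_iff_of_mk_eq L.glue_glue (L.turn_turn m) (h.closed l hl) hde).1 (Or.inl hd)
      with h1 | h1
    · exact h1
    · exact absurd (List.mem_flatten.2 ⟨l, hl, h1⟩) ((h.covers.2 e).1 he)
  · intro he'
    exact (h.closed l hl).connected (R := StrandRel L.glue (L.turn m))
      (fun d => Or.inl rfl) (fun d => Or.inr rfl) hd he'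

end LinkProjection

/-! ### The Kauffman bracket -/

instance : Fintype SiteState where
  elems := {.under02, .under13, .smooth01, .smooth03}
  complete x := by cases x <;> simp

namespace SiteState

/-- The strand at the given slot passes under another one. -/
def isUnder : SiteState → Fin 4 → Bool
  | under02, i => i = 0 ∨ i = 2
  | under13, i => i = 1 ∨ i = 3
  | smooth01, _ | smooth03, _ => false

/-- The sign of a crossing where the over-strand enters at slot `i` and the under-strand enters at
slot `j`. -/
def crossSign : SiteState → Fin 4 → Fin 4 → ℤ
  | under02, i, j | under13, i, j => if i = j - 1 then 1 else if i = j + 1 then -1 else 0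
  | smooth01, _, _ | smooth03, _, _ => 0

/-- The coefficient of the state `n` in the expansion of the site state `s` by the Kauffman
bracket. -/
def bracketWeight {K : Type*} [Field K] (A : K) : SiteState → SiteState → K
  | under02, smooth01 | under13, smooth03 => A
  | under02, smooth03 | under13, smooth01 => A⁻¹
  | smooth01, smooth01 | smooth03, smooth03 => 1
  | _, _ => 0

theorem bracketWeight_eq {K : Type*} [Field K] (A : K) {s : SiteState} (hs : s.IsCrossing)
    (n : SiteState) : bracketWeight A s n =
      A * bracketWeight A s.smoothA n + A⁻¹ * bracketWeight A s.smoothB n := by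
  cases s <;> cases n <;> simp [IsCrossing, smoothA, smoothB, bracketWeight] at hs ⊢

end SiteState

namespace LinkProjection

variable (L : LinkProjection) {K : Type*} [Field K]

/-- The sum over all states of the sites with local weights `w`, where a system of `c` curves has
the value `δ ^ (c - 1)`. -/
noncomputable def stateSum (δ : K) (w : L.Site → SiteState → K) : K :=
  ∑ n : L.Site → SiteState, (∏ x, w x (n x)) * δ ^ ((L.numComponents n : ℤ) - 1)

/-- The Kauffman bracket, normalized to be `1` at the simple circle. -/
noncomputable def bracket (A : K) (m : L.Site → SiteState) : K :=
  L.stateSum (-(A ^ 2 + (A ^ 2)⁻¹)) fun x => (m x).bracketWeight A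

theorem stateSum_update_add (δ : K) (w : L.Site → SiteState → K) (x : L.Site) (a b : K)
    (u v : SiteState → K) :
    L.stateSum δ (Function.update w x fun n => a * u n + b * v n) =
      a * L.stateSum δ (Function.update w x u) + b * L.stateSum δ (Function.update w x v) := by
  have key : ∀ (u : SiteState → K) (n : L.Site → SiteState),
      ∏ y, Function.update w x u y (n y) = u (n x) * ∏ y ∈ Finset.univ.erase x, w y (n y) := by
    intro u n
    rw [← Finset.mul_prod_erase _ _ (Finset.mem_univ x), Function.update_self]
    congr 1
    refine Finset.prod_congr rfl fun y hy => ?_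
    rw [Function.update_of_ne (Finset.ne_of_mem_erase hy)]
  unfold stateSum
  simp only [key, Finset.mul_sum, ← Finset.sum_add_distrib]
  refine Finset.sum_congr rfl fun n _ => ?_
  ring

/-- The state sum is linear in the local weight at `x`, and the weight of a crossing is the
corresponding combination of the weights of its smoothings. -/
theorem bracket_eq (A : K) {m : L.Site → SiteState} {x : L.Site} (hx : (m x).IsCrossing) :
    L.bracket A m = A * L.bracket A (L.modify m x SiteState.smoothA) +
      A⁻¹ * L.bracket A (L.modify m x SiteState.smoothB) := by
  have e : ∀ f : SiteState → SiteState,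
      (fun y => (L.modify m x f y).bracketWeight A) =
        Function.update (fun y => (m y).bracketWeight A) x ((f (m x)).bracketWeight A) := by
    intro f
    funext y
    by_cases hy : y = x
    · subst hy; simp [modify]
    · simp [modify, hy]
  unfold bracket
  rw [e, e, ← stateSum_update_add]
  congr 1
  funext y
  by_cases hy : y = x
  · subst hy
    funext n
    simp [SiteState.bracketWeight_eq A hx n]
  · simp [hy]

theorem bracket_of_forall_not_isCrossing (A : K) {m : L.Site → SiteState}
    (hm : ∀ x, ¬ (m x).IsCrossing) :
    L.bracket A m = (-(A ^ 2 + (A ^ 2)⁻¹)) ^ ((L.numComponents m : ℤ) - 1) := by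
  have e : ∀ s n : SiteState, ¬ s.IsCrossing → s.bracketWeight A n = if n = s then 1 else 0 := by
    intro s n hs
    cases s <;> cases n <;> simp [SiteState.IsCrossing, SiteState.bracketWeight] at hs ⊢
  unfold bracket stateSum
  rw [Finset.sum_eq_single m]
  · rw [Finset.prod_eq_one, one_mul]
    intro x _
    exact (e _ _ (hm x)).trans (if_pos rfl)
  · intro n _ hn
    obtain ⟨x, hx⟩ := Function.ne_iff.1 hn
    rw [Finset.prod_eq_zero (Finset.mem_univ x), zero_mul]
    exact (e _ _ (hm x)).trans (if_neg hx)
  · simp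

/-! ### Linking numbers -/

/-- The sum of the values of `f` at the pairs of members of two lists. -/
def pairSum {X : Type*} (f : X → X → ℤ) (l₁ l₂ : List X) : ℤ :=
  (l₁.map fun u => (l₂.map (f u)).sum).sum

section pairSum

variable {X : Type*} {f f' : X → X → ℤ} {l l₁ l₂ l₃ : List X} {a : X}

theorem pairSum_append_left :
    pairSum f (l₁ ++ l₂) l = pairSum f l₁ l + pairSum f l₂ l := by
  simp [pairSum]

theorem pairSum_append_right :
    pairSum f l (l₁ ++ l₂) = pairSum f l l₁ + pairSum f l l₂ := by
  simp [pairSum, List.sum_map_add]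

theorem pairSum_cons_left : pairSum f (a :: l₁) l = pairSum f [a] l + pairSum f l₁ l :=
  pairSum_append_left (l₁ := [a])

theorem pairSum_cons_right : pairSum f l (a :: l₁) = pairSum f l [a] + pairSum f l l₁ :=
  pairSum_append_right (l₁ := [a])

theorem pairSum_congr (h : ∀ u ∈ l₁, ∀ v ∈ l₂, f u v = f' u v) :
    pairSum f l₁ l₂ = pairSum f' l₁ l₂ := by
  unfold pairSum
  congr 1
  refine List.map_congr_left fun u hu => ?_
  congr 1
  exact List.map_congr_left fun v hv => h u hu v hv

theorem pairSum_eq_zero (h : ∀ u ∈ l₁, ∀ v ∈ l₂, f u v = 0) : pairSum f l₁ l₂ = 0 := by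
  rw [pairSum_congr (f' := fun _ _ => 0) h]
  simp [pairSum]

theorem pairSum_reverse_map {τ : X → X} (h : ∀ u ∈ l₁, ∀ v ∈ l₂, f (τ u) v = - f u v) :
    pairSum f (l₁.reverse.map τ) l₂ = - pairSum f l₁ l₂ := by
  have h1 : pairSum f (l₁.reverse.map τ) l₂ = pairSum (fun u v => f (τ u) v) l₁ l₂ := by
    unfold pairSum
    rw [List.map_map]
    exact ((List.reverse_perm l₁).map _).sum_eq
  rw [h1, pairSum_congr (f' := fun u v => - f u v) h]
  have neg : ∀ (l : List X) (f : X → ℤ),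
      (l.map fun v => - f v).sum = - (l.map f).sum := by
    intro l f
    induction l with
    | nil => simp
    | cons a l ih => simp only [List.map_cons, List.sum_cons, ih]; ring
  simp only [pairSum, neg]

theorem pairSum_flip : pairSum f l₁ l₂ = pairSum (fun u v => f v u) l₂ l₁ := by
  induction l₁ with
  | nil => simp [pairSum]
  | cons a l ih =>
    rw [pairSum_cons_left, pairSum_cons_right, ih]
    congr 1
    simp [pairSum]

end pairSum

/-- The sign of the crossing of two strands, which enter at the slots `u` and `v`, provided that the
second one passes under the first one. -/
def formalSign (m : L.Site → SiteState) (u v : L.Slot) : ℤ :=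
  if u.1 = v.1 then (m v.1).crossSign u.2 v.2 else 0

variable {L} {m : L.Site → SiteState}

/-- The flow along a closed curve. -/
def curveFlow (τ : L.Slot → L.Slot) (l : List L.Slot) (d : L.Slot) : ℚ :=
  (if τ d ∈ l then 1 else 0) - if d ∈ l then 1 else 0

theorem curveFlow_glue {l : List L.Slot} (h : ClosedPath L.glue (L.turn m) l) (d : L.Slot) :
    curveFlow (L.turn m) l (L.glue d) = - curveFlow (L.turn m) l d := by
  have h1 : ∀ d, L.turn m (L.glue d) ∈ l ↔ d ∈ l := by
    intro d
    constructor
    · intro hd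
      have := h.next_mem hd
      rwa [turn_turn, L.glue_glue] at this
    · intro hd
      obtain ⟨e, he, rfl⟩ := h.exists_prev hd
      rwa [L.glue_glue, turn_turn]
  have h2 : L.glue d ∈ l ↔ L.turn m d ∈ l := by
    rw [← h1 (L.glue d), L.glue_glue]
  unfold curveFlow
  simp only [h1, h2]
  ring

theorem curveFlow_turn (l : List L.Slot) (d : L.Slot) :
    curveFlow (L.turn m) l (L.turn m d) = - curveFlow (L.turn m) l d := by
  unfold curveFlow
  rw [turn_turn]
  ring

theorem sum_eq_zero_of_turn {z : L.Slot → ℚ} (hz : ∀ d, z (L.turn m d) = - z d) (x : L.Site) :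
    ∑ j, z (x, j) = 0 := by
  have h : ∀ j, z (x, (m x).pairing j) = - z (x, j) := fun j => hz (x, j)
  have h0 := h 0
  have h1 := h 1
  have h2 := h 2
  have h3 := h 3
  rw [Fin.sum_univ_four]
  cases hm : m x <;> simp [hm, SiteState.pairing] at h0 h1 h2 h3 <;> linarith

/-- Only entries at the two slots beside `v` contribute. They belong to the transverse strand, so
their signed count is the flow of `l` at one of these slots. -/
theorem sum_formalSign {l : List L.Slot} (hn : l.Nodup) (v : L.Slot) :
    ((l.map fun u => L.formalSign m u v).sum : ℚ) =
      if (m v.1).pairing v.2 = v.2 + 2 then curveFlow (L.turn m) l (v.1, v.2 + 1) else 0 := by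
  obtain ⟨x, j⟩ := v
  have hj : j - 1 ≠ j + 1 := by revert j; decide
  have h2 : ∀ u : L.Slot, L.formalSign m u (x, j) =
      if (m x).pairing j = j + 2 then
        (if u = (x, j - 1) then 1 else 0) - (if u = (x, j + 1) then 1 else 0) else 0 := by
    rintro ⟨y, i⟩
    by_cases hy : y = x
    · subst hy
      unfold formalSign
      have hij : i = j - 1 → i ≠ j + 1 := fun h => h ▸ hj
      have hp : j ≠ j + 2 ∧ 1 - j ≠ j + 2 ∧ 3 - j ≠ j + 2 := by clear hj hij; revert j; decide
      cases hm : m y <;> simp [SiteState.crossSign, SiteState.pairing, hp] <;> split_ifs <;> simp_all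
    · simp [formalSign, hy]
  simp only [h2]
  by_cases hc : (m x).pairing j = j + 2
  · have h3 : L.turn m (x, j + 1) = (x, j - 1) := by
      have : ∀ s : SiteState, s.pairing j = j + 2 → s.pairing (j + 1) = j - 1 := by
        intro s
        clear hc hj h2
        revert j
        cases s <;> decide
      simp [turn, this _ hc]
    simp only [hc, if_true, curveFlow, h3]
    rw [← List.sum_toFinset _ hn, Finset.sum_sub_distrib, Finset.sum_ite_eq', Finset.sum_ite_eq']
    simp
  · simp [hc]

/-- In the plane, the signs of the crossings of two different closed curves add up to zero if the
crossings are counted as if the first curve were over the second one. -/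
theorem pairSum_formalSign (hL : L.HasPotentials) {l₁ l₂ : List L.Slot}
    (h₁ : ClosedPath L.glue (L.turn m) l₁) (h₂ : ClosedPath L.glue (L.turn m) l₂)
    (hn : l₁.Nodup) (hd : ∀ e ∈ l₂, e ∉ l₁ ∧ L.turn m e ∉ l₁) :
    pairSum (L.formalSign m) l₁ l₂ = 0 := by
  obtain ⟨κ, hκ, hκg⟩ := hL (curveFlow (L.turn m) l₁) (curveFlow_glue h₁)
    (fun x => sum_eq_zero_of_turn (curveFlow_turn (m := m) l₁) x)
  -- The potential in the region on a fixed side of the second curve, just before it enters at `d`.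
  let r : L.Slot → ℚ := fun d => κ (d.1, d.2 - 1)
  -- Passing through a site, the second curve changes its potential by the signed crossings with
  -- `l₁` there. `z1` and `z2` say that `l₁` does not use the strand passed. Along arcs the
  -- potential is constant, so the changes around the closed curve add up to zero.
  have jump : ∀ e ∈ l₂, ((l₁.map fun u => L.formalSign m u e).sum : ℚ) =
      κ (L.turn m e) - r e := by
    rintro ⟨x, j⟩ he
    rw [sum_formalSign hn]
    obtain ⟨h1, h2⟩ := hd _ he
    have z1 : curveFlow (L.turn m) l₁ (x, j) = 0 := by simp [curveFlow, h1, h2]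
    have z2 : curveFlow (L.turn m) l₁ (x, (m x).pairing j) = 0 := by
      have := curveFlow_turn (m := m) l₁ (x, j)
      rw [z1, neg_zero] at this
      exact this
    have k0 := hκ x 0
    have k1 := hκ x 1
    have k2 := hκ x 2
    have k3 := hκ x 3
    simp only [turn, r]
    cases hm : m x <;> simp only [hm] at z2 ⊢ <;> clear he h1 h2 <;> revert z1 z2 <;>
      revert j <;> intro j <;> fin_cases j <;>
      simp [SiteState.pairing, Fin.reduceSub, -zero_sub] at k0 k1 k2 k3 ⊢ <;> intros <;> linarith
  have path : ∀ (l : List L.Slot) (u v : L.Slot), ArcPath L.glue (L.turn m) u l v →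
      (∀ e ∈ l, e ∈ l₂) →
      (l.map fun e => ((l₁.map fun u => L.formalSign m u e).sum : ℚ)).sum = r v - κ u := by
    intro l
    induction l with
    | nil =>
      intro u v huv _
      have h := hκg u
      rw [show L.glue u = v from huv] at h
      simp [r, h]
    | cons e l ih =>
      intro u v huv hl
      have h := hκg u
      rw [huv.1] at h
      rw [List.map_cons, List.sum_cons, jump e (hl e (by simp)),
        ih _ _ huv.2 fun e he => hl e (by simp [he]), h]
      ring
  have total : (l₂.map fun e => ((l₁.map fun u => L.formalSign m u e).sum : ℚ)).sum = 0 := by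
    cases l₂ with
    | nil => simp
    | cons e t =>
      rw [List.map_cons, List.sum_cons, jump e (by simp), path t _ _ h₂ fun e he => by simp [he]]
      ring
  rw [pairSum_flip]
  unfold pairSum
  rw [← Int.cast_inj (α := ℚ)]
  push_cast
  rw [List.map_map]
  exact total

end LinkProjection

/-! ### The bracket of a descending diagram -/

namespace LinkProjection

variable {L : LinkProjection} {K : Type*} [Field K] {m m' : L.Site → SiteState}

/-- `m'` arises from `m` by smoothing the crossing `x`. -/
structure IsSmoothingAt (m m' : L.Site → SiteState) (x : L.Site) : Prop where
  off : ∀ y, y ≠ x → m' y = m y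
  smooth : ¬ (m' x).IsCrossing

theorem IsSmoothingAt.numCrossings_lt {x : L.Site} (h : IsSmoothingAt m m' x)
    (hx : (m x).IsCrossing) : L.numCrossings m' < L.numCrossings m := by
  classical
  apply Finset.card_lt_card
  rw [Finset.ssubset_iff_of_subset]
  · exact ⟨x, by simpa using hx, by simpa using h.smooth⟩
  · intro y hy
    rw [Finset.mem_filter] at hy ⊢
    refine ⟨Finset.mem_univ _, ?_⟩
    by_cases hyx : y = x
    · subst hyx; exact absurd hy.2 h.smooth
    · rw [← h.off y hyx]; exact hy.2

theorem isSmoothingAt_modify (x : L.Site) {f : SiteState → SiteState}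
    (hf : ∀ s, ¬ (f s).IsCrossing) : IsSmoothingAt m (L.modify m x f) x :=
  ⟨fun y hy => by simp [modify, hy], by simp [modify, hf]⟩

theorem isCrossing_of_isUnder {s : SiteState} {i : Fin 4} (h : s.isUnder i = true) :
    s.IsCrossing := by
  cases s <;> simp [SiteState.isUnder, SiteState.IsCrossing] at h ⊢

/-- The two smoothings of a crossing with over-strand `o` and under-strand `u`, and the expansion
of the bracket. -/
theorem exists_smoothings (A : K) {o u : L.Slot} (hs : o.1 = u.1)
    (hu : (m u.1).isUnder u.2 = true) (ho : (m u.1).isUnder o.2 = false) :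
    ∃ (m₁ m₂ : L.Site → SiteState) (ε : ℤ), (ε = 1 ∨ ε = -1) ∧
      IsSmoothingAt m m₁ u.1 ∧ IsSmoothingAt m m₂ u.1 ∧
      IsCrossSwap (L.turn m) (L.turn m₁) o u ∧ IsEndSwap (L.turn m) (L.turn m₂) o u ∧
      L.formalSign m o u = ε ∧
      L.bracket A m = A ^ ε * L.bracket A m₁ + A ^ (-ε) * L.bracket A m₂ := by
  obtain ⟨x, j⟩ := u
  obtain ⟨y, i⟩ := o
  change y = x at hs
  subst hs
  change (m y).isUnder j = true at hu
  change (m y).isUnder i = false at ho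
  have all : ∀ (s : SiteState) (i j k : Fin 4), s.isUnder j = true → s.isUnder i = false →
      k = i ∨ k = j ∨ k = s.pairing i ∨ k = s.pairing j := by
    intro s; cases s <;> decide
  have cross : ∀ f : SiteState → SiteState,
      (f (m y)).pairing i = (m y).pairing j ∧ (f (m y)).pairing j = (m y).pairing i ∧
      (f (m y)).pairing ((m y).pairing i) = j ∧ (f (m y)).pairing ((m y).pairing j) = i →
      IsCrossSwap (L.turn m) (L.turn (L.modify m y f)) (y, i) (y, j) := by
    rintro f ⟨h1, h2, h3, h4⟩
    refine ⟨?_, ?_, ?_, ?_, ?_⟩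
    · simp [turn, modify, h1]
    · simp [turn, modify, h2]
    · simp [turn, modify, h3]
    · simp [turn, modify, h4]
    · rintro ⟨y', k⟩ d1 d2 d3 d4
      have : y' ≠ y := by
        rintro rfl
        rcases all (m y') i j k hu ho with h | h | h | h <;> subst h <;> simp [turn] at d1 d2 d3 d4
      simp [turn, modify, this]
  have ends : ∀ f : SiteState → SiteState,
      (f (m y)).pairing i = j ∧ (f (m y)).pairing j = i ∧
      (f (m y)).pairing ((m y).pairing i) = (m y).pairing j ∧
      (f (m y)).pairing ((m y).pairing j) = (m y).pairing i →
      IsEndSwap (L.turn m) (L.turn (L.modify m y f)) (y, i) (y, j) := by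
    rintro f ⟨h1, h2, h3, h4⟩
    refine ⟨?_, ?_, ?_, ?_, ?_⟩
    · simp [turn, modify, h1]
    · simp [turn, modify, h2]
    · simp [turn, modify, h3]
    · simp [turn, modify, h4]
    · rintro ⟨y', k⟩ d1 d2 d3 d4
      have : y' ≠ y := by
        rintro rfl
        rcases all (m y') i j k hu ho with h | h | h | h <;> subst h <;> simp [turn] at d1 d2 d3 d4
      simp [turn, modify, this]
  -- The smoothing along the orientation is the `A`-smoothing at a positive crossing and the other
  -- one at a negative crossing; hence its coefficient is `A ^ ε`.
  have cases_sign : ∀ (s : SiteState) (i j : Fin 4), s.isUnder j = true → s.isUnder i = false →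
      (s.crossSign i j = 1 ∧
        (s.smoothA.pairing i = s.pairing j ∧ s.smoothA.pairing j = s.pairing i ∧
          s.smoothA.pairing (s.pairing i) = j ∧ s.smoothA.pairing (s.pairing j) = i) ∧
        (s.smoothB.pairing i = j ∧ s.smoothB.pairing j = i ∧
          s.smoothB.pairing (s.pairing i) = s.pairing j ∧
          s.smoothB.pairing (s.pairing j) = s.pairing i)) ∨
      (s.crossSign i j = -1 ∧
        (s.smoothB.pairing i = s.pairing j ∧ s.smoothB.pairing j = s.pairing i ∧
          s.smoothB.pairing (s.pairing i) = j ∧ s.smoothB.pairing (s.pairing j) = i) ∧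
        (s.smoothA.pairing i = j ∧ s.smoothA.pairing j = i ∧
          s.smoothA.pairing (s.pairing i) = s.pairing j ∧
          s.smoothA.pairing (s.pairing j) = s.pairing i)) := by
    intro s; cases s <;> decide
  have hb := L.bracket_eq A (isCrossing_of_isUnder hu)
  rcases cases_sign (m y) i j hu ho with ⟨h1, h2, h3⟩ | ⟨h1, h2, h3⟩
  · refine ⟨_, _, 1, Or.inl rfl, isSmoothingAt_modify y SiteState.not_isCrossing_smoothA,
      isSmoothingAt_modify y SiteState.not_isCrossing_smoothB, cross _ h2, ends _ h3, ?_, ?_⟩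
    · simp [formalSign, h1]
    · rw [hb]; simp
  · refine ⟨_, _, -1, Or.inr rfl, isSmoothingAt_modify y SiteState.not_isCrossing_smoothB,
      isSmoothingAt_modify y SiteState.not_isCrossing_smoothA, cross _ h2, ends _ h3, ?_, ?_⟩
    · simp [formalSign, h1]
    · rw [hb]; simp [add_comm]

/-- Of the strands at `u` and `v`, the first one is not under the second one. -/
def IsOver (m : L.Site → SiteState) (u v : L.Slot) : Prop :=
  u.1 = v.1 → (m u.1).isUnder u.2 = false

/-- The strands at `u` and `v` do not cross each other. -/
def Uncrossed (m : L.Site → SiteState) (u v : L.Slot) : Prop :=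
  u.1 = v.1 → ¬ (m u.1).IsCrossing

theorem Uncrossed.symm {u v : L.Slot} (h : Uncrossed m u v) : Uncrossed m v u := by
  intro h1 h2
  exact h h1.symm (by rwa [h1] at h2)

theorem Uncrossed.isOver {u v : L.Slot} (h : Uncrossed m u v) : IsOver m u v := by
  intro h1
  by_contra h2
  exact h h1 (isCrossing_of_isUnder (by simpa using h2))

/-- The sign of the crossing of the strands which enter at `u` and `v`, or zero if the second one
does not pass under the first one. -/
def overSign (m : L.Site → SiteState) (u v : L.Slot) : ℤ :=
  if (m v.1).isUnder v.2 = true then L.formalSign m u v else 0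

/-- The self-writhe of the curves in `ℓ`. -/
def writhe (m : L.Site → SiteState) (ℓ : List (List L.Slot)) : ℤ :=
  (ℓ.map fun l => pairSum (overSign m) l l).sum

theorem Uncrossed.formalSign_eq_zero {u v : L.Slot} (h : Uncrossed m u v) :
    L.formalSign m u v = 0 := by
  unfold formalSign
  split_ifs with h1
  · have := h h1
    rw [h1] at this
    cases hm : m v.1 <;> simp [hm, SiteState.IsCrossing, SiteState.crossSign] at this ⊢
  · rfl

theorem Uncrossed.overSign_eq_zero {u v : L.Slot} (h : Uncrossed m u v) :
    overSign m u v = 0 := by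
  unfold overSign
  rw [h.formalSign_eq_zero, ite_self]

theorem IsOver.overSign_eq_zero {u v : L.Slot} (h : IsOver m v u) : overSign m u v = 0 := by
  unfold overSign formalSign
  split_ifs with h1 h2
  · rw [h h2.symm] at h1; exact absurd h1 (by simp)
  · rfl
  · rfl

/-- Slots of different strands of a site. -/
theorem isUnder_eq_not {u v : L.Slot} (h : u.1 = v.1) (hc : (m u.1).IsCrossing) (h1 : u ≠ v)
    (h2 : L.turn m u ≠ v) : (m v.1).isUnder v.2 = !(m u.1).isUnder u.2 := by
  obtain ⟨x, i⟩ := u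
  obtain ⟨y, j⟩ := v
  change x = y at h
  subst h
  have h1' : i ≠ j := fun h => h1 (by rw [h])
  have h2' : (m x).pairing i ≠ j := fun h => h2 (by rw [← h]; rfl)
  change (m x).IsCrossing at hc
  change (m x).isUnder j = !(m x).isUnder i
  have key : ∀ s : SiteState, s.IsCrossing → i ≠ j → s.pairing i ≠ j →
      s.isUnder j = !s.isUnder i := by
    clear h1 h2 h1' h2'
    revert i j
    intro i j s hs
    revert i j
    cases s
    · decide
    · decide
    · exact hs.elim
    · exact hs.elim
  exact key _ hc h1' h2'

theorem formalSign_turn_left {u v : L.Slot} :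
    L.formalSign m (L.turn m u) v = - L.formalSign m u v := by
  have key : ∀ (s : SiteState) (i j : Fin 4), s.crossSign (s.pairing i) j = - s.crossSign i j := by
    intro s; cases s <;> decide
  unfold formalSign
  by_cases h : u.1 = v.1
  · rw [if_pos h, if_pos (show (L.turn m u).1 = v.1 from h)]
    change (m v.1).crossSign ((m u.1).pairing u.2) v.2 = _
    rw [h, key]
  · rw [if_neg h, if_neg (show (L.turn m u).1 ≠ v.1 from h), neg_zero]

theorem overSign_turn_left {u v : L.Slot} :
    overSign m (L.turn m u) v = - overSign m u v := by
  unfold overSign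
  rw [formalSign_turn_left]
  split_ifs <;> simp

theorem isUnder_pairing (s : SiteState) (i : Fin 4) : s.isUnder (s.pairing i) = s.isUnder i := by
  revert i; cases s <;> decide

theorem overSign_turn_right {u v : L.Slot} :
    overSign m u (L.turn m v) = - overSign m u v := by
  have key : ∀ (s : SiteState) (i j : Fin 4), s.crossSign i (s.pairing j) = - s.crossSign i j := by
    intro s; cases s <;> decide
  unfold overSign formalSign
  change (if (m v.1).isUnder ((m v.1).pairing v.2) = true then
    (if u.1 = v.1 then (m v.1).crossSign u.2 ((m v.1).pairing v.2) else 0) else 0) = _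
  rw [key, isUnder_pairing]
  split_ifs <;> simp

theorem IsOver.turn_left {u v : L.Slot} (h : IsOver m u v) : IsOver m (L.turn m u) v := by
  intro h1
  change (m u.1).isUnder ((m u.1).pairing u.2) = false
  rw [isUnder_pairing]
  exact h h1

theorem IsOver.turn_right {u v : L.Slot} (h : IsOver m u v) : IsOver m u (L.turn m v) := h

theorem Uncrossed.turn_left {u v : L.Slot} (h : Uncrossed m u v) : Uncrossed m (L.turn m u) v := h

theorem Uncrossed.turn_right {u v : L.Slot} (h : Uncrossed m u v) : Uncrossed m u (L.turn m v) := h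

namespace IsSmoothingAt

variable {x : L.Site}

theorem isOver (h : IsSmoothingAt m m' x) {u v : L.Slot} (huv : IsOver m u v) :
    IsOver m' u v := by
  intro h1
  by_cases hx : u.1 = x
  · by_contra h2
    apply h.smooth
    rw [hx] at h2
    exact isCrossing_of_isUnder (by simpa using h2)
  · rw [h.off _ hx]; exact huv h1

theorem uncrossed (h : IsSmoothingAt m m' x) {u v : L.Slot} (huv : Uncrossed m u v) :
    Uncrossed m' u v := by
  intro h1
  by_cases hx : u.1 = x
  · rw [hx]; exact h.smooth
  · rw [h.off _ hx]; exact huv h1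

theorem uncrossed_left (h : IsSmoothingAt m m' x) {u v : L.Slot} (hu : u.1 = x) :
    Uncrossed m' u v := by
  intro _
  rw [hu]; exact h.smooth

theorem uncrossed_right (h : IsSmoothingAt m m' x) {u v : L.Slot} (hv : v.1 = x) :
    Uncrossed m' u v :=
  (h.uncrossed_left hv).symm

theorem overSign_eq (h : IsSmoothingAt m m' x) {u v : L.Slot} (hv : v.1 ≠ x) :
    overSign m' u v = overSign m u v := by
  unfold overSign formalSign
  rw [h.off _ hv]

theorem formalSign_eq (h : IsSmoothingAt m m' x) {u v : L.Slot} (hv : v.1 ≠ x) :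
    L.formalSign m' u v = L.formalSign m u v := by
  unfold formalSign
  rw [h.off _ hv]

end IsSmoothingAt

theorem overSign_eq_formalSign {u v : L.Slot} (h : (m v.1).isUnder v.2 = true) :
    overSign m u v = L.formalSign m u v := by
  unfold overSign
  rw [if_pos h]

end LinkProjection

/-! ### Lists: choice of a crossing and preservation of descending order -/

/-- With `N` meaning "uncrossed", this finds the first return to an earlier strand: the loop between
the two passages has no self-crossings and does not meet what precedes it. -/
theorem List.exists_first_pair {X : Type*} {N : X → X → Prop} {l : List X}
    (h : ¬ l.Pairwise N) :
    ∃ P a Q c S, l = P ++ a :: Q ++ c :: S ∧ ¬ N a c ∧ (P ++ a :: Q).Pairwise N := by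
  induction l using List.reverseRecOn with
  | nil => exact absurd List.Pairwise.nil h
  | append_singleton l c ih =>
    by_cases hl : l.Pairwise N
    · rw [List.pairwise_append] at h
      simp only [hl, List.pairwise_singleton, true_and, List.mem_singleton, forall_eq] at h
      push Not at h
      obtain ⟨a, ha, hac⟩ := h
      obtain ⟨P, Q, rfl⟩ := List.append_of_mem ha
      exact ⟨P, a, Q, c, [], rfl, hac, hl⟩
    · obtain ⟨P, a, Q, c', S, rfl, h1, h2⟩ := ih hl
      exact ⟨P, a, Q, c', S ++ [c], by simp, h1, h2⟩

theorem List.exists_first {X : Type*} {p : X → Prop} {l : List X} (h : ∃ x ∈ l, p x) :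
    ∃ l₁ x l₂, l = l₁ ++ x :: l₂ ∧ p x ∧ ∀ y ∈ l₁, ¬ p y := by
  induction l with
  | nil => simp at h
  | cons a l ih =>
    by_cases ha : p a
    · exact ⟨[], a, l, rfl, ha, by simp⟩
    · obtain ⟨x, hx, hpx⟩ := h
      rcases List.mem_cons.1 hx with rfl | hx
      · exact absurd hpx ha
      · obtain ⟨l₁, y, l₂, rfl, h1, h2⟩ := ih ⟨x, hx, hpx⟩
        refine ⟨a :: l₁, y, l₂, rfl, h1, ?_⟩
        intro z hz
        rcases List.mem_cons.1 hz with rfl | hz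
        · exact ha
        · exact h2 z hz
section

variable {X : Type*} {R R' N : X → X → Prop} {x : X → Prop} {τ : X → X}
  {T₁ T₂ P Q S : List X} {a c d : X}

/-- In this and the next lemmas `R` and `R'` mean "not under" before and after a smoothing, `N`
means "uncrossed" and `x` "at the smoothed site". The detached loop is moved in front of `P`, which
is harmless because the two do not cross. -/
theorem List.Pairwise.split_loop (h : ∀ u v, R u v → R' u v)
    (hl : ∀ u v, x u → R' u v) (hr : ∀ u v, x v → R' u v) (hN : ∀ u v, N u v → R' v u)
    (ha : x a) (hc : x c) (hd : (T₁ ++ ((P ++ a :: Q ++ c :: S) ++ T₂)).Pairwise R)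
    (hQ : (P ++ a :: Q).Pairwise N) :
    (T₁ ++ ((Q ++ [c]) ++ ((P ++ a :: S) ++ T₂))).Pairwise R' := by
  have mono : ∀ l : List X, l.Pairwise R → l.Pairwise R' := fun l hl => hl.imp (h _ _)
  simp only [List.pairwise_append, List.pairwise_cons, List.Pairwise.nil, List.not_mem_nil,
    List.mem_append, List.mem_cons] at hd hQ ⊢
  grind

/-- Height relations to strands outside the loop do not depend on its direction; inside the loop
there are no crossings, so reversing it does no harm. -/
theorem List.Pairwise.flip_loop (h : ∀ u v, R u v → R' u v) (hτl : ∀ u v, R u v → R' (τ u) v)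
    (hτr : ∀ u v, R u v → R' u (τ v)) (hN : ∀ u v, N u v → R' (τ v) (τ u))
    (hl : ∀ u v, x u → R' u v) (hr : ∀ u v, x v → R' u v) (ha : x a) (hx : x d)
    (hd : (T₁ ++ ((P ++ a :: Q ++ c :: S) ++ T₂)).Pairwise R) (hQ : (P ++ a :: Q).Pairwise N) :
    (T₁ ++ ((P ++ a :: Q.reverse.map τ ++ d :: S) ++ T₂)).Pairwise R' := by
  have hrev : (Q.reverse.map τ).Pairwise R' := by
    rw [List.pairwise_map, List.pairwise_reverse]
    simp only [List.pairwise_append, List.pairwise_cons] at hQ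
    exact hQ.2.1.2.imp fun h => hN _ _ h
  have hmem : ∀ v ∈ Q.reverse.map τ, ∃ u ∈ Q, v = τ u := by
    intro v hv
    obtain ⟨u, hu, rfl⟩ := List.mem_map.1 hv
    exact ⟨u, List.mem_reverse.1 hu, rfl⟩
  have mono : ∀ l : List X, l.Pairwise R → l.Pairwise R' := fun l hl => hl.imp (h _ _)
  have hQS : ∀ v ∈ Q.reverse.map τ, ∀ w, (∀ u ∈ Q, R u w) → R' v w := by
    intro v hv w hw
    obtain ⟨u, hu, rfl⟩ := hmem v hv
    exact hτl _ _ (hw u hu)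
  have hTQ : ∀ v ∈ Q.reverse.map τ, ∀ w, (∀ u ∈ Q, R w u) → R' w v := by
    intro v hv w hw
    obtain ⟨u, hu, rfl⟩ := hmem v hv
    exact hτr _ _ (hw u hu)
  generalize Q.reverse.map τ = Q' at *
  clear hQ hmem hτl hτr
  simp only [List.pairwise_append, List.pairwise_cons, List.mem_append, List.mem_cons] at hd ⊢
  grind

/-- The upper curve is inserted into the lower one behind `P`; only its pairs with `P` change their
order, and these do not cross. -/
theorem List.Pairwise.merge_loop (h : ∀ u v, R u v → R' u v)
    (hl : ∀ u v, x u → R' u v) (hr : ∀ u v, x v → R' u v) (ha : x a) (hc : x c)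
    (hd : (T₁ ++ ((Q ++ [c]) ++ ((P ++ a :: S) ++ T₂))).Pairwise R)
    (hP : ∀ u ∈ P, ∀ v ∈ Q, N u v) (hN : ∀ u v, N u v → R' u v) :
    (T₁ ++ ((P ++ a :: Q ++ c :: S) ++ T₂)).Pairwise R' := by
  have mono : ∀ l : List X, l.Pairwise R → l.Pairwise R' := fun l hl => hl.imp (h _ _)
  simp only [List.pairwise_append, List.pairwise_cons, List.Pairwise.nil, List.not_mem_nil,
    List.mem_append, List.mem_cons] at hd ⊢
  grind

theorem List.Pairwise.merge_flip_loop (h : ∀ u v, R u v → R' u v)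
    (hτl : ∀ u v, R u v → R' (τ u) v) (hτr : ∀ u v, R u v → R' u (τ v))
    (hN : ∀ u v, N u v → R' (τ v) (τ u))
    (hN' : ∀ u v, N u v → R' u (τ v))
    (hl : ∀ u v, x u → R' u v) (hr : ∀ u v, x v → R' u v) (ha : x a) (hx : x d)
    (hd : (T₁ ++ ((Q ++ [c]) ++ ((P ++ a :: S) ++ T₂))).Pairwise R)
    (hP : ∀ u ∈ P, ∀ v ∈ Q, N u v) (hQ : Q.Pairwise N) :
    (T₁ ++ ((P ++ a :: Q.reverse.map τ ++ d :: S) ++ T₂)).Pairwise R' := by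
  have hrev : (Q.reverse.map τ).Pairwise R' := by
    rw [List.pairwise_map, List.pairwise_reverse]
    exact hQ.imp fun h => hN _ _ h
  have hmem : ∀ v ∈ Q.reverse.map τ, ∃ u ∈ Q, v = τ u := by
    intro v hv
    obtain ⟨u, hu, rfl⟩ := List.mem_map.1 hv
    exact ⟨u, List.mem_reverse.1 hu, rfl⟩
  have mono : ∀ l : List X, l.Pairwise R → l.Pairwise R' := fun l hl => hl.imp (h _ _)
  have hQS : ∀ v ∈ Q.reverse.map τ, ∀ w, (∀ u ∈ Q, R u w) → R' v w := by
    intro v hv w hw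
    obtain ⟨u, hu, rfl⟩ := hmem v hv
    exact hτl _ _ (hw u hu)
  have hTQ : ∀ v ∈ Q.reverse.map τ, ∀ w, (∀ u ∈ Q, R w u) → R' w v := by
    intro v hv w hw
    obtain ⟨u, hu, rfl⟩ := hmem v hv
    exact hτr _ _ (hw u hu)
  have hPQ : ∀ v ∈ Q.reverse.map τ, ∀ w ∈ P, R' w v := by
    intro v hv w hw
    obtain ⟨u, hu, rfl⟩ := hmem v hv
    exact hN' _ _ (hP w hw u hu)
  generalize Q.reverse.map τ = Q' at *
  clear hQ hmem hτl hτr hP hN hN'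
  simp only [List.pairwise_append, List.pairwise_cons, List.mem_append, List.mem_cons] at hd ⊢
  grind

end

/-! ### Writhes after a smoothing, and the local identities -/

namespace LinkProjection

section

variable {X : Type*} {o : X → X → ℤ} {P Q S : List X} {a c : X}

/-- Before the first return nothing is crossed and `S` lies below the rest, so only crossings whose
lower strand is in `S` are left, besides the one of `a` and `c`. -/
theorem pairSum_crossed (h0 : ∀ u ∈ P ++ Q, ∀ v ∈ P ++ Q, o u v = 0)
    (hS : ∀ u ∈ S, ∀ v ∈ P ++ Q, o u v = 0)
    (ha : ∀ e ∈ P ++ Q ++ S, o a e = 0 ∧ o e a = 0) (hc : ∀ e ∈ P ++ Q ++ S, o c e = 0 ∧ o e c = 0)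
    (haa : o a a = 0) (hcc : o c c = 0) (hca : o c a = 0) :
    pairSum o (P ++ a :: Q ++ c :: S) (P ++ a :: Q ++ c :: S) =
      pairSum o P S + pairSum o Q S + pairSum o S S + o a c := by
  have e : P ++ a :: Q ++ c :: S = P ++ ([a] ++ (Q ++ ([c] ++ S))) := by simp
  have z : ∀ {B B' : List X}, (∀ u ∈ B, ∀ v ∈ B', o u v = 0) → pairSum o B B' = 0 :=
    fun h => pairSum_eq_zero h
  have s : ∀ u v, pairSum o [u] [v] = o u v := fun u v => by simp [pairSum]
  simp only [List.mem_append] at h0 hS ha hc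
  rw [e]
  simp only [pairSum_append_left, pairSum_append_right, s, haa, hcc, hca]
  rw [z (B := P) (B' := P), z (B := P) (B' := [a]), z (B := P) (B' := Q), z (B := P) (B' := [c]),
    z (B := [a]) (B' := P), z (B := [a]) (B' := Q), z (B := [a]) (B' := S),
    z (B := Q) (B' := P), z (B := Q) (B' := [a]), z (B := Q) (B' := Q), z (B := Q) (B' := [c]),
    z (B := [c]) (B' := P), z (B := [c]) (B' := Q), z (B := [c]) (B' := S),
    z (B := S) (B' := P), z (B := S) (B' := [a]), z (B := S) (B' := Q), z (B := S) (B' := [c])]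
  · ring
  all_goals
    intros u hu v hv
    try rw [List.mem_singleton] at hu
    try rw [List.mem_singleton] at hv
    subst_vars
    first
    | apply h0 <;> tauto
    | apply hS <;> tauto
    | exact (ha _ (by tauto)).1
    | exact (ha _ (by tauto)).2
    | exact (hc _ (by tauto)).1
    | exact (hc _ (by tauto)).2

theorem pairSum_loop (h0 : ∀ u ∈ Q, ∀ v ∈ Q, o u v = 0)
    (hc : ∀ e ∈ Q, o c e = 0 ∧ o e c = 0) (hcc : o c c = 0) :
    pairSum o (Q ++ [c]) (Q ++ [c]) = 0 := by
  apply pairSum_eq_zero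
  simp only [List.mem_append, List.mem_singleton]
  rintro u (hu | rfl) v (hv | rfl)
  · exact h0 u hu v hv
  · exact (hc u hu).2
  · exact (hc v hv).1
  · exact hcc

theorem pairSum_rest (ha : ∀ e ∈ P ++ S, o a e = 0 ∧ o e a = 0) (haa : o a a = 0) :
    pairSum o (P ++ a :: S) (P ++ a :: S) = pairSum o (P ++ S) (P ++ S) := by
  have e : P ++ a :: S = P ++ ([a] ++ S) := by simp
  have s : ∀ u v, pairSum o [u] [v] = o u v := fun u v => by simp [pairSum]
  have z1 : ∀ B : List X, (∀ e ∈ B, e ∈ P ++ S) → pairSum o [a] B = 0 := fun B hB =>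
    pairSum_eq_zero fun u hu v hv => by
      rw [List.mem_singleton.1 hu]; exact (ha v (hB v hv)).1
  have z2 : ∀ B : List X, (∀ e ∈ B, e ∈ P ++ S) → pairSum o B [a] = 0 := fun B hB =>
    pairSum_eq_zero fun u hu v hv => by
      rw [List.mem_singleton.1 hv]; exact (ha u (hB u hu)).2
  rw [e]
  simp only [pairSum_append_left, pairSum_append_right, s, haa]
  rw [z1 P (by simp +contextual), z1 S (by simp +contextual), z2 P (by simp +contextual),
    z2 S (by simp +contextual)]
  ring

end

variable {L : LinkProjection} {K : Type*} [Field K] {m m₁ : L.Site → SiteState}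

theorem writhe_append (ℓ₁ ℓ₂ : List (List L.Slot)) :
    writhe m (ℓ₁ ++ ℓ₂) = writhe m ℓ₁ + writhe m ℓ₂ := by
  simp [writhe]

theorem writhe_cons (l : List L.Slot) (ℓ : List (List L.Slot)) :
    writhe m (l :: ℓ) = pairSum (overSign m) l l + writhe m ℓ := by
  simp [writhe]

theorem IsSmoothingAt.pairSum_eq {x : L.Site} (h : IsSmoothingAt m m₁ x) {l l' : List L.Slot}
    (hl : ∀ e ∈ l', e.1 ≠ x) : pairSum (overSign m₁) l l' = pairSum (overSign m) l l' :=
  pairSum_congr fun _ _ v hv => h.overSign_eq (hl v hv)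

theorem IsSmoothingAt.writhe_eq {x : L.Site} (h : IsSmoothingAt m m₁ x) {ℓ : List (List L.Slot)}
    (hℓ : ∀ e ∈ ℓ.flatten, e.1 ≠ x) : writhe m₁ ℓ = writhe m ℓ := by
  unfold writhe
  congr 1
  refine List.map_congr_left fun l hl => h.pairSum_eq fun e he => ?_
  exact hℓ e (List.mem_flatten.2 ⟨l, hl, he⟩)

theorem overSign_eq_zero_of_ne {u v : L.Slot} (h : u.1 ≠ v.1) : overSign m u v = 0 :=
  Uncrossed.overSign_eq_zero fun h' => absurd h' h

theorem overSign_self (u : L.Slot) : overSign m u u = 0 := by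
  have h : ∀ (s : SiteState) (i : Fin 4), s.crossSign i i = 0 := by intro s; cases s <;> decide
  unfold overSign formalSign
  simp [h]

theorem IsSmoothingAt.overSign_eq_zero_left {x : L.Site} (h : IsSmoothingAt m m₁ x) {u v : L.Slot}
    (hu : u.1 = x) : overSign m₁ u v = 0 := (h.uncrossed_left hu).overSign_eq_zero

theorem IsSmoothingAt.overSign_eq_zero_right {x : L.Site} (h : IsSmoothingAt m m₁ x)
    {u v : L.Slot} (hv : v.1 = x) : overSign m₁ u v = 0 := (h.uncrossed_right hv).overSign_eq_zero

theorem overSign_eq_zero_of_pairwise {l : List L.Slot} (h : l.Pairwise (Uncrossed m)) :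
    ∀ u ∈ l, ∀ v ∈ l, overSign m u v = 0 := by
  have : Std.Symm fun u v : L.Slot => overSign m u v = 0 ∧ overSign m v u = 0 :=
    ⟨fun _ _ h => h.symm⟩
  have h1 : ∀ u ∈ l, ∀ v ∈ l, overSign m u v = 0 ∧ overSign m v u = 0 := fun u hu v hv =>
    List.Pairwise.forall_of_forall (R := fun u v => overSign m u v = 0 ∧ overSign m v u = 0)
      (fun u _ => ⟨overSign_self u, overSign_self u⟩)
      (h.imp fun h => ⟨h.overSign_eq_zero, h.symm.overSign_eq_zero⟩) hu hv
  exact fun u hu v hv => (h1 u hu v hv).1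

/-- The slots off a site whose two strands are entered at `a` and `c`. -/
theorem fst_ne_of_covers {a c : L.Slot} {F : List L.Slot} (hac : a.1 = c.1)
    (hcov : CoversStrands (L.turn m) (a :: c :: F)) : ∀ e ∈ F, e.1 ≠ a.1 := by
  intro e he hea
  obtain ⟨h1, h2, h3, h4⟩ := hcov.off he
  obtain ⟨hn, hm⟩ := hcov
  have ha := (hm a).1 (by simp)
  simp only [List.nodup_cons, List.mem_cons, not_or] at hn ha
  obtain ⟨x, i⟩ := a
  obtain ⟨y, j⟩ := c
  obtain ⟨y', k⟩ := e
  change x = y at hac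
  change y' = x at hea
  subst hac hea
  have key : ∀ (s : SiteState) (i j k : Fin 4), i ≠ j → s.pairing i ≠ j → k ≠ i → k ≠ j →
      k ≠ s.pairing i → k = s.pairing j := by
    intro s; cases s <;> decide
  have e1 : ∀ k k' : Fin 4, ((y', k) : L.Slot) ≠ (y', k') → k ≠ k' := fun k k' h h' =>
    h (by rw [h'])
  exact h4 (by
    change (y', k) = (y', (m y').pairing j)
    rw [key (m y') i j k (e1 _ _ hn.1.1) (e1 _ _ ha.2.1) (e1 _ _ h1) (e1 _ _ h2) (e1 _ _ h3)])

/-- The value of the bracket at descending diagrams. -/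
noncomputable def descendingValue (A : K) (m : L.Site → SiteState) (ℓ : List (List L.Slot)) : K :=
  (-A ^ 3) ^ writhe m ℓ * (-(A ^ 2 + (A ^ 2)⁻¹)) ^ ((ℓ.length + L.circles : ℤ) - 1)

/-- The bracket of a curl of sign `ε`: the first smoothing has an additional circle. -/
theorem curl_identity {A : K} (hA : A ≠ 0) {ε : ℤ} (hε : ε = 1 ∨ ε = -1) :
    A ^ ε * -(A ^ 2 + (A ^ 2)⁻¹) + A ^ (-ε) = (-A ^ 3) ^ ε := by
  rcases hε with rfl | rfl
  · simp only [zpow_one, zpow_neg]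
    field_simp
    ring
  · simp only [zpow_one, zpow_neg, neg_neg]
    field_simp
    ring

/-- For two crossing components, both smoothings have one component less, and their writhes differ
by `-ε` and `ε` from the original. Together they restore the lost factor `δ`. -/
theorem loop_identity {A : K} (hA : A ≠ 0) {ε : ℤ} (hε : ε = 1 ∨ ε = -1) :
    A ^ ε * (-A ^ 3) ^ (-ε) + A ^ (-ε) * (-A ^ 3) ^ ε = -(A ^ 2 + (A ^ 2)⁻¹) := by
  rcases hε with rfl | rfl
  · simp only [zpow_one, zpow_neg]
    field_simp
    ring
  · simp only [zpow_one, zpow_neg, neg_neg]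
    field_simp
    ring

/-- After the loop is detached, it and the rest are different closed curves and cross algebraically
zero times. `P` does not meet the loop and the slots at `x` no longer cross anything, so the whole
count comes from `Q` and `S`. -/
theorem pairSum_overSign_eq_zero_of_closed (hL : L.HasPotentials) {P Q S : List L.Slot}
    {a c : L.Slot} {ℓ : List (List L.Slot)} {x : L.Site}
    (hs : IsSmoothingAt m m₁ x) (ha : a.1 = x) (hc : c.1 = x)
    (ht : IsTraversal L.glue (L.turn m₁) ((Q ++ [c]) :: (P ++ a :: S) :: ℓ))
    (hPQ : ∀ u ∈ Q, ∀ v ∈ P, Uncrossed m u v)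
    (hQS : ∀ u ∈ Q, ∀ v ∈ S, overSign m u v = L.formalSign m u v)
    (hx : ∀ e ∈ P ++ S, e.1 ≠ x) :
    pairSum (overSign m) Q S = 0 := by
  have hn := List.nodup_flatten.1 ht.covers.1
  have hdis := (List.pairwise_cons.1 hn.2).1 (P ++ a :: S) (by simp)
  have key := pairSum_formalSign (m := m₁) hL (ht.closed (Q ++ [c]) (by simp))
    (ht.closed (P ++ a :: S) (by simp)) (hn.1 _ (by simp)) (fun e he => by
      have h1 : e ∈ ((Q ++ [c]) :: (P ++ a :: S) :: ℓ).flatten :=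
        List.mem_flatten.2 ⟨_, by simp, he⟩
      refine ⟨fun h => hdis h he, fun h => (ht.covers.2 e).1 h1 ?_⟩
      exact List.mem_flatten.2 ⟨_, List.mem_cons_self, h⟩)
  have e : P ++ a :: S = P ++ ([a] ++ S) := by simp
  rw [e] at key
  simp only [pairSum_append_left, pairSum_append_right] at key
  simp only [List.mem_append] at hx
  have zx : ∀ B B' : List L.Slot, (∀ u ∈ B, u.1 = x) → pairSum (L.formalSign m₁) B B' = 0 :=
    fun B B' hB => pairSum_eq_zero fun u hu v hv => (hs.uncrossed_left (hB u hu)).formalSign_eq_zero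
  have zx' : ∀ B B' : List L.Slot, (∀ u ∈ B', u.1 = x) → pairSum (L.formalSign m₁) B B' = 0 :=
    fun B B' hB => pairSum_eq_zero fun u hu v hv => (hs.uncrossed_right (hB v hv)).formalSign_eq_zero
  rw [zx [c] P (by simpa using hc), zx [c] [a] (by simpa using hc), zx [c] S (by simpa using hc),
    zx' Q [a] (by simpa using ha),
    pairSum_eq_zero fun u hu v hv => (hs.uncrossed (hPQ u hu v hv)).formalSign_eq_zero] at key
  have h2 : pairSum (overSign m) Q S = pairSum (L.formalSign m₁) Q S :=
    pairSum_congr fun u hu v hv => by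
      rw [hQS u hu v hv, hs.formalSign_eq (hx v (Or.inr hv))]
  rw [h2]
  linarith

/-- The strands entered at `u` and `v` are different, and the first one is not under the second
one. -/
theorem overSign_eq_formalSign_of_isOver {u v : L.Slot} (h : IsOver m u v) (h1 : u ≠ v)
    (h2 : L.turn m u ≠ v) : overSign m u v = L.formalSign m u v := by
  by_cases hs : u.1 = v.1
  · by_cases hc : (m u.1).IsCrossing
    · apply overSign_eq_formalSign
      rw [isUnder_eq_not hs hc h1 h2, h hs]; rfl
    · have : Uncrossed m u v := fun _ => hc
      rw [this.overSign_eq_zero, this.formalSign_eq_zero]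
  · have : Uncrossed m u v := fun h => absurd h hs
    rw [this.overSign_eq_zero, this.formalSign_eq_zero]

end LinkProjection

/-! ### The two inductive steps for descending diagrams -/

namespace LinkProjection

variable {L : LinkProjection} {K : Type*} [Field K] {m : L.Site → SiteState}

theorem exists_site_of_not_uncrossed {a c : L.Slot} (h : ¬ Uncrossed m a c) :
    a.1 = c.1 ∧ (m a.1).IsCrossing := by
  unfold Uncrossed at h
  push Not at h
  exact h

theorem turn_ne_of_isTraversal {ℓ : List (List L.Slot)} (ht : IsTraversal L.glue (L.turn m) ℓ)
    {u v : L.Slot} (hu : u ∈ ℓ.flatten) (hv : v ∈ ℓ.flatten) : L.turn m u ≠ v := by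
  rintro rfl
  exact (ht.covers.2 u).1 hu hv

/-- The inductive step for a component which crosses itself. -/
theorem bracket_of_self_crossing {A : K} (hA : A ≠ 0) (hδ : A ^ 2 + (A ^ 2)⁻¹ ≠ 0)
    (hL : L.HasPotentials)
    (ih : ∀ m' ℓ', L.numCrossings m' < L.numCrossings m → IsTraversal L.glue (L.turn m') ℓ' →
      ℓ'.flatten.Pairwise (IsOver m') → L.bracket A m' = descendingValue A m' ℓ')
    {ℓ₁ ℓ₂ : List (List L.Slot)} {P Q S : List L.Slot} {a c : L.Slot}
    (ht : IsTraversal L.glue (L.turn m) (ℓ₁ ++ (P ++ a :: Q ++ c :: S) :: ℓ₂))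
    (hd : (ℓ₁ ++ (P ++ a :: Q ++ c :: S) :: ℓ₂).flatten.Pairwise (IsOver m))
    (hac : ¬ Uncrossed m a c) (hPQ : (P ++ a :: Q).Pairwise (Uncrossed m)) :
    L.bracket A m = descendingValue A m (ℓ₁ ++ (P ++ a :: Q ++ c :: S) :: ℓ₂) := by
  obtain ⟨hx, hcr⟩ := exists_site_of_not_uncrossed hac
  have hfl : (ℓ₁ ++ (P ++ a :: Q ++ c :: S) :: ℓ₂).flatten =
      ℓ₁.flatten ++ ((P ++ a :: Q ++ c :: S) ++ ℓ₂.flatten) := by simp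
  have ht' : IsTraversal L.glue (L.turn m) ((P ++ a :: Q ++ c :: S) :: (ℓ₁ ++ ℓ₂)) :=
    ht.perm List.perm_middle
  have hcov := ht'.covers
  rw [List.flatten_cons] at hcov
  have hcov' := hcov.perm perm_crossed
  have hoff := fst_ne_of_covers hx hcov'
  have hn := hcov'.1
  have hd' := hd
  rw [hfl] at hd'
  have hne : a ≠ c := by
    rintro rfl
    simp at hn
  have hne' : L.turn m a ≠ c := turn_ne_of_isTraversal ht' (by simp) (by simp)
  have hover : IsOver m a c := by
    have h1 := (List.pairwise_append.1 hd').2.1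
    have h2 := (List.pairwise_append.1 h1).1
    exact (List.pairwise_append.1 h2).2.2 a (by simp) c (by simp)
  have hua : (m c.1).isUnder a.2 = false := by rw [← hx]; exact hover hx
  have huc : (m c.1).isUnder c.2 = true := by
    rw [isUnder_eq_not hx hcr hne hne', hover hx]; rfl
  have hac' : overSign m a c = L.formalSign m a c := overSign_eq_formalSign huc
  obtain ⟨m₁, m₂, ε, hε, h₁, h₂, hs₁, hs₂, hsign, hb⟩ := exists_smoothings A hx huc hua
  rw [hx] at hoff
  have hcr' : (m c.1).IsCrossing := by rwa [← hx]
  have o0 := overSign_eq_zero_of_pairwise hPQ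
  have offP : ∀ e ∈ P ++ Q ++ S, e.1 ≠ c.1 := fun e he => hoff e (by
    simp only [List.mem_append] at he ⊢; tauto)
  have oS : ∀ u ∈ S, ∀ v ∈ P ++ Q, overSign m u v = 0 := by
    intro u hu v hv
    apply IsOver.overSign_eq_zero
    have h1 := (List.pairwise_append.1 hd').2.1
    have h2 := (List.pairwise_append.1 h1).1
    refine (List.pairwise_append.1 h2).2.2 v ?_ u (by simp [hu])
    simp only [List.mem_append, List.mem_cons] at hv ⊢
    tauto
  have hQS : ∀ u ∈ Q, ∀ v ∈ S, IsOver m u v := by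
    intro u hu v hv
    have h1 := (List.pairwise_append.1 hd').2.1
    have h2 := (List.pairwise_append.1 h1).1
    exact (List.pairwise_append.1 h2).2.2 u (by simp [hu]) v (by simp [hv])
  have oa : ∀ e ∈ P ++ Q ++ S, overSign m a e = 0 ∧ overSign m e a = 0 := fun e he =>
    ⟨overSign_eq_zero_of_ne (by rw [hx]; exact (offP e he).symm),
      overSign_eq_zero_of_ne (by rw [hx]; exact offP e he)⟩
  have oc : ∀ e ∈ P ++ Q ++ S, overSign m c e = 0 ∧ overSign m e c = 0 := fun e he =>
    ⟨overSign_eq_zero_of_ne (offP e he).symm, overSign_eq_zero_of_ne (offP e he)⟩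
  have o0' : ∀ u ∈ P ++ Q, ∀ v ∈ P ++ Q, overSign m u v = 0 := fun u hu v hv => by
    apply o0 <;> simp only [List.mem_append, List.mem_cons] at hu hv ⊢ <;> tauto
  have w0 := pairSum_crossed (o := overSign m) o0' oS oa oc (overSign_self a) (overSign_self c)
    (hover.overSign_eq_zero)
  have t₁ := ht'.split_of_crossed hs₁
  -- This makes the writhe independent of the direction of the loop; without planarity the two
  -- smoothings could have different writhes.
  have hQS0 : pairSum (overSign m) Q S = 0 := by
    refine pairSum_overSign_eq_zero_of_closed hL h₁ hx rfl t₁ ?_ ?_ ?_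
    · intro u hu v hv
      exact ((List.pairwise_append.1 hPQ).2.2 v hv u (by simp [hu])).symm
    · intro u hu v hv
      refine overSign_eq_formalSign_of_isOver (hQS u hu v hv) ?_ ?_
      · rintro rfl
        simp only [List.nodup_cons, List.nodup_append] at hn
        exact hn.2.2.2.2 u hu u (by simp [hv]) rfl
      · exact turn_ne_of_isTraversal ht' (by simp [hu]) (by simp [hv])
    · intro e he
      exact offP e (by simp only [List.mem_append] at he ⊢; tauto)
  have offℓ₁ : ∀ e ∈ ℓ₁.flatten, e.1 ≠ c.1 := fun e he => hoff e (by
    rw [List.flatten_append]; simp only [List.mem_append]; tauto)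
  have offℓ₂ : ∀ e ∈ ℓ₂.flatten, e.1 ≠ c.1 := fun e he => hoff e (by
    rw [List.flatten_append]; simp only [List.mem_append]; tauto)
  -- The detached loop is traversed before the rest of its component: it lies over `S` and does not
  -- cross `P`.
  have b₁ : L.bracket A m₁ = descendingValue A m₁ (ℓ₁ ++ (Q ++ [c]) :: (P ++ a :: S) :: ℓ₂) := by
    refine ih m₁ _ (h₁.numCrossings_lt hcr') (t₁.perm ?_) ?_
    · exact ((List.perm_middle (a := Q ++ [c]) (l₁ := ℓ₁) (l₂ := (P ++ a :: S) :: ℓ₂)).trans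
        (List.Perm.cons _ List.perm_middle)).symm
    · have := List.Pairwise.split_loop (R' := IsOver m₁) (x := fun u : L.Slot => u.1 = c.1)
        (fun _ _ => h₁.isOver)
        (fun u v hu => (h₁.uncrossed_left hu).isOver) (fun u v hv => (h₁.uncrossed_right hv).isOver)
        (fun u v huv => (h₁.uncrossed huv).symm.isOver) hx rfl hd' hPQ
      simpa using this
  have b₂ : L.bracket A m₂ = descendingValue A m₂
      (ℓ₁ ++ (P ++ a :: Q.reverse.map (L.turn m) ++ L.turn m a :: S) :: ℓ₂) := by
    refine ih m₂ _ (h₂.numCrossings_lt hcr')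
      ((ht'.flipped_of_crossed L.glue_glue (L.turn_turn m) hs₂).perm List.perm_middle.symm) ?_
    have := List.Pairwise.flip_loop (R' := IsOver m₂) (x := fun u : L.Slot => u.1 = c.1)
        (τ := L.turn m) (a := a) (d := L.turn m a) (fun _ _ => h₂.isOver)
        (fun u v huv => h₂.isOver huv.turn_left) (fun u v huv => h₂.isOver huv.turn_right)
        (fun u v huv => (h₂.uncrossed huv.symm.turn_left.turn_right).isOver)
        (fun u v hu => (h₂.uncrossed_left hu).isOver) (fun u v hv => (h₂.uncrossed_right hv).isOver)
        hx hx hd' hPQ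
    simpa using this
  -- The crossings of `Q` with `S` no longer count as self-crossings, but their signs add up to
  -- zero. Only the sign of the smoothed crossing is lost.
  have w₁ : writhe m₁ (ℓ₁ ++ (Q ++ [c]) :: (P ++ a :: S) :: ℓ₂) =
      writhe m (ℓ₁ ++ (P ++ a :: Q ++ c :: S) :: ℓ₂) - ε := by
    rw [writhe_append, writhe_append, writhe_cons, writhe_cons, writhe_cons, w0,
      h₁.writhe_eq offℓ₁, h₁.writhe_eq offℓ₂, hQS0, hac', hsign]
    rw [pairSum_loop, pairSum_rest]
    · rw [h₁.pairSum_eq fun e he => offP e (by simp only [List.mem_append] at he ⊢; tauto)]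
      simp only [pairSum_append_left, pairSum_append_right]
      rw [pairSum_eq_zero fun u hu v hv => o0' u (by simp [hu]) v (by simp [hv]),
        pairSum_eq_zero fun u hu v hv => oS u hu v (by simp [hv])]
      ring
    · exact fun e _ => ⟨h₁.overSign_eq_zero_left hx, h₁.overSign_eq_zero_right hx⟩
    · exact h₁.overSign_eq_zero_left hx
    · intro u hu v hv
      rw [h₁.overSign_eq (offP v (by simp [hv]))]
      exact o0' u (by simp [hu]) v (by simp [hv])
    · exact fun e _ => ⟨h₁.overSign_eq_zero_left rfl, h₁.overSign_eq_zero_right rfl⟩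
    · exact h₁.overSign_eq_zero_left rfl
  -- Reversing the loop changes the signs of its crossings with `S`, whose sum is zero anyway.
  have w₂ : writhe m₂ (ℓ₁ ++ (P ++ a :: Q.reverse.map (L.turn m) ++ L.turn m a :: S) :: ℓ₂) =
      writhe m (ℓ₁ ++ (P ++ a :: Q ++ c :: S) :: ℓ₂) - ε := by
    have offQ : ∀ e ∈ Q.reverse.map (L.turn m), e.1 ≠ c.1 := by
      intro e he
      obtain ⟨u, hu, rfl⟩ := List.mem_map.1 he
      exact offP u (by simp at hu; simp [hu])
    have oQl : ∀ u ∈ Q.reverse.map (L.turn m), ∀ v, (∀ u ∈ Q, overSign m u v = 0) →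
        overSign m u v = 0 := by
      intro u hu v h
      obtain ⟨u, hu', rfl⟩ := List.mem_map.1 hu
      rw [overSign_turn_left, h u (List.mem_reverse.1 hu'), neg_zero]
    have oQr : ∀ v ∈ Q.reverse.map (L.turn m), ∀ u, (∀ v ∈ Q, overSign m u v = 0) →
        overSign m u v = 0 := by
      intro v hv u h
      obtain ⟨v, hv', rfl⟩ := List.mem_map.1 hv
      rw [overSign_turn_right, h v (List.mem_reverse.1 hv'), neg_zero]
    rw [writhe_append, writhe_append, writhe_cons, writhe_cons, w0,
      h₂.writhe_eq offℓ₁, h₂.writhe_eq offℓ₂, hQS0, hac', hsign]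
    rw [pairSum_crossed]
    · rw [h₂.pairSum_eq fun e he => offP e (by simp [he]),
        h₂.pairSum_eq fun e he => offP e (by simp [he]),
        h₂.pairSum_eq fun e he => offP e (by simp [he]),
        pairSum_reverse_map fun u _ v _ => overSign_turn_left, hQS0,
        h₂.overSign_eq_zero_left hx]
      ring
    · intro u hu v hv
      have hv' : v.1 ≠ c.1 := by
        rcases List.mem_append.1 hv with hv | hv
        · exact offP v (by simp [hv])
        · exact offQ v hv
      rw [h₂.overSign_eq hv']
      rcases List.mem_append.1 hu with hu | hu <;> rcases List.mem_append.1 hv with hv | hv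
      · exact o0' u (by simp [hu]) v (by simp [hv])
      · exact oQr v hv u fun v hv => o0' u (by simp [hu]) v (by simp [hv])
      · exact oQl u hu v fun u hu => o0' u (by simp [hu]) v (by simp [hv])
      · exact oQl u hu v fun u hu => oQr v hv u fun v hv => o0' u (by simp [hu]) v (by simp [hv])
    · intro u hu v hv
      rcases List.mem_append.1 hv with hv | hv
      · rw [h₂.overSign_eq (offP v (by simp [hv]))]
        exact oS u hu v (by simp [hv])
      · rw [h₂.overSign_eq (offQ v hv)]
        exact oQr v hv u fun v hv => oS u hu v (by simp [hv])
    · exact fun e _ => ⟨h₂.overSign_eq_zero_left hx, h₂.overSign_eq_zero_right hx⟩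
    · exact fun e _ => ⟨h₂.overSign_eq_zero_left hx, h₂.overSign_eq_zero_right hx⟩
    · exact h₂.overSign_eq_zero_left hx
    · exact h₂.overSign_eq_zero_left hx
    · exact h₂.overSign_eq_zero_left hx
  have hA3 : (-A ^ 3) ≠ 0 := neg_ne_zero.2 (pow_ne_zero _ hA)
  have hδ' : -(A ^ 2 + (A ^ 2)⁻¹) ≠ 0 := neg_ne_zero.2 hδ
  rw [hb, b₁, b₂]
  unfold descendingValue
  rw [w₁, w₂]
  set w := writhe m (ℓ₁ ++ (P ++ a :: Q ++ c :: S) :: ℓ₂)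
  simp only [List.length_append, List.length_cons]
  -- The detached loop accounts for one more factor `δ`, as in `curl_identity`.
  have e1 : (((ℓ₁.length + (ℓ₂.length + 1 + 1) : ℕ) : ℤ) + (L.circles : ℤ) - 1) =
      (((ℓ₁.length + (ℓ₂.length + 1) : ℕ) : ℤ) + (L.circles : ℤ) - 1) + 1 := by push_cast; ring
  rw [e1, zpow_add_one₀ hδ']
  have e2 : (-A ^ 3) ^ w = (-A ^ 3) ^ (w - ε) * (-A ^ 3) ^ ε := by
    rw [← zpow_add₀ hA3, sub_add_cancel]
  rw [e2, ← curl_identity hA hε]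
  ring

end LinkProjection

theorem IsCrossSwap.symm {X : Type*} {τ τ' : X → X} {a c : X} (h : IsCrossSwap τ τ' a c) :
    IsCrossSwap τ τ' c a :=
  ⟨h.right, h.left, h.right', h.left', fun d h1 h2 h3 h4 => h.off d h2 h1 h4 h3⟩

theorem IsEndSwap.symm {X : Type*} {τ τ' : X → X} {a c : X} (h : IsEndSwap τ τ' a c) :
    IsEndSwap τ τ' c a :=
  ⟨h.right, h.left, h.right', h.left', fun d h1 h2 h3 h4 => h.off d h2 h1 h4 h3⟩

namespace LinkProjection

variable {L : LinkProjection} {K : Type*} [Field K] {m : L.Site → SiteState}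

/-- The inductive step for two crossing components without self-crossings. -/
theorem bracket_of_mixed_crossing {A : K} (hA : A ≠ 0) (hδ : A ^ 2 + (A ^ 2)⁻¹ ≠ 0)
    (hL : L.HasPotentials)
    (ih : ∀ m' ℓ', L.numCrossings m' < L.numCrossings m → IsTraversal L.glue (L.turn m') ℓ' →
      ℓ'.flatten.Pairwise (IsOver m') → L.bracket A m' = descendingValue A m' ℓ')
    {ℓ₁ ℓ₂ : List (List L.Slot)} {P Q S : List L.Slot} {a o : L.Slot}
    (ht : IsTraversal L.glue (L.turn m) (ℓ₁ ++ (Q ++ [o]) :: (P ++ a :: S) :: ℓ₂))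
    (hd : (ℓ₁ ++ (Q ++ [o]) :: (P ++ a :: S) :: ℓ₂).flatten.Pairwise (IsOver m))
    (hoa : ¬ Uncrossed m o a) (hQ : (Q ++ [o]).Pairwise (Uncrossed m))
    (hP : (P ++ a :: S).Pairwise (Uncrossed m)) (hPQ : ∀ u ∈ P, ∀ v ∈ Q, Uncrossed m u v) :
    L.bracket A m = descendingValue A m (ℓ₁ ++ (Q ++ [o]) :: (P ++ a :: S) :: ℓ₂) := by
  obtain ⟨hx, hcr⟩ := exists_site_of_not_uncrossed hoa
  have hfl : (ℓ₁ ++ (Q ++ [o]) :: (P ++ a :: S) :: ℓ₂).flatten =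
      ℓ₁.flatten ++ ((Q ++ [o]) ++ ((P ++ a :: S) ++ ℓ₂.flatten)) := by simp
  have ht' : IsTraversal L.glue (L.turn m) ((Q ++ [o]) :: (P ++ a :: S) :: (ℓ₁ ++ ℓ₂)) :=
    ht.perm ((List.perm_middle (a := Q ++ [o]) (l₁ := ℓ₁) (l₂ := (P ++ a :: S) :: ℓ₂)).trans
        (List.Perm.cons _ List.perm_middle))
  have hcov := ht'.covers
  rw [List.flatten_cons, List.flatten_cons] at hcov
  have hcov' := hcov.perm perm_split
  have hoff := fst_ne_of_covers hx.symm hcov'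
  have hn := hcov'.1
  have hd' := hd
  rw [hfl] at hd'
  have hne : o ≠ a := by
    rintro rfl
    simp at hn
  have hne' : L.turn m o ≠ a := turn_ne_of_isTraversal ht' (by simp) (by simp)
  have hγc : ∀ u ∈ Q ++ [o], ∀ v ∈ P ++ a :: S, IsOver m u v := fun u hu v hv =>
    (List.pairwise_append.1 (List.pairwise_append.1 hd').2.1).2.2 u hu v
      (List.mem_append_left _ hv)
  have hover : IsOver m o a := hγc o (by simp) a (by simp)
  have huo : (m a.1).isUnder o.2 = false := by rw [← hx]; exact hover hx
  have hua : (m a.1).isUnder a.2 = true := by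
    rw [isUnder_eq_not hx hcr hne hne', hover hx]; rfl
  obtain ⟨m₁, m₂, ε, hε, h₁, h₂, hs₁, hs₂, hsign, hb⟩ := exists_smoothings A hx hua huo
  have hcr' : (m a.1).IsCrossing := by rwa [← hx]
  have offP : ∀ e ∈ P ++ Q ++ S, e.1 ≠ a.1 := fun e he => hoff e (by
    simp only [List.mem_append] at he ⊢; tauto)
  have oγ := overSign_eq_zero_of_pairwise hQ
  have oc := overSign_eq_zero_of_pairwise hP
  have oPQ : ∀ u ∈ P, ∀ v ∈ Q, overSign m u v = 0 ∧ overSign m v u = 0 := fun u hu v hv =>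
    ⟨(hPQ u hu v hv).overSign_eq_zero, (hPQ u hu v hv).symm.overSign_eq_zero⟩
  have oSQ : ∀ u ∈ S, ∀ v ∈ Q, overSign m u v = 0 := fun u hu v hv =>
    (hγc v (by simp [hv]) u (by simp [hu])).overSign_eq_zero
  have oSP : ∀ u ∈ S, ∀ v ∈ P, overSign m u v = 0 := fun u hu v hv =>
    oc u (by simp [hu]) v (by simp [hv])
  have o0' : ∀ u ∈ P ++ Q, ∀ v ∈ P ++ Q, overSign m u v = 0 := fun u hu v hv => by
    rcases List.mem_append.1 hu with hu | hu <;> rcases List.mem_append.1 hv with hv | hv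
    · exact oc u (by simp [hu]) v (by simp [hv])
    · exact (oPQ u hu v hv).1
    · exact (oPQ v hv u hu).2
    · exact oγ u (by simp [hu]) v (by simp [hv])
  have oS : ∀ u ∈ S, ∀ v ∈ P ++ Q, overSign m u v = 0 := fun u hu v hv => by
    rcases List.mem_append.1 hv with hv | hv
    · exact oSP u hu v hv
    · exact oSQ u hu v hv
  have zPS : pairSum (overSign m) P S = 0 :=
    pairSum_eq_zero fun u hu v hv => oc u (by simp [hu]) v (by simp [hv])
  have zSS : pairSum (overSign m) S S = 0 :=
    pairSum_eq_zero fun u hu v hv => oc u (by simp [hu]) v (by simp [hv])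
  -- The two components cross algebraically zero times. The crossing of `o` and `a` contributes `ε`
  -- and `P` contributes nothing, so the crossings of `Q` with `S` contribute `-ε`.
  have hQS : pairSum (overSign m) Q S = - ε := by
    have hnn := List.nodup_flatten.1 ht'.covers.1
    have hdis := (List.pairwise_cons.1 hnn.2).1 (P ++ a :: S) (by simp)
    have key := pairSum_formalSign (m := m) hL (ht'.closed (Q ++ [o]) (by simp))
      (ht'.closed (P ++ a :: S) (by simp)) (hnn.1 _ (by simp)) (fun e he => by
        refine ⟨fun h => hdis h he, fun h => ?_⟩
        exact turn_ne_of_isTraversal ht' (u := e) (v := L.turn m e)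
          (List.mem_flatten.2 ⟨_, by simp, he⟩)
          (List.mem_flatten.2 ⟨_, List.mem_cons_self, h⟩) rfl)
    have e : P ++ a :: S = P ++ ([a] ++ S) := by simp
    rw [e] at key
    simp only [pairSum_append_left, pairSum_append_right] at key
    have zx : ∀ B B' : List L.Slot, (∀ u ∈ B, ∀ v ∈ B', u.1 ≠ v.1) →
        pairSum (L.formalSign m) B B' = 0 := fun B B' hB =>
      pairSum_eq_zero fun u hu v hv =>
        Uncrossed.formalSign_eq_zero fun h' => absurd h' (hB u hu v hv)
    rw [pairSum_eq_zero (l₁ := Q) (l₂ := P) fun u hu v hv =>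
        (hPQ v hv u hu).symm.formalSign_eq_zero,
      zx Q [a] (by
        intro u hu v hv
        rw [List.mem_singleton.1 hv]; exact offP u (by simp [hu])),
      zx [o] P (by
        intro u hu v hv
        rw [List.mem_singleton.1 hu, hx]; exact (offP v (by simp [hv])).symm),
      zx [o] S (by
        intro u hu v hv
        rw [List.mem_singleton.1 hu, hx]; exact (offP v (by simp [hv])).symm)] at key
    have h2 : pairSum (overSign m) Q S = pairSum (L.formalSign m) Q S :=
      pairSum_congr fun u hu v hv => by
        refine overSign_eq_formalSign_of_isOver (hγc u (by simp [hu]) v (by simp [hv])) ?_ ?_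
        · rintro rfl
          exact hdis (a := u) (by simp [hu]) (by simp [hv])
        · exact turn_ne_of_isTraversal ht' (by simp [hu]) (by simp [hv])
    have h3 : pairSum (L.formalSign m) [o] [a] = ε := by simp [pairSum, hsign]
    rw [h2]
    linarith
  have offℓ₁ : ∀ e ∈ ℓ₁.flatten, e.1 ≠ a.1 := fun e he => hoff e (by
    rw [List.flatten_append]; simp only [List.mem_append]; tauto)
  have offℓ₂ : ∀ e ∈ ℓ₂.flatten, e.1 ≠ a.1 := fun e he => hoff e (by
    rw [List.flatten_append]; simp only [List.mem_append]; tauto)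
  have b₁ : L.bracket A m₁ = descendingValue A m₁ (ℓ₁ ++ (P ++ a :: Q ++ o :: S) :: ℓ₂) := by
    refine ih m₁ _ (h₁.numCrossings_lt hcr')
      ((ht'.crossed_of_split hs₁.symm).perm List.perm_middle.symm) ?_
    have := List.Pairwise.merge_loop (R' := IsOver m₁) (N := Uncrossed m)
      (x := fun u : L.Slot => u.1 = a.1)
      (fun _ _ => h₁.isOver)
      (fun u v hu => (h₁.uncrossed_left hu).isOver) (fun u v hv => (h₁.uncrossed_right hv).isOver)
      rfl hx hd' hPQ (fun u v huv => (h₁.uncrossed huv).isOver)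
    simpa using this
  have b₂ : L.bracket A m₂ = descendingValue A m₂
      (ℓ₁ ++ (P ++ a :: Q.reverse.map (L.turn m) ++ L.turn m o :: S) :: ℓ₂) := by
    refine ih m₂ _ (h₂.numCrossings_lt hcr')
      ((ht'.flipped_of_split L.glue_glue (L.turn_turn m) hs₂.symm).perm List.perm_middle.symm) ?_
    have := List.Pairwise.merge_flip_loop (R' := IsOver m₂) (N := Uncrossed m)
        (x := fun u : L.Slot => u.1 = a.1)
        (τ := L.turn m) (a := a) (d := L.turn m o) (fun _ _ => h₂.isOver)
        (fun u v huv => h₂.isOver huv.turn_left) (fun u v huv => h₂.isOver huv.turn_right)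
        (fun u v huv => (h₂.uncrossed huv.symm.turn_left.turn_right).isOver)
        (fun u v huv => (h₂.uncrossed huv).isOver.turn_right)
        (fun u v hu => (h₂.uncrossed_left hu).isOver) (fun u v hv => (h₂.uncrossed_right hv).isOver)
        rfl hx hd' hPQ (List.pairwise_append.1 hQ).1
    simpa using this
  have w0 : writhe m (ℓ₁ ++ (Q ++ [o]) :: (P ++ a :: S) :: ℓ₂) = writhe m ℓ₁ + writhe m ℓ₂ := by
    rw [writhe_append, writhe_cons, writhe_cons, pairSum_eq_zero oγ, pairSum_eq_zero oc]
    ring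
  -- After merging, the crossings of `Q` with `S` have become self-crossings.
  have w₁ : writhe m₁ (ℓ₁ ++ (P ++ a :: Q ++ o :: S) :: ℓ₂) =
      writhe m (ℓ₁ ++ (Q ++ [o]) :: (P ++ a :: S) :: ℓ₂) - ε := by
    rw [w0, writhe_append, writhe_cons, h₁.writhe_eq offℓ₁, h₁.writhe_eq offℓ₂]
    rw [pairSum_crossed]
    · rw [h₁.pairSum_eq fun e he => offP e (by simp [he]),
        h₁.pairSum_eq fun e he => offP e (by simp [he]),
        h₁.pairSum_eq fun e he => offP e (by simp [he]), zPS, zSS, hQS,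
        h₁.overSign_eq_zero_left rfl]
      ring
    · intro u hu v hv
      rw [h₁.overSign_eq (offP v (by simp only [List.mem_append] at hv ⊢; tauto))]
      exact o0' u hu v hv
    · intro u hu v hv
      rw [h₁.overSign_eq (offP v (by simp only [List.mem_append] at hv ⊢; tauto))]
      exact oS u hu v hv
    · exact fun e _ => ⟨h₁.overSign_eq_zero_left rfl, h₁.overSign_eq_zero_right rfl⟩
    · exact fun e _ => ⟨h₁.overSign_eq_zero_left hx, h₁.overSign_eq_zero_right hx⟩
    · exact h₁.overSign_eq_zero_left rfl
    · exact h₁.overSign_eq_zero_left hx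
    · exact h₁.overSign_eq_zero_left hx
  -- As before, but `Q` is reversed, so its crossings with `S` now contribute `+ε`.
  have w₂ : writhe m₂ (ℓ₁ ++ (P ++ a :: Q.reverse.map (L.turn m) ++ L.turn m o :: S) :: ℓ₂) =
      writhe m (ℓ₁ ++ (Q ++ [o]) :: (P ++ a :: S) :: ℓ₂) + ε := by
    have offQ : ∀ e ∈ Q.reverse.map (L.turn m), e.1 ≠ a.1 := by
      intro e he
      obtain ⟨u, hu, rfl⟩ := List.mem_map.1 he
      exact offP u (by simp at hu; simp [hu])
    have oQl : ∀ u ∈ Q.reverse.map (L.turn m), ∀ v, (∀ u ∈ Q, overSign m u v = 0) →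
        overSign m u v = 0 := by
      intro u hu v h
      obtain ⟨u, hu', rfl⟩ := List.mem_map.1 hu
      rw [overSign_turn_left, h u (List.mem_reverse.1 hu'), neg_zero]
    have oQr : ∀ v ∈ Q.reverse.map (L.turn m), ∀ u, (∀ v ∈ Q, overSign m u v = 0) →
        overSign m u v = 0 := by
      intro v hv u h
      obtain ⟨v, hv', rfl⟩ := List.mem_map.1 hv
      rw [overSign_turn_right, h v (List.mem_reverse.1 hv'), neg_zero]
    rw [w0, writhe_append, writhe_cons, h₂.writhe_eq offℓ₁, h₂.writhe_eq offℓ₂]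
    rw [pairSum_crossed]
    · rw [h₂.pairSum_eq fun e he => offP e (by simp [he]),
        h₂.pairSum_eq fun e he => offP e (by simp [he]),
        h₂.pairSum_eq fun e he => offP e (by simp [he]),
        pairSum_reverse_map fun u _ v _ => overSign_turn_left, hQS, zPS, zSS,
        h₂.overSign_eq_zero_left rfl]
      ring
    · intro u hu v hv
      have hv' : v.1 ≠ a.1 := by
        rcases List.mem_append.1 hv with hv | hv
        · exact offP v (by simp [hv])
        · exact offQ v hv
      rw [h₂.overSign_eq hv']
      rcases List.mem_append.1 hu with hu | hu <;> rcases List.mem_append.1 hv with hv | hv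
      · exact o0' u (by simp [hu]) v (by simp [hv])
      · exact oQr v hv u fun v hv => o0' u (by simp [hu]) v (by simp [hv])
      · exact oQl u hu v fun u hu => o0' u (by simp [hu]) v (by simp [hv])
      · exact oQl u hu v fun u hu => oQr v hv u fun v hv => o0' u (by simp [hu]) v (by simp [hv])
    · intro u hu v hv
      rcases List.mem_append.1 hv with hv | hv
      · rw [h₂.overSign_eq (offP v (by simp [hv]))]
        exact oS u hu v (by simp [hv])
      · rw [h₂.overSign_eq (offQ v hv)]
        exact oQr v hv u fun v hv => oS u hu v (by simp [hv])
    · exact fun e _ => ⟨h₂.overSign_eq_zero_left rfl, h₂.overSign_eq_zero_right rfl⟩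
    · exact fun e _ => ⟨h₂.overSign_eq_zero_left hx, h₂.overSign_eq_zero_right hx⟩
    · exact h₂.overSign_eq_zero_left rfl
    · exact h₂.overSign_eq_zero_left hx
    · exact h₂.overSign_eq_zero_left hx
  have hA3 : (-A ^ 3) ≠ 0 := neg_ne_zero.2 (pow_ne_zero _ hA)
  have hδ' : -(A ^ 2 + (A ^ 2)⁻¹) ≠ 0 := neg_ne_zero.2 hδ
  rw [hb, b₁, b₂]
  unfold descendingValue
  rw [w₁, w₂]
  set w := writhe m (ℓ₁ ++ (Q ++ [o]) :: (P ++ a :: S) :: ℓ₂)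
  simp only [List.length_append, List.length_cons]
  have e1 : (((ℓ₁.length + (ℓ₂.length + 1 + 1) : ℕ) : ℤ) + (L.circles : ℤ) - 1) =
      (((ℓ₁.length + (ℓ₂.length + 1) : ℕ) : ℤ) + (L.circles : ℤ) - 1) + 1 := by push_cast; ring
  rw [e1, zpow_add_one₀ hδ', sub_eq_add_neg, zpow_add₀ hA3, zpow_add₀ hA3]
  rw [← loop_identity hA hε]
  ring

end LinkProjection

/-! ### The induction for descending diagrams -/

namespace LinkProjection

variable {L : LinkProjection} {K : Type*} [Field K] {m : L.Site → SiteState}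

theorem writhe_eq_zero {ℓ : List (List L.Slot)} (h : ∀ l ∈ ℓ, l.Pairwise (Uncrossed m)) :
    writhe m ℓ = 0 := by
  unfold writhe
  apply List.sum_eq_zero
  intro z hz
  obtain ⟨l, hl, rfl⟩ := List.mem_map.1 hz
  exact pairSum_eq_zero (overSign_eq_zero_of_pairwise (h l hl))

theorem exists_mem_of_site {ℓ : List (List L.Slot)} (ht : IsTraversal L.glue (L.turn m) ℓ)
    (d : L.Slot) : ∃ u ∈ ℓ.flatten, u = d ∨ u = L.turn m d := by
  rcases ht.mem_flatten d with h | h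
  · exact ⟨_, h, Or.inl rfl⟩
  · exact ⟨_, h, Or.inr rfl⟩

theorem not_isCrossing_of_pairwise_uncrossed {ℓ : List (List L.Slot)}
    (ht : IsTraversal L.glue (L.turn m) ℓ) (h : ℓ.flatten.Pairwise (Uncrossed m)) (x : L.Site) :
    ¬ (m x).IsCrossing := by
  intro hx
  obtain ⟨u, hu, hu'⟩ := exists_mem_of_site ht (x, 0)
  obtain ⟨v, hv, hv'⟩ := exists_mem_of_site ht (x, 1)
  have key : ∀ s : SiteState, s.IsCrossing → (0 : Fin 4) ≠ 1 ∧ s.pairing 0 ≠ 1 ∧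
      0 ≠ s.pairing 1 ∧ s.pairing 0 ≠ s.pairing 1 := by
    intro s hs
    cases s
    · decide
    · decide
    · exact hs.elim
    · exact hs.elim
  obtain ⟨k1, k2, k3, k4⟩ := key _ hx
  have huv : u ≠ v := by
    rcases hu' with rfl | rfl <;> rcases hv' with rfl | rfl <;> intro h <;>
      simp [turn] at h <;> tauto
  have h1 : u.1 = x := by rcases hu' with rfl | rfl <;> rfl
  have h2 : v.1 = x := by rcases hv' with rfl | rfl <;> rfl
  have : Std.Symm (Uncrossed m) := ⟨fun _ _ h => h.symm⟩
  exact h.forall hu hv huv (h1.trans h2.symm) (by rwa [h1])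

/-- The bracket of a diagram which is descending for some traversal of its components. -/
theorem bracket_eq_descendingValue {A : K} (hA : A ≠ 0) (hδ : A ^ 2 + (A ^ 2)⁻¹ ≠ 0)
    (hL : L.HasPotentials) (m : L.Site → SiteState) (ℓ : List (List L.Slot))
    (ht : IsTraversal L.glue (L.turn m) ℓ) (hd : ℓ.flatten.Pairwise (IsOver m)) :
    L.bracket A m = descendingValue A m ℓ := by
  induction hn : L.numCrossings m using Nat.strong_induction_on generalizing m ℓ with
  | _ n ih =>
  subst hn
  have ih' : ∀ m' ℓ', L.numCrossings m' < L.numCrossings m →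
      IsTraversal L.glue (L.turn m') ℓ' → ℓ'.flatten.Pairwise (IsOver m') →
      L.bracket A m' = descendingValue A m' ℓ' := fun m' ℓ' hlt h1 h2 => ih _ hlt m' ℓ' h1 h2 rfl
  by_cases hself : ∀ l ∈ ℓ, l.Pairwise (Uncrossed m)
  · have : Std.Symm (Uncrossed m) := ⟨fun _ _ h => h.symm⟩
    by_cases hmix : ℓ.Pairwise fun l l' => ∀ u ∈ l, ∀ v ∈ l', Uncrossed m u v
    · have hall : ℓ.flatten.Pairwise (Uncrossed m) := List.pairwise_flatten.2 ⟨hself, hmix⟩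
      rw [L.bracket_of_forall_not_isCrossing A (not_isCrossing_of_pairwise_uncrossed ht hall),
        descendingValue, writhe_eq_zero hself, numComponents_eq ht]
      simp
    -- `c` is the first component crossed by an earlier one, say `γ`. On `c` the first slot `a`
    -- which meets `γ` is taken, at a strand `o` of `γ`. Then `γ` is based so that `o` is its last
    -- entry, and moved next to `c`; it does not cross the components in between.
    · obtain ⟨L₁, γ, L₂, c, L₃, rfl, h1, h2⟩ := List.exists_first_pair hmix
      have h1' : ∃ v ∈ c, ∃ u ∈ γ, ¬ Uncrossed m u v := by
        by_contra hcon
        push Not at hcon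
        exact h1 fun u hu v hv => hcon v hv u hu
      obtain ⟨P, a, S, rfl, ⟨o, ho, hoa⟩, hP⟩ := List.exists_first h1'
      obtain ⟨G₁, G₂, rfl⟩ := List.append_of_mem ho
      have hperm : (G₁ ++ o :: G₂).Perm (G₂ ++ G₁ ++ [o]) := by
        classical
        rw [List.perm_iff_count]
        intro x
        simp only [List.count_append, List.count_cons, List.count_nil]
        omega
      have hγ := hself (G₁ ++ o :: G₂) (by simp)
      have hγ' : (G₂ ++ G₁ ++ [o]).Pairwise (Uncrossed m) :=
        (hperm.pairwise_iff fun h => Uncrossed.symm h).1 hγ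
      have hc := hself (P ++ a :: S) (by simp)
      have ht₁ : IsTraversal L.glue (L.turn m)
          ((G₁ ++ o :: G₂) :: (L₁ ++ L₂ ++ (P ++ a :: S) :: L₃)) := by
        refine ht.perm ?_
        classical
        rw [List.perm_iff_count]
        intro x
        simp only [List.count_append, List.count_cons]
        omega
      have ht₂ : IsTraversal L.glue (L.turn m)
          ((G₂ ++ G₁ ++ [o]) :: (L₁ ++ L₂ ++ (P ++ a :: S) :: L₃)) := by
        cases G₂ with
        | nil => simpa using ht₁
        | cons b G₂ =>
          have := IsTraversal.rotate (P := G₁ ++ [o]) (a := b) (S := G₂) (by simpa using ht₁)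
          simpa using this
      have ht₃ : IsTraversal L.glue (L.turn m)
          ((L₁ ++ L₂) ++ (G₂ ++ G₁ ++ [o]) :: (P ++ a :: S) :: L₃) :=
        ht₂.perm List.perm_middle.symm
      have hself' : ∀ l ∈ (L₁ ++ L₂) ++ (G₂ ++ G₁ ++ [o]) :: (P ++ a :: S) :: L₃,
          l.Pairwise (Uncrossed m) := by
        intro l hl
        simp only [List.mem_append, List.mem_cons] at hl
        rcases hl with (hl | hl) | rfl | rfl | hl
        · exact hself l (by simp [hl])
        · exact hself l (by simp [hl])
        · exact hγ'
        · exact hc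
        · exact hself l (by simp [hl])
      -- Without self-crossings the writhe vanishes, and only the number of components matters.
      have hval : descendingValue A m (L₁ ++ (G₁ ++ o :: G₂) :: L₂ ++ (P ++ a :: S) :: L₃) =
          descendingValue A m ((L₁ ++ L₂) ++ (G₂ ++ G₁ ++ [o]) :: (P ++ a :: S) :: L₃) := by
        rw [descendingValue, descendingValue, writhe_eq_zero hself, writhe_eq_zero hself']
        congr 3
        simp only [List.length_append, List.length_cons]
        omega
      -- Changing the base point of `γ` is allowed because it has no self-crossings, and moving it
      -- past `L₂` because they do not cross.
      have hd₃ : ((L₁ ++ L₂) ++ (G₂ ++ G₁ ++ [o]) :: (P ++ a :: S) :: L₃).flatten.Pairwise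
          (IsOver m) := by
        have hL₂ : ∀ u ∈ L₂.flatten, ∀ v ∈ G₂ ++ G₁ ++ [o], IsOver m u v := by
          intro u hu v hv
          obtain ⟨l, hl, hu⟩ := List.mem_flatten.1 hu
          exact ((List.pairwise_cons.1 (List.pairwise_append.1 h2).2.1).1 l hl v
            (hperm.mem_iff.2 hv) u hu).symm.isOver
        have hγ'' := hγ'.imp fun h => Uncrossed.isOver h
        have hmem : ∀ v, v ∈ G₂ ++ G₁ ++ [o] ↔ v ∈ G₁ ++ o :: G₂ := fun v => hperm.mem_iff.symm
        clear hγ' hγ hperm hval hself' ht₃ ht₂ ht₁ hoa ho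
        generalize G₂ ++ G₁ ++ [o] = γ' at *
        generalize G₁ ++ o :: G₂ = γ at *
        generalize P ++ a :: S = c at *
        simp only [List.flatten_append, List.flatten_cons] at hd ⊢
        generalize L₁.flatten = F₁ at *
        generalize L₂.flatten = F₂ at *
        generalize L₃.flatten = F₃ at *
        clear h1' h1 h2 hself hc hP
        simp only [List.pairwise_append, List.mem_append] at hd ⊢
        grind
      rw [hval]
      refine bracket_of_mixed_crossing hA hδ hL ih' ht₃ hd₃ hoa hγ' hc ?_
      intro u hu v hv
      have := hP u hu
      push Not at this
      exact (this v (hperm.mem_iff.2 (by simp only [List.mem_append] at hv ⊢; tauto))).symm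
  · push Not at hself
    obtain ⟨l, hl, hl'⟩ := hself
    obtain ⟨ℓ₁, ℓ₂, rfl⟩ := List.append_of_mem hl
    obtain ⟨P, a, Q, c, S, rfl, hac, hPQ⟩ := List.exists_first_pair hl'
    exact bracket_of_self_crossing hA hδ hL ih' ht hd hac hPQ

end LinkProjection

/-! ### The Dubrovnik polynomial as a bracket -/

namespace LinkProjection

variable {L : LinkProjection} {K : Type*} [Field K] {m : L.Site → SiteState}

/-- Switching a crossing exchanges its two smoothings, so the difference of the two bracket
expansions is the Dubrovnik skein relation. -/
theorem bracket_sub_bracket_switch {A : K} (x : L.Site)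
    (hx : (m x).IsCrossing) :
    L.bracket A m = L.bracket A (L.modify m x SiteState.switch) +
      (A - A⁻¹) * (L.bracket A (L.modify m x SiteState.smoothA) -
        L.bracket A (L.modify m x SiteState.smoothB)) := by
  have hx' : (L.modify m x SiteState.switch x).IsCrossing := by
    simpa [modify, SiteState.isCrossing_switch] using hx
  have key : ∀ s : SiteState, s.IsCrossing →
      s.switch.smoothA = s.smoothB ∧ s.switch.smoothB = s.smoothA := by
    intro s hs
    cases s
    · decide
    · decide
    · exact hs.elim
    · exact hs.elim
  have e : ∀ f : SiteState → SiteState, L.modify (L.modify m x SiteState.switch) x f =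
      Function.update m x (f (m x).switch) := by
    intro f
    simp [modify]
  rw [L.bracket_eq A hx, L.bracket_eq A hx', e, e, (key _ hx).1, (key _ hx).2]
  unfold modify
  ring

/-- If `u` were under `v` at a crossing, this crossing would be ascending. `IsAscending` looks only
at the slots `0` and `1`; the other slots are reduced to these because passing times do not
distinguish the two ends of a strand piece. -/
theorem PassedBefore.isOver (h : ∀ x, ¬ L.IsAscending m x) {u v : L.Slot}
    (huv : L.PassedBefore (L.turn m) u v) : IsOver m u v := by
  intro hx
  by_contra hu
  rw [Bool.not_eq_false] at hu
  obtain ⟨x, i⟩ := u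
  obtain ⟨y, j⟩ := v
  change x = y at hx
  subst hx
  change (m x).isUnder i = true at hu
  have hne : (x, j) ≠ (x, i) := by
    intro he
    rw [he] at huv
    exact huv.asymm L huv
  have hne' : (x, j) ≠ L.turn m (x, i) := by
    intro he
    rw [he, passedBefore_turn_right] at huv
    exact huv.asymm L huv
  have h1 : j ≠ i := fun h => hne (by rw [h])
  have h2 : j ≠ (m x).pairing i := fun h => hne' (by rw [h]; rfl)
  have k4 : ∀ i j : Fin 4, j ≠ i → j ≠ i + 2 → (i = 0 ∨ i = 2) → j = 1 ∨ j = 3 := by decide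
  have k4' : ∀ i j : Fin 4, j ≠ i → j ≠ i + 2 → (i = 1 ∨ i = 3) → j = 0 ∨ j = 2 := by decide
  apply h x
  unfold IsAscending
  have tl := fun d e => passedBefore_turn_left (m := m) (d := d) (e := e)
  have tr := fun d e => passedBefore_turn_right (m := m) (d := d) (e := e)
  cases hm : m x <;> rw [hm] at hu h2
  · have hi : i = 0 ∨ i = 2 := by simpa [SiteState.isUnder] using hu
    have hj : j = 1 ∨ j = 3 := k4 i j h1 h2 hi
    have h0 : L.turn m (x, 0) = (x, 2) := by simp [turn, hm, SiteState.pairing]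
    have e1 : L.turn m (x, 1) = (x, 3) := by simp [turn, hm, SiteState.pairing]
    rcases hi with rfl | rfl <;> rcases hj with rfl | rfl
    · exact huv
    · rwa [← e1, tr] at huv
    · rwa [← h0, tl] at huv
    · rwa [← h0, ← e1, tl, tr] at huv
  · have hi : i = 1 ∨ i = 3 := by simpa [SiteState.isUnder] using hu
    have hj : j = 0 ∨ j = 2 := k4' i j h1 h2 hi
    have h0 : L.turn m (x, 0) = (x, 2) := by simp [turn, hm, SiteState.pairing]
    have e1 : L.turn m (x, 1) = (x, 3) := by simp [turn, hm, SiteState.pairing]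
    rcases hi with rfl | rfl <;> rcases hj with rfl | rfl
    · exact huv
    · rwa [← h0, tr] at huv
    · rwa [← e1, tl] at huv
    · rwa [← h0, ← e1, tl, tr] at huv
  · simp [SiteState.isUnder] at hu
  · simp [SiteState.isUnder] at hu

open Classical in
theorem pairSum_eq_sum {X : Type*} [Fintype X] {f : X → X → ℤ} {l : List X}
    (hl : l.Nodup) : pairSum f l l = ∑ u, ∑ v, if u ∈ l ∧ v ∈ l then f u v else 0 := by
  have key : ∀ g : X → ℤ, (l.map g).sum = ∑ u, if u ∈ l then g u else 0 := by
    intro g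
    rw [← List.sum_toFinset g hl, ← Finset.sum_filter]
    congr 1
    ext u
    simp
  unfold pairSum
  rw [key]
  refine Finset.sum_congr rfl fun u _ => ?_
  by_cases hu : u ∈ l
  · simp only [hu, true_and, if_true, key]
  · simp [hu]

theorem sum_map_eq_sum_getElem {X : Type*} (ℓ : List X) (f : X → ℤ) :
    (ℓ.map f).sum = ∑ i : Fin ℓ.length, f ℓ[i] :=
  (Fin.sum_univ_fun_getElem ℓ f).symm

open Classical in
theorem writhe_eq_sum {ℓ : List (List L.Slot)} (ht : IsTraversal L.glue (L.turn m) ℓ) :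
    writhe m ℓ = ∑ u : L.Slot, ∑ v : L.Slot, if u ∈ ℓ.flatten ∧ v ∈ ℓ.flatten ∧
      L.component (L.turn m) u = L.component (L.turn m) v then overSign m u v else 0 := by
  have hn := List.nodup_flatten.1 ht.covers.1
  have h1 : writhe m ℓ = ∑ i : Fin ℓ.length, ∑ u : L.Slot, ∑ v : L.Slot,
      if u ∈ ℓ[i] ∧ v ∈ ℓ[i] then overSign m u v else 0 := by
    rw [writhe, sum_map_eq_sum_getElem]
    refine Finset.sum_congr rfl fun i _ => (pairSum_eq_sum (hn.1 _ (List.getElem_mem i.2))).trans ?_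
    refine Finset.sum_congr rfl fun u _ => Finset.sum_congr rfl fun v _ => ?_
    by_cases h : u ∈ ℓ[i] ∧ v ∈ ℓ[i]
    · exact (if_pos h).trans (if_pos h).symm
    · exact (if_neg h).trans (if_neg h).symm
  rw [h1, Finset.sum_comm]
  refine Finset.sum_congr rfl fun u _ => ?_
  rw [Finset.sum_comm]
  refine Finset.sum_congr rfl fun v _ => ?_
  split_ifs with h
  · obtain ⟨hu, hv, huv⟩ := h
    obtain ⟨l, hl, hul⟩ := List.mem_flatten.1 hu
    have hvl := (component_eq_iff_of_mem ht hl hul hv).1 huv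
    obtain ⟨i, hi, rfl⟩ := List.getElem_of_mem hl
    rw [Finset.sum_eq_single ⟨i, hi⟩]
    · exact if_pos ⟨hul, hvl⟩
    · intro j _ hj
      exact if_neg fun h => hj (ht.eq_of_mem h.1 hul)
    · simp
  · refine Finset.sum_eq_zero fun i _ => if_neg fun h' => h ?_
    have hm := List.getElem_mem i.2
    have hv := List.mem_flatten.2 ⟨_, hm, h'.2⟩
    exact ⟨List.mem_flatten.2 ⟨_, hm, h'.1⟩, hv,
      (component_eq_iff_of_mem ht hm h'.1 hv).2 h'.2⟩

/-- Of the two slots of each strand at a crossing exactly one is an entry. Hence exactly one pair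
consisting of an over-entry and an under-entry occurs, and its sign is read off from whether the
slots `0` and `1` are both entries or both exits. -/
theorem writhe_baseTraversal : writhe m (L.baseTraversal m) = L.selfWrithe m := by
  classical
  rw [writhe_eq_sum (L.isTraversal_baseTraversal m), selfWrithe, Fintype.sum_prod_type]
  refine Finset.sum_congr rfl fun x _ => ?_
  have h1 : ∀ i : Fin 4, (∑ v : L.Slot, if (x, i) ∈ (L.baseTraversal m).flatten ∧
      v ∈ (L.baseTraversal m).flatten ∧ L.component (L.turn m) (x, i) = L.component (L.turn m) v
      then overSign m (x, i) v else 0) = ∑ j : Fin 4, if (x, i) ∈ (L.baseTraversal m).flatten ∧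
      (x, j) ∈ (L.baseTraversal m).flatten ∧
      L.component (L.turn m) (x, i) = L.component (L.turn m) (x, j)
      then overSign m (x, i) (x, j) else 0 := by
    intro i
    rw [Fintype.sum_prod_type, Finset.sum_eq_single x]
    · intro y _ hy
      refine Finset.sum_eq_zero fun j _ => ?_
      rw [overSign_eq_zero_of_ne (by exact hy.symm), ite_self]
    · simp
  simp only [h1]
  unfold selfSign
  have hc := (L.isTraversal_baseTraversal m).covers.2
  have c0 := component_turn L (L.turn m) (x, 0)
  have c1 := component_turn L (L.turn m) (x, 1)
  have m0 := hc (x, 0)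
  have m1 := hc (x, 1)
  have hsymm : (L.component (L.turn m) (x, 1) = L.component (L.turn m) (x, 0)) =
      (L.component (L.turn m) (x, 0) = L.component (L.turn m) (x, 1)) := propext eq_comm
  simp only [isEntry_iff]
  simp only [Fin.sum_univ_four, overSign, formalSign, if_true]
  cases hm : m x
  · have h0 : L.turn m (x, 0) = (x, 2) := by simp [turn, hm, SiteState.pairing]
    have h1 : L.turn m (x, 1) = (x, 3) := by simp [turn, hm, SiteState.pairing]
    rw [h0] at m0 c0
    rw [h1] at m1 c1
    simp only [c0, c1, m0, m1, hsymm, SiteState.isUnder, SiteState.crossSign]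
    by_cases hcc : L.component (L.turn m) (x, 0) = L.component (L.turn m) (x, 1) <;>
    by_cases k0 : (x, 2) ∈ (L.baseTraversal m).flatten <;>
    by_cases k1 : (x, 3) ∈ (L.baseTraversal m).flatten <;>
    simp [hcc, k0, k1] <;> decide
  · have h0 : L.turn m (x, 0) = (x, 2) := by simp [turn, hm, SiteState.pairing]
    have h1 : L.turn m (x, 1) = (x, 3) := by simp [turn, hm, SiteState.pairing]
    rw [h0] at m0 c0
    rw [h1] at m1 c1
    simp only [c0, c1, m0, m1, hsymm, SiteState.isUnder, SiteState.crossSign]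
    by_cases hcc : L.component (L.turn m) (x, 0) = L.component (L.turn m) (x, 1) <;>
    by_cases k0 : (x, 2) ∈ (L.baseTraversal m).flatten <;>
    by_cases k1 : (x, 3) ∈ (L.baseTraversal m).flatten <;>
    simp [hcc, k0, k1]
  · simp [SiteState.isUnder]
  · simp [SiteState.isUnder]

/-- The circle values of the two polynomials agree at the specialization; `A ^ 4 ≠ 1` makes `z = A -
A⁻¹` invertible. -/
theorem loopValue_eq {A : K} (hA : A ≠ 0) (hA1 : A ^ 4 ≠ 1) :
    (-A ^ 3 - (-A ^ 3)⁻¹) / (A - A⁻¹) + 1 = -(A ^ 2 + (A ^ 2)⁻¹) := by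
  have h2 : A ^ 2 - 1 ≠ 0 := fun h => hA1 (by linear_combination (A ^ 2 + 1) * h)
  have hz : A - A⁻¹ ≠ 0 := by
    intro h
    apply h2
    field_simp at h
    simpa using h
  rw [div_add_one hz, div_eq_iff hz]
  field_simp
  ring

theorem loopValue_ne_zero {A : K} (hA : A ≠ 0) (hA2 : A ^ 4 ≠ -1) : A ^ 2 + (A ^ 2)⁻¹ ≠ 0 := by
  intro h
  apply hA2
  field_simp at h
  linear_combination h

/-- At `a = -A³` and `z = A - A⁻¹`, the Dubrovnik polynomial is the Kauffman bracket. -/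
theorem dubrovnik_eq_bracket {A : K} (hA : A ≠ 0) (hA1 : A ^ 4 ≠ 1) (hA2 : A ^ 4 ≠ -1)
    (hL : L.HasPotentials) (m : L.Site → SiteState) :
    L.dubrovnik (-A ^ 3) (A - A⁻¹) m = L.bracket A m := by
  induction m using dubrovnik.induct with
  | case1 m h ih1 ih2 ih3 =>
    rw [dubrovnik, dif_pos h, ih1, ih2, ih3]
    exact (bracket_sub_bracket_switch _ (L.isCrossing_of_isAscending h.choose_spec)).symm
  | case2 m h =>
    push Not at h
    rw [dubrovnik, dif_neg (by push Not; exact h), loopValue_eq hA hA1,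
      bracket_eq_descendingValue hA (loopValue_ne_zero hA hA2) hL m _
        (L.isTraversal_baseTraversal m)
        ((L.pairwise_baseTraversal m).imp fun h' => h'.isOver h),
      descendingValue, writhe_baseTraversal, numComponents_eq (L.isTraversal_baseTraversal m)]
    push_cast
    rfl

end LinkProjection

/-! ### The number of components after a change of a smoothing -/

namespace LinkProjection

variable {L : LinkProjection} {m m' : L.Site → SiteState}

/-- Two different smoothings of a site exchange the slots. -/
theorem swap_of_smoothing {x : L.Site} (hoff : ∀ y, y ≠ x → m' y = m y)
    (h : ¬ (m x).IsCrossing) (h' : ¬ (m' x).IsCrossing) (hne : m' x ≠ m x) {i j : Fin 4}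
    (hij : j ≠ i) (hij' : j ≠ (m x).pairing i) :
    (j = i + 2 ∧ IsCrossSwap (L.turn m) (L.turn m') (x, i) (x, j)) ∨
      (j ≠ i + 2 ∧ IsEndSwap (L.turn m) (L.turn m') (x, i) (x, j)) := by
  -- Entries at opposite slots belong to arcs for which the other smoothing respects the
  -- orientation; for entries at neighbouring slots it joins these two entries.
  have key : ∀ s s' : SiteState, ¬ s.IsCrossing → ¬ s'.IsCrossing → s' ≠ s → ∀ i j : Fin 4,
      j ≠ i → j ≠ s.pairing i →
      (∀ k, k = i ∨ k = j ∨ k = s.pairing i ∨ k = s.pairing j) ∧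
      ((j = i + 2 ∧ s'.pairing i = s.pairing j ∧ s'.pairing j = s.pairing i ∧
        s'.pairing (s.pairing i) = j ∧ s'.pairing (s.pairing j) = i) ∨
      (j ≠ i + 2 ∧ s'.pairing i = j ∧ s'.pairing j = i ∧
        s'.pairing (s.pairing i) = s.pairing j ∧ s'.pairing (s.pairing j) = s.pairing i)) := by
    intro s s' hs hs' hne
    cases s <;> cases s' <;> first
      | exact absurd trivial hs
      | exact absurd trivial hs'
      | exact absurd rfl hne
      | decide
  obtain ⟨hall, hcase⟩ := key _ _ h h' hne i j hij hij'
  have off : ∀ d : L.Slot, d ≠ (x, i) → d ≠ (x, j) → d ≠ L.turn m (x, i) → d ≠ L.turn m (x, j) →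
      L.turn m' d = L.turn m d := by
    rintro ⟨y, k⟩ d1 d2 d3 d4
    have hy : y ≠ x := by
      rintro rfl
      rcases hall k with h | h | h | h <;> subst h <;> simp [turn] at d1 d2 d3 d4
    simp [turn, hoff y hy]
  rcases hcase with ⟨h0, h1, h2, h3, h4⟩ | ⟨h0, h1, h2, h3, h4⟩
  · refine Or.inl ⟨h0, ⟨?_, ?_, ?_, ?_, off⟩⟩ <;> simp [turn, h1, h2, h3, h4]
  · refine Or.inr ⟨h0, ⟨?_, ?_, ?_, ?_, off⟩⟩ <;> simp [turn, h1, h2, h3, h4]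

theorem exists_entry (m : L.Site → SiteState) (x : L.Site) (i : Fin 4) :
    ∃ j, (j = i ∨ j = (m x).pairing i) ∧ (x, j) ∈ (L.baseTraversal m).flatten ∧
      L.component (L.turn m) (x, j) = L.component (L.turn m) (x, i) := by
  rcases (L.isTraversal_baseTraversal m).mem_flatten (x, i) with h | h
  · exact ⟨i, Or.inl rfl, h, rfl⟩
  · exact ⟨_, Or.inr rfl, h, component_turn L (L.turn m) (x, i)⟩

/-- The other smoothing of a site at which two components meet has one component less. -/
theorem numComponents_of_component_ne {x : L.Site} (hoff : ∀ y, y ≠ x → m' y = m y)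
    (h : ¬ (m x).IsCrossing) (h' : ¬ (m' x).IsCrossing) (hne : m' x ≠ m x)
    (hc : L.component (L.turn m) (x, 0) ≠ L.component (L.turn m) (x, 2)) :
    L.numComponents m' + 1 = L.numComponents m := by
  have ht := L.isTraversal_baseTraversal m
  obtain ⟨i, -, hi, ci⟩ := exists_entry m x 0
  obtain ⟨j, -, hj, cj⟩ := exists_entry m x 2
  have hcij : L.component (L.turn m) (x, i) ≠ L.component (L.turn m) (x, j) := by
    rw [ci, cj]; exact hc
  have hij : j ≠ i := by rintro rfl; exact hcij rfl
  have hij' : j ≠ (m x).pairing i := by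
    rintro rfl; exact hcij (component_turn L (L.turn m) (x, i)).symm
  have hswap := swap_of_smoothing hoff h h' hne hij hij'
  obtain ⟨l₁, hl₁, hi₁⟩ := List.mem_flatten.1 hi
  obtain ⟨ℓ, hℓ⟩ : ∃ ℓ, (L.baseTraversal m).Perm (l₁ :: ℓ) := by
    obtain ⟨A, B, h⟩ := List.append_of_mem hl₁
    exact ⟨A ++ B, by rw [h]; exact List.perm_middle⟩
  have ht₁ := ht.perm hℓ
  have hj₁ : (x, j) ∉ l₁ := fun hj' => hcij ((component_eq_iff_of_mem ht hl₁ hi₁ hj).2 hj')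
  have hj₂ : (x, j) ∈ ℓ.flatten := by
    have := hℓ.flatten.mem_iff.1 hj
    rw [List.flatten_cons, List.mem_append] at this
    exact this.resolve_left hj₁
  obtain ⟨l₂, hl₂, hj₂⟩ := List.mem_flatten.1 hj₂
  obtain ⟨ℓ', hℓ'⟩ : ∃ ℓ', ℓ.Perm (l₂ :: ℓ') := by
    obtain ⟨A, B, h⟩ := List.append_of_mem hl₂
    exact ⟨A ++ B, by rw [h]; exact List.perm_middle⟩
  have ht₂ : IsTraversal L.glue (L.turn m) (l₂ :: l₁ :: ℓ') :=
    ht₁.perm ((List.Perm.cons _ hℓ').trans (List.Perm.swap _ _ _))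
  obtain ⟨P, S, rfl⟩ := List.append_of_mem hi₁
  obtain ⟨Q₁, Q₂, rfl⟩ := List.append_of_mem hj₂
  -- The second curve is based so that the site is its last entry. Then either kind of swap merges
  -- the two curves.
  have ht₃ : ∃ Q, IsTraversal L.glue (L.turn m)
      ((Q ++ [(x, j)]) :: (P ++ (x, i) :: S) :: ℓ') := by
    refine ⟨Q₂ ++ Q₁, ?_⟩
    cases Q₂ with
    | nil => simpa using ht₂
    | cons b Q₂ =>
      have := IsTraversal.rotate (P := Q₁ ++ [(x, j)]) (a := b) (S := Q₂) (by simpa using ht₂)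
      simpa using this
  obtain ⟨Q, ht₃⟩ := ht₃
  have hlen := numComponents_eq ht₃
  rw [hlen]
  rcases hswap with ⟨-, hs⟩ | ⟨-, hs⟩
  · rw [numComponents_eq (ht₃.crossed_of_split hs)]
    simp only [List.length_cons]
    omega
  · rw [numComponents_eq (ht₃.flipped_of_split L.glue_glue (L.turn_turn m) hs)]
    simp only [List.length_cons]
    omega

/-- The other smoothing of a site which is passed twice in parallel by a component has one component
more. -/
theorem numComponents_of_mem {x : L.Site} (hoff : ∀ y, y ≠ x → m' y = m y)
    (h : ¬ (m x).IsCrossing) (h' : ¬ (m' x).IsCrossing) (hne : m' x ≠ m x)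
    {ℓ : List (List L.Slot)} (ht : IsTraversal L.glue (L.turn m) ℓ) {l : List L.Slot}
    (hl : l ∈ ℓ) {i : Fin 4} (hi : (x, i) ∈ l) (hj : (x, i + 2) ∈ l) :
    L.numComponents m' = L.numComponents m + 1 := by
  have h4 : ∀ i : Fin 4, i + 2 ≠ i := by decide
  have hpair : ∀ s : SiteState, ¬ s.IsCrossing → ∀ i : Fin 4, i + 2 ≠ s.pairing i := by
    intro s hs
    cases s <;> first
      | exact absurd trivial hs
      | decide
  obtain ⟨ℓ', hℓ'⟩ : ∃ ℓ', ℓ.Perm (l :: ℓ') := by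
    obtain ⟨A, B, h⟩ := List.append_of_mem hl
    exact ⟨A ++ B, by rw [h]; exact List.perm_middle⟩
  have ht₁ := ht.perm hℓ'
  obtain ⟨P, S, rfl⟩ := List.append_of_mem hi
  have ht₂ := ht₁.rotate
  have hj' : (x, i + 2) ∈ S ++ P := by
    simp only [List.mem_append, List.mem_cons, Prod.mk.injEq, h4 i, and_false, false_or] at hj ⊢
    exact hj.symm
  obtain ⟨Q, R, hQR⟩ := List.append_of_mem hj'
  rw [hQR] at ht₂
  have ht₃ : IsTraversal L.glue (L.turn m) (([] ++ (x, i) :: Q ++ (x, i + 2) :: R) :: ℓ') := by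
    simpa using ht₂
  rcases swap_of_smoothing hoff h h' hne (h4 i) (hpair _ h i) with ⟨-, hs⟩ | ⟨h0, -⟩
  · rw [numComponents_eq (ht₃.split_of_crossed hs), numComponents_eq ht₃]
    simp only [List.length_cons]
    omega
  · exact absurd rfl h0

/-- Slots of different components are recognized by a set of slots which is closed under passing
along the strands. -/
theorem component_ne_of_closed {τ : L.Slot → L.Slot} (hτ : ∀ d, τ (τ d) = d) {Z : L.Slot → Prop}
    (hg : ∀ d, Z d → Z (L.glue d)) (ht : ∀ d, Z d → Z (τ d)) {d e : L.Slot} (hd : Z d)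
    (he : ¬ Z e) : L.component τ d ≠ L.component τ e := by
  intro h
  have key : ∀ d e : L.Slot, L.component τ d = L.component τ e → (Z d ↔ Z e) := by
    intro d e h
    have h' := Quot.eqvGen_exact h
    clear h
    induction h' with
    | rel d e h =>
      rcases h with rfl | rfl
      · exact ⟨hg d, fun h => by simpa [L.glue_glue] using hg _ h⟩
      · exact ⟨ht d, fun h => by simpa [hτ] using ht _ h⟩
    | refl => rfl
    | symm _ _ _ ih => exact ih.symm
    | trans _ _ _ _ _ ih1 ih2 => exact ih1.trans ih2
  exact he ((key d e h).1 hd)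

end LinkProjection

/-! ### The bracket expansion of the bar diagram -/

namespace DiagramData

/-- The smoothing of the site in the quadrant between the ports `k` and `k + 1` of a crossing: the
value `true` stands for the one which joins the slots `k` and `k + 1`. -/
def quadrantState (k : Fin 4) (b : Bool) : SiteState :=
  if b = (k == 0 || k == 2) then .smooth01 else .smooth03

/-- The strip of a bar is either left as it is (`true`) or cut. -/
def stripState (b : Bool) : SiteState := if b then .smooth01 else .smooth03

theorem not_isCrossing_quadrantState (k : Fin 4) (b : Bool) :
    ¬ (quadrantState k b).IsCrossing := by
  unfold quadrantState
  split_ifs <;> simp [SiteState.IsCrossing]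

theorem not_isCrossing_stripState (b : Bool) : ¬ (stripState b).IsCrossing := by
  unfold stripState
  split_ifs <;> simp [SiteState.IsCrossing]

theorem quadrantState_injective (k : Fin 4) : Function.Injective (quadrantState k) := by
  have h : ∀ (k : Fin 4) (b b' : Bool), quadrantState k b = quadrantState k b' → b = b' := by
    decide
  exact fun b b' => h k b b'

theorem stripState_injective : Function.Injective stripState := by
  have h : ∀ b b' : Bool, stripState b = stripState b' → b = b' := by decide
  exact fun b b' => h b b'

variable (D : DiagramData) {K : Type*} [Field K]

/-- The state of the bar diagram which is given by smoothings at the crossings and by the choice of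
the strips which are not cut. -/
def smoothState (v : D.C → Fin 4 → Bool) (b : D.E → Bool) : D.barDiagram.Site → SiteState
  | Sum.inl (c, k) => quadrantState k (v c k)
  | Sum.inr e => stripState (b e)

theorem not_isCrossing_smoothState (v : D.C → Fin 4 → Bool) (b : D.E → Bool)
    (x : D.barDiagram.Site) : ¬ (D.smoothState v b x).IsCrossing := by
  rcases x with ⟨c, k⟩ | e
  · exact not_isCrossing_quadrantState _ _
  · exact not_isCrossing_stripState _

/-- The coefficient of the smoothings of the four sites at a crossing. -/
noncomputable def quadrantWeight (A : K) (x : Fin 4 → Bool) : K :=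
  ∏ k, SiteState.under02.bracketWeight A (quadrantState k (x k))

/-- The coefficient of the choice for a bar. -/
noncomputable def stripWeight (A : K) (b : Bool) : K := if b then 1 else (A ^ 2 + (A ^ 2)⁻¹)⁻¹

/-- The sum over the choices at the bars, for given smoothings at the crossings. -/
noncomputable def stripSum (A : K) (v : D.C → Fin 4 → Bool) : K :=
  ∑ b : D.E → Bool, (∏ e, stripWeight A (b e)) *
    (-(A ^ 2 + (A ^ 2)⁻¹)) ^ ((D.barDiagram.numComponents (D.smoothState v b) : ℤ) - 1)

/-- The half twist is expanded by the bracket and combined with the other two terms. The result is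
the Jones–Wenzl idempotent on two strands: the cut strip gets the coefficient `-δ⁻¹`. -/
theorem sum_barChoice {A : K} (hA : A ≠ 0) (hA1 : A ^ 4 ≠ 1) (hA2 : A ^ 4 ≠ -1) (b : Bool) :
    ∑ f : BarChoice, f.weight (-A ^ 3) A * f.state.bracketWeight A (stripState b) =
      stripWeight A b := by
  have hs : (Finset.univ : Finset BarChoice) = {.halfTwist, .plain, .cut} := rfl
  have h1 : A + A⁻¹ ≠ 0 := by
    intro h
    apply hA1
    field_simp at h
    linear_combination (A ^ 2 - 1) * h
  have h1' : A ^ 2 + 1 ≠ 0 := by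
    intro h; apply h1; field_simp; simpa using h
  have h2 : A ^ 4 + 1 ≠ 0 := fun h => hA2 (by linear_combination h)
  have h3 : 1 - -A ^ 3 * A ≠ 0 := by
    intro h; apply h2; linear_combination h
  have h4 : 1 + A ^ 3 * A ≠ 0 := by
    intro h; apply h2; linear_combination h
  rw [hs, Finset.sum_insert (by decide), Finset.sum_insert (by decide), Finset.sum_singleton]
  cases b
  · simp only [BarChoice.weight, BarChoice.state, stripState, stripWeight, Bool.false_eq_true,
      if_false, SiteState.bracketWeight]
    have e1 : (1 : K) - -A ^ 3 * A = A ^ 4 + 1 := by ring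
    have e2 : A ^ 2 + (A ^ 2)⁻¹ = (A ^ 4 + 1) / A ^ 2 := by field_simp
    have e3 : A + A⁻¹ = (A ^ 2 + 1) / A := by field_simp
    rw [e1, e2, e3]
    field_simp
    ring
  · simp only [BarChoice.weight, BarChoice.state, stripState, stripWeight, 
      if_true, SiteState.bracketWeight]
    have e3 : A + A⁻¹ = (A ^ 2 + 1) / A := by field_simp
    rw [e3]
    field_simp
    ring

theorem exists_smoothState {A : K} (n : D.barDiagram.Site → SiteState)
    (h1 : ∀ c k, SiteState.under02.bracketWeight A (n (Sum.inl (c, k))) ≠ 0)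
    (h2 : ∀ e, ∃ f : BarChoice, f.state.bracketWeight A (n (Sum.inr e)) ≠ 0) :
    ∃ p : (D.C → Fin 4 → Bool) × (D.E → Bool), D.smoothState p.1 p.2 = n := by
  have k1 : ∀ (s : SiteState) (k : Fin 4), (s = .smooth01 ∨ s = .smooth03) →
      ∃ b, quadrantState k b = s := by
    have : ∀ (k : Fin 4), (∃ b, quadrantState k b = .smooth01) ∧
      ∃ b, quadrantState k b = .smooth03 := by decide
    rintro s k (rfl | rfl)
    · exact (this k).1
    · exact (this k).2
  have h1' : ∀ c k, ∃ b, quadrantState k b = n (Sum.inl (c, k)) := by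
    intro c k
    apply k1
    have := h1 c k
    cases hn : n (Sum.inl (c, k)) <;> simp [hn, SiteState.bracketWeight] at this ⊢
  have h2' : ∀ e, ∃ b, stripState b = n (Sum.inr e) := by
    intro e
    obtain ⟨f, hf⟩ := h2 e
    cases hn : n (Sum.inr e)
    · cases f <;> simp [hn, SiteState.bracketWeight, BarChoice.state] at hf
    · cases f <;> simp [hn, SiteState.bracketWeight, BarChoice.state] at hf
    · exact ⟨true, rfl⟩
    · exact ⟨false, rfl⟩
  choose v hv using h1'
  choose b hb using h2'
  refine ⟨(v, b), ?_⟩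
  funext x
  rcases x with ⟨c, k⟩ | e
  · exact hv c k
  · exact hb e

theorem prod_barSite (F : D.barDiagram.Site → K) :
    ∏ x, F x = (∏ c : D.C, ∏ k : Fin 4, F (Sum.inl (c, k))) * ∏ e : D.E, F (Sum.inr e) := by
  refine (Fintype.prod_sum_type (α₁ := D.C × Fin 4) (α₂ := D.E) F).trans ?_
  congr 1
  exact Fintype.prod_prod_type fun x => F (Sum.inl x)

theorem sum_eq_sum_smoothState (F : (D.barDiagram.Site → SiteState) → K)
    (hF : ∀ n, (¬ ∃ p : (D.C → Fin 4 → Bool) × (D.E → Bool), D.smoothState p.1 p.2 = n) → F n = 0) :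
    ∑ n, F n = ∑ p : (D.C → Fin 4 → Bool) × (D.E → Bool), F (D.smoothState p.1 p.2) := by
  refine (Fintype.sum_of_injective (fun p : (D.C → Fin 4 → Bool) × (D.E → Bool) =>
    D.smoothState p.1 p.2) ?_ (fun p => F (D.smoothState p.1 p.2)) F (fun n hn => hF n hn)
    fun _ => rfl).symm
  rintro ⟨v, b⟩ ⟨v', b'⟩ h
  simp only [Prod.mk.injEq]
  refine ⟨?_, ?_⟩
  · funext c k
    exact quadrantState_injective k (congrFun h (Sum.inl (c, k)))
  · funext e
    exact stripState_injective (congrFun h (Sum.inr e))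

/-- Jaeger's polynomial as a sum over the states of the bar diagram. -/
theorem jaegerYamada_eq_sum (hD : D.IsPlane) {A : K} (hA : A ≠ 0) (hA1 : A ^ 4 ≠ 1)
    (hA2 : A ^ 4 ≠ -1) :
    D.jaegerYamada A =
      ∑ v : D.C → Fin 4 → Bool, (∏ c, quadrantWeight A (v c)) * D.stripSum A v := by
  have hL := D.hasPotentials hD
  let F : (D.barDiagram.Site → SiteState) → K := fun n =>
    (∏ c : D.C, ∏ k : Fin 4, SiteState.under02.bracketWeight A (n (Sum.inl (c, k)))) *
      (∏ e : D.E, ∑ f : BarChoice, f.weight (-A ^ 3) A * f.state.bracketWeight A (n (Sum.inr e))) *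
      (-(A ^ 2 + (A ^ 2)⁻¹)) ^ ((D.barDiagram.numComponents n : ℤ) - 1)
  -- The sums over the choices at the bars and over the bracket states are interchanged; the former
  -- then factors over the bars.
  have step1 : D.jaegerYamada A = ∑ n, F n := by
    unfold jaegerYamada jaeger
    simp only [LinkProjection.dubrovnik_eq_bracket hA hA1 hA2 hL, LinkProjection.bracket,
      LinkProjection.stateSum, Finset.mul_sum]
    rw [Finset.sum_comm]
    refine Finset.sum_congr rfl fun n _ => ?_
    change _ = (∏ c : D.C, ∏ k : Fin 4, SiteState.under02.bracketWeight A (n (Sum.inl (c, k)))) *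
      (∏ e : D.E, ∑ f : BarChoice, f.weight (-A ^ 3) A * f.state.bracketWeight A (n (Sum.inr e))) *
      (-(A ^ 2 + (A ^ 2)⁻¹)) ^ ((D.barDiagram.numComponents n : ℤ) - 1)
    rw [Finset.prod_univ_sum, Fintype.piFinset_univ, Finset.mul_sum, Finset.sum_mul]
    refine Finset.sum_congr rfl fun f _ => ?_
    have hp : ∏ x : D.barDiagram.Site, (D.resolve f x).bracketWeight A (n x) =
        (∏ c : D.C, ∏ k : Fin 4, SiteState.under02.bracketWeight A (n (Sum.inl (c, k)))) *
          ∏ e : D.E, (f e).state.bracketWeight A (n (Sum.inr e)) := by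
      exact D.prod_barSite fun x => (D.resolve f x).bracketWeight A (n x)
    rw [hp, Finset.prod_mul_distrib]
    ring
  -- States of nonzero weight have no crossings, so they are parametrized by Booleans.
  have step2 : ∑ n, F n = ∑ p : (D.C → Fin 4 → Bool) × (D.E → Bool),
      F (D.smoothState p.1 p.2) := by
    refine D.sum_eq_sum_smoothState F ?_
    · intro n hn
      by_contra hF
      apply hn
      have hF1 := left_ne_zero_of_mul (left_ne_zero_of_mul hF)
      have hF2 := right_ne_zero_of_mul (left_ne_zero_of_mul hF)
      rw [Finset.prod_ne_zero_iff] at hF1 hF2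
      refine D.exists_smoothState (A := A) n ?_ ?_
      · intro c k
        exact Finset.prod_ne_zero_iff.1 (hF1 c (Finset.mem_univ _)) k (Finset.mem_univ _)
      · intro e
        obtain ⟨f, -, hf⟩ := Finset.exists_ne_zero_of_sum_ne_zero (hF2 e (Finset.mem_univ _))
        exact ⟨f, right_ne_zero_of_mul hf⟩
  rw [step1, step2, Fintype.sum_prod_type]
  refine Finset.sum_congr rfl fun v _ => ?_
  rw [stripSum, Finset.mul_sum]
  refine Finset.sum_congr rfl fun b _ => ?_
  have hb : ∀ e, ∑ f : BarChoice, f.weight (-A ^ 3) A *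
      f.state.bracketWeight A (D.smoothState v b (Sum.inr e)) = stripWeight A (b e) := fun e =>
    sum_barChoice hA hA1 hA2 (b e)
  simp only [F, hb]
  rw [mul_assoc]
  rfl

end DiagramData

/-! ### Expansion of a function of tuples in all coordinates -/

theorem sum_prod_of_forall_update_fin {X Y K : Type*} [Fintype Y] [CommSemiring K] (κ : Y → X)
    (r : X → Y → K) (n : ℕ) (Z : (Fin n → X) → K)
    (h : ∀ c v, Z v = ∑ t, r (v c) t * Z (Function.update v c (κ t))) (v : Fin n → X) :
    Z v = ∑ s : Fin n → Y, (∏ c, r (v c) (s c)) * Z fun c => κ (s c) := by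
  induction n with
  | zero =>
    simp only [Fintype.sum_unique, Finset.univ_eq_empty, Finset.prod_empty, one_mul]
    congr 1
    exact Subsingleton.elim _ _
  | succ n ih =>
    rw [h 0 v]
    have h1 : ∀ t, Z (Function.update v 0 (κ t)) =
        ∑ s : Fin n → Y, (∏ c, r (v c.succ) (s c)) *
          Z (Fin.cons (κ t) fun c => κ (s c) : Fin (n + 1) → X) := by
      intro t
      have e : Function.update v 0 (κ t) = Fin.cons (κ t) (Fin.tail v) := by
        rw [← Fin.cons_self_tail v, Fin.update_cons_zero, Fin.tail_cons]
      rw [e]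
      refine ih (fun w => Z (Fin.cons (κ t) w : Fin (n + 1) → X)) ?_ (Fin.tail v)
      intro c w
      refine (h c.succ _).trans ?_
      simp only [Fin.cons_succ, Fin.cons_update]
    simp only [h1, Finset.mul_sum]
    rw [← Fintype.sum_prod_type']
    refine Fintype.sum_equiv (Fin.consEquiv fun _ => Y) _ _ ?_
    rintro ⟨t, s⟩
    rw [Fin.prod_univ_succ, ← mul_assoc]
    simp only [Fin.consEquiv_apply, Fin.cons_zero, Fin.cons_succ]
    congr 2
    funext c
    refine Fin.cases ?_ (fun c => ?_) c <;> simp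

/-- If a function of tuples can be expanded in every coordinate, then it can be expanded in all
coordinates. -/
theorem sum_prod_of_forall_update {C X Y K : Type*} [Fintype C] [DecidableEq C] [Fintype Y]
    [CommSemiring K] (κ : Y → X) (r : X → Y → K) (Z : (C → X) → K)
    (h : ∀ c v, Z v = ∑ t, r (v c) t * Z (Function.update v c (κ t))) (v : C → X) :
    Z v = ∑ s : C → Y, (∏ c, r (v c) (s c)) * Z fun c => κ (s c) := by
  let e := Fintype.equivFin C
  have key := sum_prod_of_forall_update_fin κ r (Fintype.card C) (fun w => Z fun c => w (e c))
    (fun c w => by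
      refine (h (e.symm c) _).trans ?_
      simp only [Equiv.apply_symm_apply]
      refine Finset.sum_congr rfl fun t _ => ?_
      congr 2
      funext c'
      by_cases hc : c' = e.symm c
      · subst hc; simp
      · have hc' : e c' ≠ c := fun h => hc (by rw [← h]; simp)
        rw [Function.update_of_ne hc, Function.update_of_ne hc'])
    fun c => v (e.symm c)
  simp only [Equiv.symm_apply_apply] at key
  rw [key]
  refine Fintype.sum_equiv (Equiv.arrowCongr e.symm (Equiv.refl Y)) _ _ fun s => ?_
  congr 1
  refine Fintype.prod_equiv e.symm _ _ fun c => ?_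
  simp

/-! ### Resolution of a crossing of two strips -/

namespace DiagramData

/-- The smoothings in the four quadrants of a crossing which represent its state: the two smoothings
or the vertex of degree `4`. -/
def quadrants : SignType → Fin 4 → Bool
  | .pos, k => k == 0 || k == 2
  | .neg, k => k == 1 || k == 3
  | .zero, k => k != 0

/-- The expansion of the smoothings in the four quadrants of a crossing. -/
def quadrantCoeff {K : Type*} [Field K] (δ : K) (x : Fin 4 → Bool) : SignType → K
  | .pos => if x = quadrants .pos then 1 else 0
  | .neg => if x = quadrants .neg then 1 else 0
  | .zero => (if x = fun _ => true then δ else 0) +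
      ∑ k : Fin 4, if x = fun k' => k' != k then 1 else 0

variable (D : DiagramData) {K : Type*} [Field K]

/-- Neither quadrant beside the strip joins it to its neighbour, so its two sides are connected to
each other at the crossing. If the bar is cut, this turn-back closes up to a separate curve, which
is the set `Z` below; if not, it is part of the curve at the other end. -/
theorem numComponents_update_strip {v : D.C → Fin 4 → Bool} {c : D.C} {i : Fin 4}
    (h1 : v c i = false) (h2 : v c (i - 1) = false) (b : D.E → Bool) :
    D.barDiagram.numComponents (D.smoothState v
        (Function.update b (D.attach.symm (Sum.inr (c, i))).1 true)) + 1 =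
      D.barDiagram.numComponents (D.smoothState v
        (Function.update b (D.attach.symm (Sum.inr (c, i))).1 false)) := by
  set e := (D.attach.symm (Sum.inr (c, i))).1 with he
  set a := (D.attach.symm (Sum.inr (c, i))).2 with ha
  set m := D.smoothState v (Function.update b e false) with hm
  have hme : m (Sum.inr e) = SiteState.smooth03 := by simp [hm, smoothState, stripState]
  have hm1 : m (Sum.inl (c, i)) = quadrantState i false := by simp [hm, smoothState, h1]
  have hm2 : m (Sum.inl (c, i - 1)) = quadrantState (i - 1) false := by
    simp [hm, smoothState, h2]
  refine LinkProjection.numComponents_of_component_ne (L := D.barDiagram) (x := Sum.inr e) ?_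
    (D.not_isCrossing_smoothState _ _ _) (D.not_isCrossing_smoothState _ _ _) ?_ ?_
  · rintro (⟨c', k⟩ | e') hy
    · rfl
    · have : e' ≠ e := fun h => hy (by rw [h])
      simp [hm, smoothState, this]
  · simp [hm, smoothState, stripState]
  · let Z : D.barDiagram.Slot → Prop := fun d =>
      d = D.barSlot (Sum.inr (c, i)) true ∨ d = D.barSlot (Sum.inr (c, i)) false ∨
      (d.1 = Sum.inl (c, i) ∧ (d.2 = i ∨ d.2 = i - 1)) ∨
      (d.1 = Sum.inl (c, i - 1) ∧ (d.2 = i ∨ d.2 = i + 1))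
    have hbar : ∀ b, D.barSlot (Sum.inr (c, i)) b = (Sum.inr e, stripCorner a b) := fun b => rfl
    have hg : ∀ d, Z d → Z (D.barDiagram.glue d) := by
      rintro d (rfl | rfl | ⟨h3, h4 | h4⟩ | ⟨h3, h4 | h4⟩)
      · right; right; left
        change (D.barGlue (D.barSlot (Sum.inr (c, i)) true)).1 = _ ∧
          ((D.barGlue (D.barSlot (Sum.inr (c, i)) true)).2 = _ ∨ _)
        rw [D.barGlue_barSlot]
        exact ⟨rfl, Or.inl rfl⟩
      · right; right; right
        change (D.barGlue (D.barSlot (Sum.inr (c, i)) false)).1 = _ ∧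
          ((D.barGlue (D.barSlot (Sum.inr (c, i)) false)).2 = _ ∨ _)
        rw [D.barGlue_barSlot]
        exact ⟨rfl, Or.inl rfl⟩
      · obtain ⟨y, j⟩ := d
        change y = _ at h3
        change j = _ at h4
        subst h3 h4
        exact Or.inl (D.barGlue_portSlot (Sum.inr (c, j)) true)
      · obtain ⟨y, j⟩ := d
        change y = _ at h3
        change j = _ at h4
        subst h3 h4
        right; right; right
        have h5 : i - 1 - i = 3 := (by decide : ∀ i : Fin 4, i - 1 - i = 3) i
        have h6 : D.barGlue (Sum.inl (c, i), i - 1) = (Sum.inl (c, i - 1), i + 1) := by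
          simp [barGlue, h5]
        change (D.barGlue (Sum.inl (c, i), i - 1)).1 = _ ∧
          ((D.barGlue (Sum.inl (c, i), i - 1)).2 = _ ∨ (D.barGlue (Sum.inl (c, i), i - 1)).2 = _)
        rw [h6]
        exact ⟨rfl, Or.inr rfl⟩
      · obtain ⟨y, j⟩ := d
        change y = _ at h3
        change j = _ at h4
        subst h3 h4
        exact Or.inr (Or.inl (D.barGlue_portSlot (Sum.inr (c, j)) false))
      · obtain ⟨y, j⟩ := d
        change y = _ at h3
        change j = _ at h4
        subst h3 h4
        right; right; left
        have h5 : i + 1 - (i - 1) = 2 := (by decide : ∀ i : Fin 4, i + 1 - (i - 1) = 2) i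
        have h6 : D.barGlue (Sum.inl (c, i - 1), i + 1) = (Sum.inl (c, i), i - 1) := by
          simp [barGlue, h5]
        change (D.barGlue (Sum.inl (c, i - 1), i + 1)).1 = _ ∧
          ((D.barGlue (Sum.inl (c, i - 1), i + 1)).2 = _ ∨
            (D.barGlue (Sum.inl (c, i - 1), i + 1)).2 = _)
        rw [h6]
        exact ⟨rfl, Or.inr rfl⟩
    have hturn : ∀ d, Z d → Z (D.barDiagram.turn m d) := by
      have p1 : ∀ i : Fin 4, (quadrantState i false).pairing i = i - 1 ∧
          (quadrantState i false).pairing (i - 1) = i := by decide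
      have p2 : ∀ i : Fin 4, (quadrantState (i - 1) false).pairing i = i + 1 ∧
          (quadrantState (i - 1) false).pairing (i + 1) = i := by decide
      have p3 : ∀ a b, SiteState.smooth03.pairing (stripCorner a b) = stripCorner a !b := by
        decide
      rintro d (rfl | rfl | ⟨h3, h4 | h4⟩ | ⟨h3, h4 | h4⟩)
      · right; left
        rw [hbar, hbar]
        change (Sum.inr e, (m (Sum.inr e)).pairing (stripCorner a true)) = (_, _)
        rw [hme, p3]; rfl
      · left
        rw [hbar, hbar]
        change (Sum.inr e, (m (Sum.inr e)).pairing (stripCorner a false)) = (_, _)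
        rw [hme, p3]; rfl
      all_goals
        obtain ⟨y, j⟩ := d
        change y = _ at h3
        change j = _ at h4
        subst h3 h4
      · refine Or.inr (Or.inr (Or.inl ⟨rfl, Or.inr ?_⟩))
        change (m (Sum.inl (c, j))).pairing j = _
        rw [hm1, (p1 j).1]
      · refine Or.inr (Or.inr (Or.inl ⟨rfl, Or.inl ?_⟩))
        change (m (Sum.inl (c, i))).pairing (i - 1) = _
        rw [hm1, (p1 i).2]
      · refine Or.inr (Or.inr (Or.inr ⟨rfl, Or.inr ?_⟩))
        change (m (Sum.inl (c, j - 1))).pairing j = _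
        rw [hm2, (p2 j).1]
      · refine Or.inr (Or.inr (Or.inr ⟨rfl, Or.inl ?_⟩))
        change (m (Sum.inl (c, i - 1))).pairing (i + 1) = _
        rw [hm2, (p2 i).2]
    have hZ : ∀ j, Z (Sum.inr e, j) ↔ (j = stripCorner a true ∨ j = stripCorner a false) := by
      intro j
      constructor
      · rintro (h | h | ⟨h, -⟩ | ⟨h, -⟩)
        · exact Or.inl (congrArg Prod.snd h)
        · exact Or.inr (congrArg Prod.snd h)
        · exact absurd h (by exact Sum.inr_ne_inl)
        · exact absurd h (by exact Sum.inr_ne_inl)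
      · rintro (rfl | rfl)
        · exact Or.inl rfl
        · exact Or.inr (Or.inl rfl)
    have ht := D.barDiagram.turn_turn m
    cases ha' : a
    · refine LinkProjection.component_ne_of_closed ht hg hturn ((hZ 0).2 ?_) (mt (hZ 2).1 ?_) <;>
        rw [ha'] <;> decide
    · refine (LinkProjection.component_ne_of_closed ht hg hturn ((hZ 2).2 ?_)
        (mt (hZ 0).1 ?_)).symm <;>
        rw [ha'] <;> decide

/-- If all four quadrants join their strips, the inner arcs form a circle around a hole, which is
the set `Z` below. Opening any one quadrant connects this circle to the outer boundary. -/
theorem numComponents_update_quadrants (v : D.C → Fin 4 → Bool) (c : D.C) (k : Fin 4)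
    (b : D.E → Bool) :
    D.barDiagram.numComponents (D.smoothState (Function.update v c fun k' => k' != k) b) + 1 =
      D.barDiagram.numComponents (D.smoothState (Function.update v c fun _ => true) b) := by
  set m := D.smoothState (Function.update v c fun _ => true) b with hm
  have hmk : ∀ k, m (Sum.inl (c, k)) = quadrantState k true := by
    intro k
    simp [hm, smoothState]
  refine LinkProjection.numComponents_of_component_ne (L := D.barDiagram) (x := Sum.inl (c, k)) ?_
    (D.not_isCrossing_smoothState _ _ _) (D.not_isCrossing_smoothState _ _ _) ?_ ?_
  · rintro (⟨c', k'⟩ | e') hy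
    · by_cases hc : c' = c
      · subst hc
        have : k' ≠ k := fun h => hy (by rw [h])
        have hb : (k' != k) = true := by simpa using this
        simp [hm, smoothState, hb]
      · simp [hm, smoothState, hc]
    · rfl
  · rw [hmk]
    simp only [smoothState, Function.update_self, bne_self_eq_false]
    exact fun h => absurd (quadrantState_injective k h) (by decide)
  · let Z : D.barDiagram.Slot → Prop := fun d =>
      ∃ k', d.1 = Sum.inl (c, k') ∧ (d.2 = k' + 2 ∨ d.2 = k' + 3)
    have hg : ∀ d, Z d → Z (D.barDiagram.glue d) := by
      rintro ⟨y, j⟩ ⟨k', h1, h2⟩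
      change y = _ at h1
      subst h1
      change Z (D.barGlue (Sum.inl (c, k'), j))
      rcases h2 with h2 | h2 <;> change j = _ at h2 <;> subst h2
      · have h6 : D.barGlue (Sum.inl (c, k'), k' + 2) = (Sum.inl (c, k' + 1), k') := by
          simp [barGlue]
        rw [h6]
        exact ⟨k' + 1, rfl, Or.inr ((by decide : ∀ i : Fin 4, i = i + 1 + 3) k')⟩
      · have h6 : D.barGlue (Sum.inl (c, k'), k' + 3) = (Sum.inl (c, k' - 1), k' + 1) := by
          simp [barGlue]
        rw [h6]
        exact ⟨k' - 1, rfl, Or.inl ((by decide : ∀ i : Fin 4, i + 1 = i - 1 + 2) k')⟩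
    have hturn : ∀ d, Z d → Z (D.barDiagram.turn m d) := by
      have p1 : ∀ i : Fin 4, (quadrantState i true).pairing (i + 2) = i + 3 ∧
          (quadrantState i true).pairing (i + 3) = i + 2 := by decide
      rintro ⟨y, j⟩ ⟨k', h1, h2⟩
      change y = _ at h1
      subst h1
      refine ⟨k', rfl, ?_⟩
      change (m (Sum.inl (c, k'))).pairing j = _ ∨ (m (Sum.inl (c, k'))).pairing j = _
      rw [hmk]
      rcases h2 with h2 | h2 <;> change j = _ at h2 <;> subst h2
      · exact Or.inr (p1 k').1
      · exact Or.inl (p1 k').2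
    have hZ : ∀ j, Z (Sum.inl (c, k), j) ↔ (j = k + 2 ∨ j = k + 3) := by
      intro j
      constructor
      · rintro ⟨k', h1, h2⟩
        have hk : k = k' := congrArg Prod.snd (Sum.inl_injective h1)
        subst hk
        exact h2
      · exact fun h => ⟨k, rfl, h⟩
    have ht := D.barDiagram.turn_turn m
    by_cases h0 : (0 : Fin 4) = k + 2 ∨ 0 = k + 3
    · refine LinkProjection.component_ne_of_closed ht hg hturn ((hZ 0).2 h0) (mt (hZ 2).1 ?_)
      exact (by decide : ∀ k : Fin 4, (0 = k + 2 ∨ 0 = k + 3) → ¬ (2 = k + 2 ∨ 2 = k + 3)) k h0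
    · refine (LinkProjection.component_ne_of_closed ht hg hturn ((hZ 2).2 ?_)
        (mt (hZ 0).1 h0)).symm
      exact (by decide : ∀ k : Fin 4, ¬ (0 = k + 2 ∨ 0 = k + 3) → (2 = k + 2 ∨ 2 = k + 3)) k h0

end DiagramData

/-! ### Reduction to the states of the spatial graph diagram -/

namespace DiagramData

variable (D : DiagramData) {K : Type*} [Field K]

/-- The Jones–Wenzl idempotent kills turn-backs: cutting the bar creates a circle, so its factor `δ`
times `-δ⁻¹` cancels the uncut term. The sum over all bars is paired off by toggling this bar. -/
theorem stripSum_eq_zero {A : K} (hδ : A ^ 2 + (A ^ 2)⁻¹ ≠ 0) {v : D.C → Fin 4 → Bool} {c : D.C}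
    {i : Fin 4} (h1 : v c i = false) (h2 : v c (i - 1) = false) : D.stripSum A v = 0 := by
  set e := (D.attach.symm (Sum.inr (c, i))).1 with he
  have hδ' : -(A ^ 2 + (A ^ 2)⁻¹) ≠ 0 := neg_ne_zero.2 hδ
  let f : (D.E → Bool) → K := fun b => (∏ e, stripWeight A (b e)) *
    (-(A ^ 2 + (A ^ 2)⁻¹)) ^ ((D.barDiagram.numComponents (D.smoothState v b) : ℤ) - 1)
  have key : ∀ b : D.E → Bool,
      f (Function.update b e false) + f (Function.update b e true) = 0 := by
    intro b
    have hp : ∀ a, ∏ e', stripWeight A (Function.update b e a e') =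
        stripWeight A a * ∏ e' ∈ Finset.univ.erase e, stripWeight A (b e') := by
      intro a
      rw [← Finset.mul_prod_erase _ _ (Finset.mem_univ e), Function.update_self]
      congr 1
      refine Finset.prod_congr rfl fun e' he' => ?_
      rw [Function.update_of_ne (Finset.ne_of_mem_erase he')]
    have hn : ((D.barDiagram.numComponents (D.smoothState v (Function.update b e false)) : ℤ) - 1)
        = ((D.barDiagram.numComponents (D.smoothState v (Function.update b e true)) : ℤ) - 1) + 1 := by
      rw [← D.numComponents_update_strip h1 h2 b]
      push_cast
      ring
    simp only [f]
    have w1 : stripWeight A true = 1 := rfl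
    have w2 : stripWeight A false = (A ^ 2 + (A ^ 2)⁻¹)⁻¹ := rfl
    rw [hp, hp, hn, zpow_add_one₀ hδ', w1, w2]
    generalize ∏ e' ∈ Finset.univ.erase e, stripWeight A (b e') = x
    linear_combination (-x * (-(A ^ 2 + (A ^ 2)⁻¹)) ^ ((D.barDiagram.numComponents
      (D.smoothState v (Function.update b e true)) : ℤ) - 1)) * inv_mul_cancel₀ hδ
  refine Finset.sum_involution (fun b _ => Function.update b e !(b e)) ?_ ?_ ?_ ?_
  · intro b _
    have := key b
    cases hb : b e
    · have h0 : b = Function.update b e false := by rw [← hb, Function.update_eq_self]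
      rw [← h0] at this
      exact this
    · have h0 : b = Function.update b e true := by rw [← hb, Function.update_eq_self]
      rw [← h0, add_comm] at this
      exact this
  · intro b _ _ h
    have := congrFun h e
    simp at this
  · simp
  · simp

theorem stripSum_update_true {A : K} (hδ : A ^ 2 + (A ^ 2)⁻¹ ≠ 0) (v : D.C → Fin 4 → Bool) (c : D.C)
    (k : Fin 4) : D.stripSum A (Function.update v c fun _ => true) =
      -(A ^ 2 + (A ^ 2)⁻¹) * D.stripSum A (Function.update v c fun k' => k' != k) := by
  have hδ' : -(A ^ 2 + (A ^ 2)⁻¹) ≠ 0 := neg_ne_zero.2 hδ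
  unfold stripSum
  rw [Finset.mul_sum]
  refine Finset.sum_congr rfl fun b _ => ?_
  have hn : ((D.barDiagram.numComponents (D.smoothState (Function.update v c fun _ => true) b) : ℤ)
      - 1) = ((D.barDiagram.numComponents
        (D.smoothState (Function.update v c fun k' => k' != k) b) : ℤ) - 1) + 1 := by
    rw [← D.numComponents_update_quadrants v c k b]
    push_cast
    ring
  rw [hn, zpow_add_one₀ hδ']
  ring

theorem sum_signType {M : Type*} [AddCommMonoid M] (f : SignType → M) :
    ∑ t, f t = f .zero + (f .neg + f .pos) := by
  have h : (Finset.univ : Finset SignType) = {.zero, .neg, .pos} := by decide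
  rw [h, Finset.sum_insert (by decide), Finset.sum_insert (by decide), Finset.sum_singleton]

theorem quadrants_cases : ∀ x : Fin 4 → Bool, x = quadrants .pos ∨ x = quadrants .neg ∨
    (x = fun _ => true) ∨ (∃ k : Fin 4, x = fun k' => k' != k) ∨
      ∃ i : Fin 4, x i = false ∧ x (i - 1) = false := by decide

/-- A pattern with two neighbouring open quadrants has a turn-back and vanishes. The other seven are
the two smoothings, the four patterns with one open quadrant, which all have the same value and
represent the vertex, and the closed pattern, which is `δ` times the vertex. -/
theorem stripSum_expand {A : K} (hδ : A ^ 2 + (A ^ 2)⁻¹ ≠ 0) (c : D.C) (v : D.C → Fin 4 → Bool) :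
    D.stripSum A v = ∑ t, quadrantCoeff (-(A ^ 2 + (A ^ 2)⁻¹)) (v c) t *
      D.stripSum A (Function.update v c (quadrants t)) := by
  have hδ' : -(A ^ 2 + (A ^ 2)⁻¹) ≠ 0 := neg_ne_zero.2 hδ
  have self : ∀ x, v c = x → Function.update v c x = v := by
    rintro x rfl
    exact Function.update_eq_self _ _
  -- The position of the open quadrant does not matter, by comparison with the pattern in which all
  -- four are joined.
  have hzero : ∀ k : Fin 4, D.stripSum A (Function.update v c fun k' => k' != k) =
      D.stripSum A (Function.update v c (quadrants .zero)) := by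
    intro k
    refine mul_left_cancel₀ hδ' ?_
    exact (D.stripSum_update_true hδ v c k).symm.trans (D.stripSum_update_true hδ v c 0)
  have hpn : quadrants .pos ≠ quadrants .neg := by decide
  have hpt : quadrants .pos ≠ fun _ => true := by decide
  have hnt : quadrants .neg ≠ fun _ => true := by decide
  have hpk : ∀ k : Fin 4, quadrants .pos ≠ fun k' => k' != k := by decide
  have hnk : ∀ k : Fin 4, quadrants .neg ≠ fun k' => k' != k := by decide
  have htk : ∀ k : Fin 4, (fun _ : Fin 4 => true) ≠ fun k' => k' != k := by decide
  have hkk : ∀ k k0 : Fin 4, ((fun k' => k' != k) = fun k' => k' != k0) ↔ k = k0 := by decide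
  have cp : ∀ δ : K, ∀ x, quadrantCoeff δ x .pos = if x = quadrants .pos then 1 else 0 :=
    fun _ _ => rfl
  have cn : ∀ δ : K, ∀ x, quadrantCoeff δ x .neg = if x = quadrants .neg then 1 else 0 :=
    fun _ _ => rfl
  have cz : ∀ δ : K, ∀ x, quadrantCoeff δ x .zero = (if x = fun _ => true then δ else 0) +
      ∑ k : Fin 4, if x = fun k' => k' != k then 1 else 0 := fun _ _ => rfl
  have sz : ∀ x : Fin 4 → Bool, (∀ k : Fin 4, x ≠ fun k' => k' != k) →
      (∑ k : Fin 4, if x = fun k' => k' != k then (1 : K) else 0) = 0 := fun x hx =>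
    Finset.sum_eq_zero fun k _ => if_neg (hx k)
  rw [sum_signType, cp, cn, cz]
  rcases quadrants_cases (v c) with h | h | h | ⟨k, h⟩ | ⟨i, h1, h2⟩
  · rw [self _ h, h, if_pos rfl, if_neg hpn, if_neg hpt, sz _ hpk]
    ring
  · rw [self _ h, h, if_pos rfl, if_neg hpn.symm, if_neg hnt, sz _ hnk]
    ring
  · have := D.stripSum_update_true hδ v c 0
    rw [self _ h] at this
    rw [this, hzero, h, if_pos rfl, if_neg hpt.symm, if_neg hnt.symm, sz _ htk]
    ring
  · have := hzero k
    rw [self _ h] at this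
    rw [this, h, if_neg (hpk k).symm, if_neg (hnk k).symm, if_neg (htk k).symm]
    simp only [hkk, Finset.sum_ite_eq, Finset.mem_univ, if_true]
    ring
  · have e1 : ∀ i, quadrants .pos i = false → quadrants .pos (i - 1) = false → False := by decide
    have e2 : ∀ i, quadrants .neg i = false → quadrants .neg (i - 1) = false → False := by decide
    have e4 : ∀ k i : Fin 4, (i != k) = false → (i - 1 != k) = false → False := by decide
    rw [D.stripSum_eq_zero hδ h1 h2, if_neg, if_neg, if_neg, sz]
    · ring
    · intro k h; rw [h] at h1 h2; exact e4 k i h1 h2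
    · intro h; rw [h] at h1 h2; exact e1 i h1 h2
    · intro h; rw [h] at h1 h2; exact e2 i h1 h2
    · intro h; rw [h] at h1; exact absurd h1 (by simp)

/-- The coefficient of a state of a crossing. -/
noncomputable def crossingWeight (A : K) : SignType → K
  | .pos => A ^ (4 : ℤ)
  | .neg => A ^ (-4 : ℤ)
  | .zero => A ^ 2 + (A ^ 2)⁻¹

/-- For the vertex, the patterns with one open quadrant give `2 (A² + A⁻²)` and the closed pattern
gives `δ`. Each smoothing of the crossing arises from a single pattern, in which the four sites have
equal weights `A` or `A⁻¹`. -/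
theorem sum_quadrantWeight {A : K} (hA : A ≠ 0) (t : SignType) :
    ∑ x, quadrantWeight A x * quadrantCoeff (-(A ^ 2 + (A ^ 2)⁻¹)) x t = crossingWeight A t := by
  have w : ∀ x, quadrantWeight A x = SiteState.under02.bracketWeight A (quadrantState 0 (x 0)) *
      SiteState.under02.bracketWeight A (quadrantState 1 (x 1)) *
      SiteState.under02.bracketWeight A (quadrantState 2 (x 2)) *
      SiteState.under02.bracketWeight A (quadrantState 3 (x 3)) := fun x => Fin.prod_univ_four _
  cases t
  · simp only [quadrantCoeff, mul_add, Finset.mul_sum, Finset.sum_add_distrib]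
    rw [Finset.sum_comm]
    simp only [mul_ite, mul_one, mul_zero, Finset.sum_ite_eq', Finset.mem_univ, if_true,
      Fin.sum_univ_four, w]
    simp [quadrantState, SiteState.bracketWeight, crossingWeight]
    field_simp
    ring
  · simp only [quadrantCoeff, mul_ite, mul_one, mul_zero, Finset.sum_ite_eq', Finset.mem_univ,
      if_true, w]
    simp [quadrantState, quadrants, SiteState.bracketWeight, crossingWeight]
    field_simp
  · simp only [quadrantCoeff, mul_ite, mul_one, mul_zero, Finset.sum_ite_eq', Finset.mem_univ,
      if_true, w]
    simp [quadrantState, quadrants, SiteState.bracketWeight, crossingWeight]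
    ring

/-- Jaeger's polynomial as a sum over the states of the diagram of the spatial graph. -/
theorem jaegerYamada_eq_sum_states (hD : D.IsPlane) {A : K} (hA : A ≠ 0) (hA1 : A ^ 4 ≠ 1)
    (hA2 : A ^ 4 ≠ -1) :
    D.jaegerYamada A = ∑ s : D.C → SignType,
      (∏ c, crossingWeight A (s c)) * D.stripSum A fun c => quadrants (s c) := by
  have hδ := LinkProjection.loopValue_ne_zero hA hA2
  rw [D.jaegerYamada_eq_sum hD hA hA1 hA2]
  have h1 : ∀ v, D.stripSum A v = _ := sum_prod_of_forall_update quadrants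
    (quadrantCoeff (-(A ^ 2 + (A ^ 2)⁻¹))) (D.stripSum A) (D.stripSum_expand hδ)
  simp_rw [← sum_quadrantWeight hA]
  rw [Finset.sum_congr rfl fun v _ => by rw [h1 v]]
  simp_rw [Finset.mul_sum]
  rw [Finset.sum_comm]
  -- For a fixed state, the sum over the quadrant patterns factors over the crossings.
  refine Finset.sum_congr rfl fun s _ => ?_
  rw [Finset.prod_univ_sum, Fintype.piFinset_univ, Finset.sum_mul]
  refine Finset.sum_congr rfl fun v _ => ?_
  rw [Finset.prod_mul_distrib]
  ring

end DiagramData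

/-! ### The ribbon surface of a state graph -/

section

variable {X : Type*} {r r' : X → X → Prop} {a b : X}

/-- An edge added inside a component leaves the set of components unchanged. -/
theorem card_quot_of_mk_eq (h1 : ∀ x y, r x y → r' x y)
    (h2 : ∀ x y, r' x y → r x y ∨ (x = a ∧ y = b) ∨ (x = b ∧ y = a))
    (hab : Quot.mk r a = Quot.mk r b) : Nat.card (Quot r') = Nat.card (Quot r) := by
  refine (Nat.card_eq_of_bijective (Quot.map id h1 : Quot r → Quot r') ⟨?_, ?_⟩).symm
  · rintro ⟨x⟩ ⟨y⟩ h
    have h' := Quot.eqvGen_exact h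
    clear h
    change Quot.mk r x = Quot.mk r y
    change Relation.EqvGen r' x y at h'
    induction h' with
    | rel x y h =>
      rcases h2 x y h with h | ⟨rfl, rfl⟩ | ⟨rfl, rfl⟩
      · exact Quot.sound h
      · exact hab
      · exact hab.symm
    | refl => rfl
    | symm _ _ _ ih => exact ih.symm
    | trans _ _ _ _ _ ih1 ih2 => exact ih1.trans ih2
  · rintro ⟨x⟩
    exact ⟨Quot.mk r x, rfl⟩

/-- An edge added between two components merges them: the new classes correspond to the old ones
other than the class of `b`. -/
theorem card_quot_of_mk_ne [Finite X] (h1 : ∀ x y, r x y → r' x y)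
    (h2 : ∀ x y, r' x y → r x y ∨ (x = a ∧ y = b) ∨ (x = b ∧ y = a)) (h3 : r' a b)
    (hab : Quot.mk r a ≠ Quot.mk r b) : Nat.card (Quot r') + 1 = Nat.card (Quot r) := by
  classical
  let f : {q : Quot r // q ≠ Quot.mk r b} → Quot r' := fun q => Quot.map id h1 q.1
  let g : Quot r → Quot r := fun q => if q = Quot.mk r b then Quot.mk r a else q
  have hg : ∀ x y : X, Relation.EqvGen r' x y → g (Quot.mk r x) = g (Quot.mk r y) := by
    intro x y h
    induction h with
    | rel x y h =>
      rcases h2 x y h with h | ⟨rfl, rfl⟩ | ⟨rfl, rfl⟩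
      · rw [Quot.sound h]
      · simp [g]
      · simp [g]
    | refl => rfl
    | symm _ _ _ ih => exact ih.symm
    | trans _ _ _ _ _ ih1 ih2 => exact ih1.trans ih2
  have hf : Function.Bijective f := by
    constructor
    · rintro ⟨⟨x⟩, hx⟩ ⟨⟨y⟩, hy⟩ h
      have := hg x y (Quot.eqvGen_exact h)
      change (if Quot.mk r x = Quot.mk r b then Quot.mk r a else Quot.mk r x) =
        (if Quot.mk r y = Quot.mk r b then Quot.mk r a else Quot.mk r y) at this
      rw [if_neg hx, if_neg hy] at this
      exact Subtype.ext this
    · rintro ⟨x⟩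
      by_cases hx : Quot.mk r x = Quot.mk r b
      · refine ⟨⟨Quot.mk r a, hab⟩, ?_⟩
        have e : (Quot.mk r' x : Quot r') = Quot.mk r' b :=
          congrArg (Quot.map id h1 : Quot r → Quot r') hx
        exact (Quot.sound h3).trans e.symm
      · exact ⟨⟨Quot.mk r x, hx⟩, rfl⟩
  rw [← Nat.card_eq_of_bijective f hf]
  have : Fintype (Quot r) := Fintype.ofFinite _
  rw [Nat.card_eq_fintype_card, Nat.card_eq_fintype_card, Fintype.card_subtype_compl,
    Fintype.card_subtype_eq]
  have : 0 < Fintype.card (Quot r) := Fintype.card_pos_iff.2 ⟨Quot.mk r a⟩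
  omega

end

theorem finRotate_mk {d k : ℕ} (h : k + 1 < d) :
    finRotate d ⟨k, by omega⟩ = ⟨k + 1, h⟩ := by
  obtain ⟨n, rfl⟩ : ∃ n, d = n + 1 := ⟨d - 1, by omega⟩
  exact finRotate_of_lt (by omega)

namespace DiagramData

variable (D : DiagramData)

/-- The mark of the state vertex at a port of a crossing. -/
def vertexSide : SignType → Fin 4 → Bool
  | .pos, i => i = 2 ∨ i = 3
  | .neg, i => i = 1 ∨ i = 2
  | .zero, _ => false

theorem stateVertex_inr (s : D.C → SignType) (c : D.C) (i : Fin 4) :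
    D.stateVertex s (Sum.inr (c, i)) = Sum.inr (c, vertexSide (s c) i) := by
  cases h : s c <;> simp only [stateVertex, vertexSide, h]

/-- A function on the ports which is invariant under rotation at the vertices and takes the same
value at ports of a crossing which are joined in a state is a function on the vertices of the state
graph. -/
theorem eq_of_stateVertex_eq {X : Type*} (s : D.C → SignType) (f : D.Port → X)
    (hrot : ∀ p, f (Sum.inl (D.rotVertex p)) = f (Sum.inl p))
    (hc : ∀ c k, quadrants (s c) k = true → f (Sum.inr (c, k + 1)) = f (Sum.inr (c, k)))
    {p q : D.Port} (h : D.stateVertex s p = D.stateVertex s q) : f p = f q := by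
  rcases p with ⟨v, i⟩ | ⟨c, i⟩ <;> rcases q with ⟨w, j⟩ | ⟨c', j⟩
  · have hvw : v = w := Sum.inl_injective h
    subst hvw
    have key : ∀ (k : ℕ) (hk : k < D.deg v),
        f (Sum.inl ⟨v, ⟨k, hk⟩⟩) = f (Sum.inl ⟨v, ⟨0, by omega⟩⟩) := by
      intro k
      induction k with
      | zero => intro _; rfl
      | succ k ih =>
        intro hk
        rw [← ih (by omega), ← hrot ⟨v, ⟨k, by omega⟩⟩]
        congr 2
        change _ = (⟨v, finRotate (D.deg v) ⟨k, _⟩⟩ : Σ v, Fin (D.deg v))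
        exact congrArg (Sigma.mk v) (finRotate_mk hk).symm
    rw [key i i.2, key j j.2]
  · simp [stateVertex] at h
  · simp [stateVertex] at h
  · have hcc : c = c' := congrArg Prod.fst (Sum.inr_injective h)
    subst hcc
    rw [stateVertex_inr, stateVertex_inr] at h
    have h2 := congrArg Prod.snd (Sum.inr_injective h)
    change vertexSide (s c) i = vertexSide (s c) j at h2
    clear h
    have hk := hc c
    revert h2 hk
    cases s c
    · intro _ hk
      have h1 := hk 1 (by decide)
      have h2 := hk 2 (by decide)
      have h3 := hk 3 (by decide)
      simp only [Fin.isValue, Fin.reduceAdd] at h1 h2 h3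
      have all : ∀ i, f (Sum.inr (c, i)) = f (Sum.inr (c, 1)) := by
        intro i
        fin_cases i
        · exact h3.trans (h2.trans h1)
        · rfl
        · exact h1
        · exact h2.trans h1
      rw [all i, all j]
    · intro h2 hk
      have h1 := hk 1 (by decide)
      have h3 := hk 3 (by decide)
      simp only [Fin.isValue, Fin.reduceAdd] at h1 h3
      fin_cases i <;> fin_cases j <;>
        first
        | exact absurd h2 (by decide)
        | simp [h1, h3]
    · intro h2 hk
      have h1 := hk 0 (by decide)
      have h3 := hk 2 (by decide)
      simp only [Fin.isValue, Fin.reduceAdd, zero_add] at h1 h3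
      fin_cases i <;> fin_cases j <;>
        first
        | exact absurd h2 (by decide)
        | simp [h1, h3]

/-- The port to whose strip a slot of the bar diagram belongs. -/
def slotPort : D.BarSite × Fin 4 → D.Port
  | (Sum.inr e, j) => D.attach (e, (stripSide j).1)
  | (Sum.inl (c, k), j) => Sum.inr (c, if j = k ∨ j = k + 3 then k else k + 1)

theorem slotPort_barSlot (p : D.Port) (b : Bool) : D.slotPort (D.barSlot p b) = p := by
  have h : ∀ a b, (stripSide (stripCorner a b)).1 = a := by decide
  simp [slotPort, barSlot, h]

variable {D}

theorem stateVertex_rotVertex (s : D.C → SignType) (p : Σ v, Fin (D.deg v)) :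
    D.stateVertex s (Sum.inl (D.rotVertex p)) = D.stateVertex s (Sum.inl p) := rfl

theorem stateVertex_succ {s : D.C → SignType} {c : D.C} {k : Fin 4}
    (h : quadrants (s c) k = true) :
    D.stateVertex s (Sum.inr (c, k + 1)) = D.stateVertex s (Sum.inr (c, k)) := by
  have key : ∀ t k, quadrants t k = true → vertexSide t (k + 1) = vertexSide t k := by decide
  rw [stateVertex_inr, stateVertex_inr, key _ _ h]

/-- Together with the lemmas on `turn`, this assigns a component of the state graph to every
boundary curve of the ribbon surface. -/
theorem stateVertex_slotPort_glue (s : D.C → SignType) (d : D.barDiagram.Slot) :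
    D.stateVertex s (D.slotPort (D.barDiagram.glue d)) = D.stateVertex s (D.slotPort d) := by
  have hport : ∀ (p : D.Port) (b : Bool),
      D.stateVertex s (D.slotPort (D.portSlot p b)) = D.stateVertex s p := by
    rintro (p | ⟨c, i⟩) b
    · cases b
      · simp only [portSlot, slotPort_barSlot]
        rw [← stateVertex_rotVertex, Equiv.apply_symm_apply]
      · simp only [portSlot, slotPort_barSlot]
        rw [stateVertex_rotVertex]
    · have k1 : ∀ i : Fin 4, ¬ (i = i - 1 ∨ i = i - 1 + 3) := by decide
      have k2 : ∀ i : Fin 4, i - 1 + 1 = i := by decide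
      cases b
      · simp [portSlot, slotPort, k1, k2]
      · simp [portSlot, slotPort]
  rcases d with ⟨⟨c, k⟩ | e, j⟩
  · obtain ⟨i, rfl⟩ : ∃ i, j = i + k := ⟨j - k, by simp⟩
    change D.stateVertex s (D.slotPort (D.barGlue (Sum.inl (c, k), i + k))) = _
    congr 1
    have r1 : ∀ k : Fin 4, ¬ (1 + k = k ∨ 1 + k = k + 3) := by decide
    have r2 : ∀ k : Fin 4, ¬ (2 + k = k ∨ 2 + k = k + 3) := by decide
    have r3 : ∀ k : Fin 4, (3 + k = k ∨ 3 + k = k + 3) := by decide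
    have r4 : ∀ k : Fin 4, (k = k + 1 ∨ k = k + 1 + 3) := by decide
    have r5 : ∀ k : Fin 4, ¬ (k + 1 = k - 1 ∨ k + 1 = k - 1 + 3) := by decide
    have r6 : ∀ k : Fin 4, k - 1 + 1 = k := by decide
    have sp : ∀ k j, D.slotPort (Sum.inl (c, k), j) =
      Sum.inr (c, if j = k ∨ j = k + 3 then k else k + 1) := fun _ _ => rfl
    fin_cases i
    · have h : D.barGlue (Sum.inl (c, k), 0 + k) = D.barSlot (Sum.inr (c, k)) true := by
        simp [barGlue]
      exact (congrArg D.slotPort h).trans ((D.slotPort_barSlot _ _).trans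
        (congrArg (fun i => Sum.inr (c, i)) (if_pos (Or.inl (zero_add k))).symm))
    · have h : D.barGlue (Sum.inl (c, k), 1 + k) = D.barSlot (Sum.inr (c, k + 1)) false := by
        simp [barGlue]
      exact (congrArg D.slotPort h).trans ((D.slotPort_barSlot _ _).trans
        (congrArg (fun i => Sum.inr (c, i)) (if_neg (r1 k)).symm))
    · have h : D.barGlue (Sum.inl (c, k), 2 + k) = (Sum.inl (c, k + 1), k) := by
        simp [barGlue]
      exact (congrArg D.slotPort h).trans ((sp _ _).trans
        ((congrArg (fun i => Sum.inr (c, i)) (if_pos (r4 k))).trans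
          (congrArg (fun i => Sum.inr (c, i)) (if_neg (r2 k)).symm)))
    · have h : D.barGlue (Sum.inl (c, k), 3 + k) = (Sum.inl (c, k - 1), k + 1) := by
        simp [barGlue]
      exact (congrArg D.slotPort h).trans ((sp _ _).trans
        ((congrArg (fun i => Sum.inr (c, i)) ((if_neg (r5 k)).trans (r6 k))).trans
          (congrArg (fun i => Sum.inr (c, i)) (if_pos (r3 k)).symm)))
  · change D.stateVertex s (D.slotPort (D.barGlue (Sum.inr e, j))) = _
    rw [← D.barSlot_stripSide e j, barGlue_barSlot, hport]
    rfl

theorem stateVertex_slotPort_turn (s : D.C → SignType) (b : D.E → Bool) (c : D.C) (k j : Fin 4) :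
    D.stateVertex s (D.slotPort (D.barDiagram.turn (D.smoothState (fun c => quadrants (s c)) b)
      (Sum.inl (c, k), j))) = D.stateVertex s (D.slotPort (Sum.inl (c, k), j)) := by
  change D.stateVertex s (Sum.inr (c, if (quadrantState k (quadrants (s c) k)).pairing j = k ∨
      (quadrantState k (quadrants (s c) k)).pairing j = k + 3 then k else k + 1)) =
    D.stateVertex s (Sum.inr (c, if j = k ∨ j = k + 3 then k else k + 1))
  cases h : quadrants (s c) k
  · have key : ∀ k j : Fin 4, ((quadrantState k false).pairing j = k ∨
      (quadrantState k false).pairing j = k + 3) ↔ (j = k ∨ j = k + 3) := by decide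
    rw [if_congr (key k j) rfl rfl]
  · have := stateVertex_succ h
    split_ifs <;> simp [this]

theorem slotPort_turn_of_false (v : D.C → Fin 4 → Bool) {b : D.E → Bool} {e : D.E}
    (he : b e = false) (j : Fin 4) :
    D.slotPort (D.barDiagram.turn (D.smoothState v b) (Sum.inr e, j)) =
      D.slotPort (Sum.inr e, j) := by
  change D.attach (e, (stripSide ((stripState (b e)).pairing j)).1) = D.attach (e, _)
  have key : ∀ j, (stripSide ((stripState false).pairing j)).1 = (stripSide j).1 := by decide
  rw [he, key]

theorem slotPort_turn_of_true (v : D.C → Fin 4 → Bool) {b : D.E → Bool} {e : D.E}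
    (he : b e = true) (j : Fin 4) :
    D.slotPort (D.barDiagram.turn (D.smoothState v b) (Sum.inr e, j)) =
      D.attach (e, !(stripSide j).1) := by
  change D.attach (e, (stripSide ((stripState (b e)).pairing j)).1) = D.attach (e, _)
  have key : ∀ j, (stripSide ((stripState true).pairing j)).1 = !(stripSide j).1 := by decide
  rw [he, key]

end DiagramData

namespace DiagramData

variable (D : DiagramData)

/-- The vertex of the state graph at a port. -/
def portVertex (s : D.C → SignType) (p : D.Port) : V(D.stateGraph s) :=
  ⟨D.stateVertex s p, by
    obtain ⟨⟨e, a⟩, rfl⟩ := D.attach.surjective p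
    cases a
    · exact (show (D.stateGraph s).IsLink e _ _ from Or.inl ⟨rfl, rfl⟩).left_mem
    · exact (show (D.stateGraph s).IsLink e _ _ from Or.inr ⟨rfl, rfl⟩).left_mem⟩

/-- Two vertices of the state graph are joined by an edge of the set `S`. -/
def Joined (s : D.C → SignType) (S : Finset D.E) (x y : V(D.stateGraph s)) : Prop :=
  ∃ e ∈ S, (D.stateGraph s).IsLink e x y

/-- The state of the bar diagram for a state of the diagram of the spatial graph and the set of the
edges which are not cut. -/
def ribbonState (s : D.C → SignType) (S : Finset D.E) : D.barDiagram.Site → SiteState :=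
  D.smoothState (fun c => quadrants (s c)) fun e => decide (e ∈ S)

variable {D} {s : D.C → SignType} {S : Finset D.E}

theorem joined_attach {e : D.E} (he : e ∈ S) (a : Bool) :
    D.Joined s S (D.portVertex s (D.attach (e, a))) (D.portVertex s (D.attach (e, !a))) := by
  refine ⟨e, he, ?_⟩
  cases a
  · exact Or.inl ⟨rfl, rfl⟩
  · exact Or.inr ⟨rfl, rfl⟩

theorem joined_iff {x y : V(D.stateGraph s)} : D.Joined s S x y ↔
    ∃ e ∈ S, ∃ a, x = D.portVertex s (D.attach (e, a)) ∧ y = D.portVertex s (D.attach (e, !a)) := by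
  constructor
  · rintro ⟨e, he, h | h⟩
    · exact ⟨e, he, false, Subtype.ext h.1, Subtype.ext h.2⟩
    · exact ⟨e, he, true, Subtype.ext h.1, Subtype.ext h.2⟩
  · rintro ⟨e, he, a, rfl, rfl⟩
    exact joined_attach he a

/-- A boundary component of the ribbon surface belongs to a component of the state graph. -/
theorem component_ne_of_joined_ne {d d' : D.BarSite × Fin 4}
    (h : Quot.mk (D.Joined s S) (D.portVertex s (D.slotPort d)) ≠
      Quot.mk (D.Joined s S) (D.portVertex s (D.slotPort d'))) :
    D.barDiagram.component (D.barDiagram.turn (D.ribbonState s S)) d ≠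
      D.barDiagram.component (D.barDiagram.turn (D.ribbonState s S)) d' := by
  let F : D.barDiagram.Slot → Quot (D.Joined s S) := fun e =>
    Quot.mk (D.Joined s S) (D.portVertex s (D.slotPort e))
  have hF : ∀ p q : D.Port, D.stateVertex s p = D.stateVertex s q →
      Quot.mk (D.Joined s S) (D.portVertex s p) = Quot.mk (D.Joined s S) (D.portVertex s q) :=
    fun p q hpq => congrArg _ (Subtype.ext hpq)
  have hg : ∀ e, F (D.barDiagram.glue e) = F e := fun e => hF _ _ (stateVertex_slotPort_glue s e)
  have ht : ∀ e, F (D.barDiagram.turn (D.ribbonState s S) e) = F e := by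
    rintro ⟨⟨c, k⟩ | e, j⟩
    · exact hF _ _ (stateVertex_slotPort_turn s _ c k j)
    · by_cases he : e ∈ S
      · have h1 : D.slotPort (D.barDiagram.turn (D.ribbonState s S) (Sum.inr e, j)) = _ :=
          slotPort_turn_of_true _ (b := fun e => decide (e ∈ S)) (decide_eq_true he) j
        exact (congrArg (fun p => Quot.mk (D.Joined s S) (D.portVertex s p)) h1).trans
          (Quot.sound (joined_attach he _)).symm
      · have h1 : D.slotPort (D.barDiagram.turn (D.ribbonState s S) (Sum.inr e, j)) = _ :=
          slotPort_turn_of_false _ (b := fun e => decide (e ∈ S)) (decide_eq_false he) j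
        exact congrArg (fun p => Quot.mk (D.Joined s S) (D.portVertex s p)) h1
  refine LinkProjection.component_ne_of_closed (Z := fun e => F e = F d)
    (D.barDiagram.turn_turn _) ?_ ?_ rfl ?_
  · intro e he
    rw [hg, he]
  · intro e he
    rw [ht, he]
  · exact fun h' => h h'.symm

/-- A function on the regions which does not change inside the ribbon surface. -/
theorem potential_eq_of_joined_eq {κ : D.BarSite × Fin 4 → ℚ}
    (hglue : ∀ d, κ d = κ ((D.barGlue d).1, (D.barGlue d).2 - 1))
    (hstrip : ∀ e ∈ S, κ (Sum.inr e, 3) = κ (Sum.inr e, 1))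
    (hquad : ∀ c k, quadrants (s c) k = true →
      κ (Sum.inl (c, k), k + 1) = κ (Sum.inl (c, k), k + 3)) {e e' : D.E} {a a' : Bool}
    (h : Quot.mk (D.Joined s S) (D.portVertex s (D.attach (e, a))) =
      Quot.mk (D.Joined s S) (D.portVertex s (D.attach (e', a')))) :
    κ (Sum.inr e, stripCorner a true) = κ (Sum.inr e', stripCorner a' true) := by
  let f : D.Port → ℚ := fun p => κ (D.barSlot p true)
  have hfa : ∀ e a, f (D.attach (e, a)) = κ (Sum.inr e, stripCorner a true) := by
    intro e a
    simp only [f, barSlot, Equiv.symm_apply_apply]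
  have hright : ∀ p, f p = κ ((D.barSlot p false).1, (D.barSlot p false).2 - 1) := by
    have : ∀ a, stripCorner a true = stripCorner a false - 1 := by decide
    intro p
    simp only [f, barSlot, this]
  have hrot : ∀ p, f (Sum.inl (D.rotVertex p)) = f (Sum.inl p) := by
    intro p
    rw [hright]
    refine ((hglue _).trans ?_).symm
    rw [barGlue_barSlot]
    rfl
  have hleft' : ∀ c k, f (Sum.inr (c, k)) = κ (Sum.inl (c, k), k + 3) := by
    have : ∀ k : Fin 4, k - 1 = k + 3 := by decide
    intro c k
    rw [← this]
    refine (hglue _).trans ?_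
    rw [barGlue_barSlot]
    rfl
  have hright' : ∀ c k, f (Sum.inr (c, k + 1)) = κ (Sum.inl (c, k), k + 1) := by
    intro c k
    rw [hright]
    refine ((hglue _).trans ?_).symm
    have : D.barGlue (Sum.inl (c, k), k + 1) = D.barSlot (Sum.inr (c, k + 1)) false := by
      simp [barGlue]
    rw [this]
  have hvert : ∀ p q, D.stateVertex s p = D.stateVertex s q → f p = f q := fun p q hpq =>
    D.eq_of_stateVertex_eq s f hrot (fun c k hck => by
      rw [hright', hleft', hquad c k hck]) hpq
  have hlink : ∀ e ∈ S, ∀ a, f (D.attach (e, !a)) = f (D.attach (e, a)) := by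
    intro e he a
    rw [hfa, hfa]
    cases a
    · exact (hstrip e he).symm
    · exact hstrip e he
  let Z : V(D.stateGraph s) → Prop := fun x =>
    ∀ p, D.portVertex s p = x → f p = f (D.attach (e, a))
  -- `Z x` says that the potential inside the ribbon surface at the vertex `x` is the one at the
  -- chosen port; it spreads along uncut strips.
  have step : ∀ x y, D.Joined s S x y → Z x → Z y := by
    intro x y hxy hx p hp
    obtain ⟨e₁, he₁, a₁, rfl, rfl⟩ := joined_iff.1 hxy
    rw [hvert p _ (congrArg Subtype.val hp), hlink e₁ he₁, hx _ rfl]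
  have hsymm : ∀ x y, D.Joined s S x y → D.Joined s S y x := fun x y ⟨e, he, h⟩ =>
    ⟨e, he, h.symm⟩
  have key : ∀ x y, Relation.EqvGen (D.Joined s S) x y → (Z x ↔ Z y) := by
    intro x y hxy
    induction hxy with
    | rel x y h => exact ⟨step x y h, step y x (hsymm x y h)⟩
    | refl => rfl
    | symm _ _ _ ih => exact ih.symm
    | trans _ _ _ _ _ ih1 ih2 => exact ih1.trans ih2
  have h0 : Z (D.portVertex s (D.attach (e, a))) := fun p hp => hvert _ _ (congrArg Subtype.val hp)
  have h1 := (key _ _ (Quot.eqvGen_exact h)).1 h0 _ rfl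
  rw [← hfa, ← hfa]
  exact h1.symm

theorem ribbonState_strip_of_mem {e : D.E} (he : e ∈ S) :
    D.ribbonState s S (Sum.inr e) = .smooth01 := by
  simp [ribbonState, smoothState, stripState, he]

theorem ribbonState_strip_of_notMem {e : D.E} (he : e ∉ S) :
    D.ribbonState s S (Sum.inr e) = .smooth03 := by
  simp [ribbonState, smoothState, stripState, he]

/-- If a strip is added between two vertices in the same component of the state graph, the number of
boundary components grows. -/
theorem numComponents_insert_of_joined_eq (hD : D.IsPlane) {e : D.E} (he : e ∉ S)
    (h : Quot.mk (D.Joined s S) (D.portVertex s (D.attach (e, false))) =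
      Quot.mk (D.Joined s S) (D.portVertex s (D.attach (e, true)))) :
    D.barDiagram.numComponents (D.ribbonState s (insert e S)) =
      D.barDiagram.numComponents (D.ribbonState s S) + 1 := by
  set m := D.ribbonState s S with hm
  have ht := D.barDiagram.isTraversal_baseTraversal m
  have hme : m (Sum.inr e) = .smooth03 := ribbonState_strip_of_notMem he
  obtain ⟨j, hj, hmem, -⟩ := LinkProjection.exists_entry (L := D.barDiagram) m (Sum.inr e) 0
  rw [hme] at hj
  obtain ⟨l, hl, hjl⟩ := List.mem_flatten.1 hmem
  have hcl := ht.closed l hl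
  -- `κ` is the winding function of a boundary curve `l` which passes one end of the cut strip. It
  -- will show that `l` passes the other end as well.
  obtain ⟨κ, hκ, hκg⟩ := D.hasPotentials hD (LinkProjection.curveFlow (D.barDiagram.turn m) l)
    (LinkProjection.curveFlow_glue hcl) (fun x =>
      LinkProjection.sum_eq_zero_of_turn (LinkProjection.curveFlow_turn (m := m) l) x)
  set z := LinkProjection.curveFlow (D.barDiagram.turn m) l with hz
  have hzt : ∀ d, z (D.barDiagram.turn m d) = - z d :=
    LinkProjection.curveFlow_turn (m := m) l
  have h01 : ∀ x, m x = .smooth01 → κ (x, 3) = κ (x, 1) := by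
    intro x hx
    have e1 : D.barDiagram.turn m (x, 2) = (x, 3) := by
      simp [LinkProjection.turn, hx, SiteState.pairing]
    have := hzt (x, 2)
    rw [e1, ← hκ, ← hκ] at this
    simp only [Fin.isValue, Fin.reduceSub] at this
    linarith
  have h03 : ∀ x, m x = .smooth03 → κ (x, 0) = κ (x, 2) := by
    intro x hx
    have e1 : D.barDiagram.turn m (x, 1) = (x, 2) := by
      simp [LinkProjection.turn, hx, SiteState.pairing]
    have := hzt (x, 1)
    rw [e1, ← hκ, ← hκ] at this
    simp only [Fin.isValue, Fin.reduceSub] at this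
    linarith
  -- The two ends of the cut strip lie in the same component of the surface, inside which `κ` does
  -- not change.
  have hint : κ (Sum.inr e, 3) = κ (Sum.inr e, 1) := by
    refine potential_eq_of_joined_eq (s := s) (S := S) (a := false) (a' := true) (κ := κ) hκg ?_ ?_ h
    · exact fun e' he' => h01 _ (ribbonState_strip_of_mem he')
    · intro c k hck
      have h5 : m (Sum.inl (c, k)) = quadrantState k true := by
        rw [← hck]; rfl
      have h6 : ∀ k, (k = 0 ∨ k = 2) ∧ quadrantState k true = .smooth01 ∨
          (k = 1 ∨ k = 3) ∧ quadrantState k true = .smooth03 := by decide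
      rcases h6 k with ⟨rfl | rfl, h7⟩ | ⟨rfl | rfl, h7⟩
      · exact (h01 _ (h5.trans h7)).symm
      · exact h01 _ (h5.trans h7)
      · exact (h03 _ (h5.trans h7)).symm
      · exact h03 _ (h5.trans h7)
  -- The regions on the two long sides of the strip are connected through the cut, so `κ` also
  -- agrees there, and the jumps at the two ends coincide. Hence `l` enters at opposite slots of the
  -- site, and inserting the strip splits it.
  have hz02 : z (Sum.inr e, 0) = z (Sum.inr e, 2) := by
    have e0 : κ (Sum.inr e, 0) - κ (Sum.inr e, 3) = z (Sum.inr e, 0) := hκ (Sum.inr e) 0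
    have e2 : κ (Sum.inr e, 2) - κ (Sum.inr e, 1) = z (Sum.inr e, 2) := hκ (Sum.inr e) 2
    have := h03 _ hme
    linarith
  have hoff : ∀ y, y ≠ Sum.inr e → D.ribbonState s (insert e S) y = m y := by
    rintro (⟨c, k⟩ | e') hy
    · rfl
    · have : e' ≠ e := fun h => hy (by rw [h])
      simp [hm, ribbonState, smoothState, this]
  have hne : D.ribbonState s (insert e S) (Sum.inr e) ≠ m (Sum.inr e) := by
    rw [hme, ribbonState_strip_of_mem (Finset.mem_insert_self e S)]
    decide
  have fin := fun i hi hj => LinkProjection.numComponents_of_mem (L := D.barDiagram)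
    (x := Sum.inr e) hoff (D.not_isCrossing_smoothState _ _ _)
    (D.not_isCrossing_smoothState _ _ _) hne ht hl (i := i) hi hj
  have hcov : ∀ d, d ∈ l → D.barDiagram.turn m d ∉ l := fun d hd hd' =>
    (ht.covers.2 d).1 (List.mem_flatten.2 ⟨l, hl, hd⟩) (List.mem_flatten.2 ⟨l, hl, hd'⟩)
  have hzval : ∀ d, z d = (if D.barDiagram.turn m d ∈ l then 1 else 0) - if d ∈ l then 1 else 0 :=
    fun d => rfl
  rcases hj with rfl | rfl
  · refine fin 0 hjl ?_
    have h1 := hzval (Sum.inr e, 0)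
    rw [if_neg (hcov _ hjl), if_pos hjl] at h1
    have h3 := h1.symm.trans (hz02.trans (hzval (Sum.inr e, 2)))
    change (Sum.inr e, 2) ∈ l
    split_ifs at h3 with g1 g2 g2
    · norm_num at h3
    · norm_num at h3
    · exact g2
    · norm_num at h3
  · have e0 : D.barDiagram.turn m (Sum.inr e, 0) = (Sum.inr e, 3) :=
      congrArg (fun t : SiteState => (Sum.inr e, t.pairing 0)) hme
    have e2 : D.barDiagram.turn m (Sum.inr e, 2) = (Sum.inr e, 1) :=
      congrArg (fun t : SiteState => (Sum.inr e, t.pairing 2)) hme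
    have hjl' : (Sum.inr e, 3) ∈ l := hjl
    refine fin 3 hjl' ?_
    have h0 : (Sum.inr e, 0) ∉ l := by
      intro h0
      exact hcov _ h0 (e0 ▸ hjl')
    have h1 := hzval (Sum.inr e, 0)
    rw [if_pos (e0 ▸ hjl'), if_neg (by exact h0)] at h1
    have h3 := h1.symm.trans (hz02.trans (hzval (Sum.inr e, 2)))
    change (Sum.inr e, 1) ∈ l
    split_ifs at h3 with g1 g2 g2
    · norm_num at h3
    · exact e2 ▸ g1
    · norm_num at h3
    · norm_num at h3

/-- If a strip is added between two vertices in different components of the state graph, the number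
of boundary components decreases. -/
theorem numComponents_insert_of_joined_ne {e : D.E} (he : e ∉ S)
    (h : Quot.mk (D.Joined s S) (D.portVertex s (D.attach (e, false))) ≠
      Quot.mk (D.Joined s S) (D.portVertex s (D.attach (e, true)))) :
    D.barDiagram.numComponents (D.ribbonState s (insert e S)) + 1 =
      D.barDiagram.numComponents (D.ribbonState s S) := by
  refine LinkProjection.numComponents_of_component_ne (L := D.barDiagram) (x := Sum.inr e) ?_
    (D.not_isCrossing_smoothState _ _ _) (D.not_isCrossing_smoothState _ _ _) ?_ ?_
  · rintro (⟨c, k⟩ | e') hy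
    · rfl
    · have : e' ≠ e := fun h => hy (by rw [h])
      simp [ribbonState, smoothState, this]
  · rw [ribbonState_strip_of_notMem he, ribbonState_strip_of_mem (Finset.mem_insert_self e S)]
    decide
  · exact component_ne_of_joined_ne h

end DiagramData

/-! ### Counting the boundary curves of a ribbon surface -/

namespace DiagramData

variable {D : DiagramData} {s : D.C → SignType} {S : Finset D.E}

/-- The boundary component of a ribbon surface all of whose strips are cut runs along the strips
which start at a vertex of the state graph. -/
theorem component_eq_component_barSlot (d : D.BarSite × Fin 4) :
    D.barDiagram.component (D.barDiagram.turn (D.ribbonState s ∅)) d =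
      D.barDiagram.component (D.barDiagram.turn (D.ribbonState s ∅))
        (D.barSlot (D.slotPort d) true) := by
  set comp : D.BarSite × Fin 4 → D.barDiagram.Component (D.barDiagram.turn (D.ribbonState s ∅)) :=
    D.barDiagram.component (D.barDiagram.turn (D.ribbonState s ∅)) with hcomp
  have hg : ∀ d, comp (D.barGlue d) = comp d := fun d =>
    D.barDiagram.component_glue _ d
  have ht : ∀ x j, comp (x, (D.ribbonState s ∅ x).pairing j) = comp (x, j) := fun x j =>
    D.barDiagram.component_turn _ (x, j)
  have hside : ∀ p b, comp (D.barSlot p b) = comp (D.barSlot p true) := by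
    intro p b
    cases b
    · have h1 := ht (Sum.inr (D.attach.symm p).1) (stripCorner (D.attach.symm p).2 true)
      rw [ribbonState_strip_of_notMem (Finset.notMem_empty _)] at h1
      have h2 : ∀ a, SiteState.smooth03.pairing (stripCorner a true) = stripCorner a false := by
        decide
      rw [h2] at h1
      exact h1
    · rfl
  rcases d with ⟨⟨c, k⟩ | e, j⟩
  · have g0 : ∀ k, comp (Sum.inl (c, k), k) = comp (D.barSlot (Sum.inr (c, k)) true) := by
      intro k
      rw [← hg (Sum.inl (c, k), k)]
      simp [barGlue]
    have g1 : ∀ k, comp (Sum.inl (c, k), k + 1) = comp (D.barSlot (Sum.inr (c, k + 1)) true) := by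
      intro k
      rw [← hg (Sum.inl (c, k), k + 1), ← hside _ false]
      simp [barGlue]
    have g3 : ∀ k, comp (Sum.inl (c, k + 1), k) = comp (Sum.inl (c, k), k + 2) := by
      intro k
      rw [← hg (Sum.inl (c, k), k + 2)]
      simp [barGlue]
    have tf : ∀ k, quadrants (s c) k = false →
        comp (Sum.inl (c, k), k + 2) = comp (D.barSlot (Sum.inr (c, k + 1)) true) ∧
        comp (Sum.inl (c, k), k + 3) = comp (D.barSlot (Sum.inr (c, k)) true) := by
      intro k hk
      have hst : D.ribbonState s ∅ (Sum.inl (c, k)) = quadrantState k false := by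
        rw [← hk]; rfl
      have p1 : ∀ k : Fin 4, (quadrantState k false).pairing (k + 2) = k + 1 := by decide
      have p2 : ∀ k : Fin 4, (quadrantState k false).pairing (k + 3) = k := by decide
      have t1 := ht (Sum.inl (c, k)) (k + 2)
      have t2 := ht (Sum.inl (c, k)) (k + 3)
      rw [hst, p1, g1] at t1
      rw [hst, p2, g0] at t2
      exact ⟨t1.symm, t2.symm⟩
    have tt : ∀ k, quadrants (s c) k = true →
        comp (Sum.inl (c, k), k + 2) = comp (Sum.inl (c, k), k + 3) ∧
        comp (D.barSlot (Sum.inr (c, k + 1)) true) = comp (D.barSlot (Sum.inr (c, k)) true) := by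
      intro k hk
      have hst : D.ribbonState s ∅ (Sum.inl (c, k)) = quadrantState k true := by
        rw [← hk]; rfl
      have p1 : ∀ k : Fin 4, (quadrantState k true).pairing (k + 3) = k + 2 := by decide
      have p2 : ∀ k : Fin 4, (quadrantState k true).pairing k = k + 1 := by decide
      have t1 := ht (Sum.inl (c, k)) (k + 3)
      have t2 := ht (Sum.inl (c, k)) k
      rw [hst, p1] at t1
      rw [hst, p2, g0, g1] at t2
      exact ⟨t1, t2⟩
    -- It remains to follow the inner arcs. An inner arc beside an open quadrant is led out to a
    -- strip there; otherwise the connection is passed on from quadrant to quadrant.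
    have a3 : ∀ k : Fin 4, k + 1 + 3 = k := by decide
    have inner : ∀ k, quadrants (s c) k = false ∨ quadrants (s c) (k + 1) = false →
        comp (Sum.inl (c, k), k + 2) = comp (D.barSlot (Sum.inr (c, k + 1)) true) := by
      rintro k (hk | hk)
      · exact (tf k hk).1
      · rw [← g3, ← (tf _ hk).2, a3]
    have step : ∀ k, quadrants (s c) (k + 1) = true →
        comp (Sum.inl (c, k), k + 2) = comp (D.barSlot (Sum.inr (c, k + 1)) true) →
        comp (Sum.inl (c, k + 1), k + 1 + 2) =
          comp (D.barSlot (Sum.inr (c, k + 1 + 1)) true) := by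
      intro k hk h
      rw [(tt _ hk).2, (tt _ hk).1, a3, g3, h]
    have all : ∀ k, comp (Sum.inl (c, k), k + 2) =
        comp (D.barSlot (Sum.inr (c, k + 1)) true) := by
      -- For the vertex state quadrant `0` is open, so the arcs beside it are settled directly and
      -- the other two by passing through the quadrants `1` and `2`. For the smoothings, every inner
      -- arc is beside an open quadrant.
      cases hs : s c
      · rw [hs] at inner step
        have i0 := inner 0 (by decide)
        have i1 := step 0 (by decide) i0
        have i2 := step 1 (by decide) i1
        have i3 := inner 3 (by decide)
        intro k
        fin_cases k
        exacts [i0, i1, i2, i3]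
      · rw [hs] at inner
        exact fun k => inner k ((by decide : ∀ k, quadrants .neg k = false ∨
          quadrants .neg (k + 1) = false) k)
      · rw [hs] at inner
        exact fun k => inner k ((by decide : ∀ k, quadrants .pos k = false ∨
          quadrants .pos (k + 1) = false) k)
    have sp : ∀ j, D.slotPort (Sum.inl (c, k), j) =
      Sum.inr (c, if j = k ∨ j = k + 3 then k else k + 1) := fun _ => rfl
    rw [sp]
    obtain ⟨i, rfl⟩ : ∃ i, j = k + i := ⟨j - k, by simp⟩
    have r0 : (k + 0 = k ∨ k + 0 = k + 3) := by simp
    have r1 : ∀ k : Fin 4, ¬ (k + 1 = k ∨ k + 1 = k + 3) := by decide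
    have r2 : ∀ k : Fin 4, ¬ (k + 2 = k ∨ k + 2 = k + 3) := by decide
    have r3 : (k + 3 = k ∨ k + 3 = k + 3) := Or.inr rfl
    fin_cases i
    · rw [if_pos (by exact r0), ← g0]
      simp
    · rw [if_neg (by exact r1 k), ← g1]
      rfl
    · rw [if_neg (by exact r2 k), ← all]
      rfl
    · rw [if_pos (by exact r3)]
      have := all (k + 3)
      have b1 : ∀ k : Fin 4, k + 3 + 1 = k := by decide
      rw [b1, ← g3, b1] at this
      exact this
  · refine (congrArg comp (D.barSlot_stripSide e j)).symm.trans ?_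
    exact hside _ _

theorem component_barSlot_eq_of_portVertex_eq {p q : D.Port}
    (h : D.portVertex s p = D.portVertex s q) :
    D.barDiagram.component (D.barDiagram.turn (D.ribbonState s ∅)) (D.barSlot p true) =
      D.barDiagram.component (D.barDiagram.turn (D.ribbonState s ∅)) (D.barSlot q true) := by
  set comp : D.BarSite × Fin 4 → D.barDiagram.Component (D.barDiagram.turn (D.ribbonState s ∅)) :=
    D.barDiagram.component (D.barDiagram.turn (D.ribbonState s ∅)) with hcomp
  have hg : ∀ d, comp (D.barGlue d) = comp d := fun d =>
    D.barDiagram.component_glue _ d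
  have ht : ∀ x j, comp (x, (D.ribbonState s ∅ x).pairing j) = comp (x, j) := fun x j =>
    D.barDiagram.component_turn _ (x, j)
  refine D.eq_of_stateVertex_eq s (fun p => comp (D.barSlot p true)) ?_ ?_ (congrArg Subtype.val h)
  · intro p
    have h1 := hg (D.barSlot (Sum.inl p) true)
    rw [barGlue_barSlot] at h1
    have h2 : comp (D.barSlot (Sum.inl (D.rotVertex p)) false) =
        comp (D.barSlot (Sum.inl (D.rotVertex p)) true) := by
      refine (component_eq_component_barSlot _).trans ?_
      rw [slotPort_barSlot]
    exact h2.symm.trans h1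
  · intro c k hk
    have hst : D.ribbonState s ∅ (Sum.inl (c, k)) = quadrantState k true := by
      rw [← hk]; rfl
    have p2 : ∀ k : Fin 4, (quadrantState k true).pairing k = k + 1 := by decide
    have t2 := ht (Sum.inl (c, k)) k
    rw [hst, p2] at t2
    have e1 := component_eq_component_barSlot (s := s) (Sum.inl (c, k), k)
    have e2 := component_eq_component_barSlot (s := s) (Sum.inl (c, k), k + 1)
    have q1 : D.slotPort (Sum.inl (c, k), k) = Sum.inr (c, k) := by simp [slotPort]
    have q2 : D.slotPort (Sum.inl (c, k), k + 1) = Sum.inr (c, k + 1) := by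
      have r1 : ∀ k : Fin 4, ¬ (k + 1 = k ∨ k + 1 = k + 3) := by decide
      simp only [slotPort, if_neg (r1 k)]
    rw [q1] at e1
    rw [q2] at e2
    exact e2.symm.trans (t2.trans e1)

/-- With all strips cut, the surface is a union of discs, one for each vertex of the state graph.
Isolated vertices meet no site and are counted by `circles`. -/
theorem numComponents_ribbonState_empty :
    D.barDiagram.numComponents (D.ribbonState s ∅) = Nat.card V(D.stateGraph s) := by
  classical
  let τ := D.barDiagram.turn (D.ribbonState s ∅)
  have hwd : ∀ d e : D.barDiagram.Slot, e = D.barDiagram.glue d ∨ e = τ d →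
      D.portVertex s (D.slotPort d) = D.portVertex s (D.slotPort e) := by
    rintro d e (rfl | rfl)
    · exact Subtype.ext (stateVertex_slotPort_glue s d).symm
    · rcases d with ⟨⟨c, k⟩ | e, j⟩
      · exact Subtype.ext (stateVertex_slotPort_turn s _ c k j).symm
      · exact congrArg (D.portVertex s) (slotPort_turn_of_false _
          (b := fun e => decide (e ∈ (∅ : Finset D.E))) (by simp) j).symm
  let F : D.barDiagram.Component τ ⊕ {v // D.deg v = 0} → V(D.stateGraph s) :=
    Sum.elim (Quot.lift (fun d => D.portVertex s (D.slotPort d)) hwd)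
      fun v => ⟨Sum.inl v.1, fun c h => by simp at h⟩
  have hF : Function.Bijective F := by
    constructor
    · rintro (q | ⟨v, hv⟩) (q' | ⟨w, hw⟩) h
      · obtain ⟨d, rfl⟩ := Quot.exists_rep q
        obtain ⟨d', rfl⟩ := Quot.exists_rep q'
        have h1 : D.portVertex s (D.slotPort d) = D.portVertex s (D.slotPort d') := h
        exact congrArg Sum.inl ((component_eq_component_barSlot d).trans
          ((component_barSlot_eq_of_portVertex_eq h1).trans
            (component_eq_component_barSlot d').symm))
      · exfalso
        obtain ⟨d, rfl⟩ := Quot.exists_rep q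
        have h1 : D.stateVertex s (D.slotPort d) = Sum.inl w := congrArg Subtype.val h
        rcases hp : D.slotPort d with ⟨v, i⟩ | p
        · rw [hp] at h1
          have : v = w := Sum.inl_injective h1
          subst this
          exact absurd i.2 (by omega)
        · rw [hp] at h1
          simp [stateVertex] at h1
      · exfalso
        obtain ⟨d', rfl⟩ := Quot.exists_rep q'
        have h1 : Sum.inl v = D.stateVertex s (D.slotPort d') := congrArg Subtype.val h
        rcases hp : D.slotPort d' with ⟨w, i⟩ | p
        · rw [hp] at h1
          have : v = w := Sum.inl_injective h1
          subst this
          exact absurd i.2 (by omega)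
        · rw [hp] at h1
          simp [stateVertex] at h1
      · have h1 : v = w := Sum.inl_injective (congrArg Subtype.val h)
        subst h1
        rfl
    · have hport : ∀ p, ∃ x, F x = D.portVertex s p := fun p =>
        ⟨Sum.inl (Quot.mk _ (D.barSlot p true)), congrArg (D.portVertex s)
          (D.slotPort_barSlot p true)⟩
      rintro ⟨v | ⟨c, b⟩, hx⟩
      · by_cases hv : D.deg v = 0
        · exact ⟨Sum.inr ⟨v, hv⟩, rfl⟩
        · obtain ⟨x, hx⟩ := hport (Sum.inl ⟨v, ⟨0, Nat.pos_of_ne_zero hv⟩⟩)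
          exact ⟨x, hx.trans (Subtype.ext rfl)⟩
      · cases b
        · obtain ⟨x, hx'⟩ := hport (Sum.inr (c, 0))
          refine ⟨x, hx'.trans (Subtype.ext ((D.stateVertex_inr s c 0).trans ?_))⟩
          have : ∀ t, vertexSide t 0 = false := by decide
          rw [this]
        · obtain ⟨x, hx'⟩ := hport (Sum.inr (c, 2))
          refine ⟨x, hx'.trans (Subtype.ext ((D.stateVertex_inr s c 2).trans ?_))⟩
          have : ∀ t : SignType, t ≠ 0 → vertexSide t 2 = true := by decide
          rw [this _ (hx c rfl)]
  have : Finite (D.barDiagram.Component τ) :=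
    inferInstanceAs (Finite (Quot _))
  rw [← Nat.card_eq_of_bijective F hF, Nat.card_sum, LinkProjection.numComponents]
  congr 1
  exact Nat.card_eq_fintype_card.symm

/-- The number of boundary components of a ribbon surface in the plane. -/
theorem numComponents_ribbonState (hD : D.IsPlane) (S : Finset D.E) :
    D.barDiagram.numComponents (D.ribbonState s S) + Nat.card V(D.stateGraph s) =
      2 * Nat.card (Quot (D.Joined s S)) + S.card := by
  have : Finite V(D.stateGraph s) := Subtype.finite
  -- A strip inside a component adds a boundary curve; a strip between two components removes a
  -- boundary curve and a component. Both changes preserve the identity.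
  induction S using Finset.induction_on with
  | empty =>
    have h : Function.Bijective (Quot.mk (D.Joined s ∅)) := by
      refine ⟨fun x y h => ?_, Quot.exists_rep⟩
      have h' := Quot.eqvGen_exact h
      clear h
      induction h' with
      | rel x y h => exact absurd h.choose_spec.1 (Finset.notMem_empty _)
      | refl => rfl
      | symm _ _ _ ih => exact ih.symm
      | trans _ _ _ _ _ ih1 ih2 => exact ih1.trans ih2
    rw [numComponents_ribbonState_empty, ← Nat.card_eq_of_bijective _ h, Finset.card_empty]
    omega
  | insert e S he ih =>
    have h1 : ∀ x y, D.Joined s S x y → D.Joined s (insert e S) x y := fun x y ⟨e', he', h⟩ =>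
      ⟨e', Finset.mem_insert_of_mem he', h⟩
    have h2 : ∀ x y, D.Joined s (insert e S) x y → D.Joined s S x y ∨
        (x = D.portVertex s (D.attach (e, false)) ∧ y = D.portVertex s (D.attach (e, true))) ∨
        (x = D.portVertex s (D.attach (e, true)) ∧ y = D.portVertex s (D.attach (e, false))) := by
      rintro x y ⟨e', he', h⟩
      rcases Finset.mem_insert.1 he' with rfl | he'
      · exact Or.inr (h.imp (fun h => ⟨Subtype.ext h.1, Subtype.ext h.2⟩)
          fun h => ⟨Subtype.ext h.1, Subtype.ext h.2⟩)
      · exact Or.inl ⟨e', he', h⟩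
    rw [Finset.card_insert_of_notMem he]
    by_cases hab : Quot.mk (D.Joined s S) (D.portVertex s (D.attach (e, false))) =
        Quot.mk (D.Joined s S) (D.portVertex s (D.attach (e, true)))
    · rw [numComponents_insert_of_joined_eq hD he hab, card_quot_of_mk_eq h1 h2 hab]
      omega
    · have h3 := joined_attach (s := s) (Finset.mem_insert_self e S) false
      have h4 := card_quot_of_mk_ne h1 h2 h3 hab
      have h5 := numComponents_insert_of_joined_ne he hab
      omega

end DiagramData

/-! ### The Euler characteristic of a graph -/

namespace Graph

variable {α β : Type*}

/-- The transpose of the boundary map is the coboundary. In characteristic 2 the formula also covers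
loops, since `f x + f x = 0`. -/
theorem sum_isNonloopAt_mul (G : Graph α β) [Fintype V(G)] {e : β} {x y : V(G)}
    (h : G.IsLink e x y) (f : V(G) → ZMod 2) :
    (open Classical in ∑ v : V(G), (if G.IsNonloopAt e v then (1 : ZMod 2) else 0) * f v) =
      f x + f y := by
  classical
  by_cases hxy : x = y
  · subst hxy
    have hl : G.IsLoopAt e x := h
    rw [CharTwo.add_self_eq_zero]
    exact Finset.sum_eq_zero fun v _ => by rw [if_neg (hl.not_isNonloopAt _), zero_mul]
  · have hv : ∀ v : V(G), G.IsNonloopAt e v ↔ v = x ∨ v = y := by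
      intro v
      constructor
      · rintro ⟨w, -, hw⟩
        rcases hw.left_eq_or_eq h with hv | hv
        · exact Or.inl (Subtype.ext hv)
        · exact Or.inr (Subtype.ext hv)
      · rintro (rfl | rfl)
        · exact ⟨y, fun h => hxy (Subtype.ext h.symm), h⟩
        · exact ⟨x, fun h => hxy (Subtype.ext h), h.symm⟩
    have hs : ∀ v : V(G), (if G.IsNonloopAt e v then (1 : ZMod 2) else 0) * f v =
        if v ∈ ({x, y} : Finset V(G)) then f v else 0 := by
      intro v
      by_cases h1 : G.IsNonloopAt e v
      · rw [if_pos h1, if_pos (by simpa using (hv v).1 h1), one_mul]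
      · rw [if_neg h1, if_neg (by simpa using fun h2 => h1 ((hv v).2 h2)), zero_mul]
    rw [Finset.sum_congr rfl fun v _ => hs v, Finset.sum_ite_mem, Finset.univ_inter,
      Finset.sum_pair hxy]

/-- The Euler characteristic of a finite graph. -/
theorem bettiOne_add_card (G : Graph α β) [Finite V(G)] [Finite β] :
    G.bettiOne + Nat.card V(G) = Nat.card E(G) + G.numComponents := by
  classical
  let _ : Fintype E(G) := Fintype.ofFinite _
  let _ : Fintype V(G) := Fintype.ofFinite _
  let r : V(G) → V(G) → Prop := fun x y => G.Adj x y
  let _ : Fintype (Quot r) := Fintype.ofFinite _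
  let M : Matrix V(G) E(G) (ZMod 2) :=
    Matrix.of fun v e => if G.IsNonloopAt (e : β) (v : α) then 1 else 0
  have hM : G.boundary = M.mulVecLin := rfl
  have h1 := LinearMap.finrank_range_add_finrank_ker M.mulVecLin
  have h2 := LinearMap.finrank_range_add_finrank_ker M.transpose.mulVecLin
  have h3 : Module.finrank (ZMod 2) (LinearMap.range M.transpose.mulVecLin) =
      Module.finrank (ZMod 2) (LinearMap.range M.mulVecLin) := M.rank_transpose
  -- The kernel of the coboundary consists of the functions constant on components. As a matrix and
  -- its transpose have equal rank, this computes the rank of the boundary map.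
  have hmem : ∀ f : V(G) → ZMod 2, f ∈ LinearMap.ker M.transpose.mulVecLin ↔
      ∀ x y : V(G), G.Adj x y → f x = f y := by
    intro f
    rw [LinearMap.mem_ker, Matrix.mulVecLin_apply]
    have key : ∀ (e : E(G)) (x y : V(G)), G.IsLink e x y →
        M.transpose.mulVec f e = f x + f y := fun e x y h => sum_isNonloopAt_mul G h f
    constructor
    · rintro h0 x y ⟨e, he⟩
      have := key ⟨e, he.edge_mem⟩ x y he
      rw [h0] at this
      exact CharTwo.add_eq_zero.1 this.symm
    · intro h
      funext e
      obtain ⟨x, y, hxy⟩ := G.exists_isLink_of_mem_edgeSet e.2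
      rw [key e ⟨x, hxy.left_mem⟩ ⟨y, hxy.right_mem⟩ hxy,
        h ⟨x, hxy.left_mem⟩ ⟨y, hxy.right_mem⟩ ⟨e, hxy⟩]
      exact CharTwo.add_self_eq_zero _
  have hker : LinearMap.ker M.transpose.mulVecLin =
      LinearMap.range (LinearMap.funLeft (ZMod 2) (ZMod 2) (Quot.mk r)) := by
    ext f
    rw [hmem, LinearMap.mem_range]
    constructor
    · intro h
      exact ⟨Quot.lift f h, rfl⟩
    · rintro ⟨g, rfl⟩ x y hxy
      exact congrArg g (Quot.sound hxy)
  have h4 : Module.finrank (ZMod 2) (LinearMap.ker M.transpose.mulVecLin) = G.numComponents := by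
    rw [hker, LinearMap.finrank_range_of_inj
      (LinearMap.funLeft_injective_of_surjective _ _ _ Quot.mk_surjective),
      Module.finrank_fintype_fun_eq_card, numComponents, Nat.card_eq_fintype_card]
  rw [Module.finrank_fintype_fun_eq_card] at h1 h2
  rw [bettiOne, hM, Nat.card_eq_fintype_card, Nat.card_eq_fintype_card]
  omega

end Graph

namespace DiagramData

variable {D : DiagramData} {s : D.C → SignType}

theorem numComponents_deleteEdges_stateGraph (F : Finset D.E) :
    ((D.stateGraph s).deleteEdges (F : Set D.E)).numComponents =
      Nat.card (Quot (D.Joined s Fᶜ)) := by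
  refine Nat.card_congr (Quot.congr (Equiv.refl _) fun x y => ?_)
  constructor
  · rintro ⟨e, he⟩
    rw [Graph.deleteEdges_isLink] at he
    exact ⟨e, by simpa using he.2, he.1⟩
  · rintro ⟨e, he, h⟩
    refine ⟨e, ?_⟩
    rw [Graph.deleteEdges_isLink]
    exact ⟨h, by simpa using he⟩

theorem bettiOne_deleteEdges_stateGraph (F : Finset D.E) :
    ((D.stateGraph s).deleteEdges (F : Set D.E)).bettiOne + Nat.card V(D.stateGraph s) =
      Fᶜ.card + ((D.stateGraph s).deleteEdges (F : Set D.E)).numComponents := by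
  have : Finite V((D.stateGraph s).deleteEdges (F : Set D.E)) := Subtype.finite
  have h := Graph.bettiOne_add_card ((D.stateGraph s).deleteEdges (F : Set D.E))
  have hE : Nat.card E((D.stateGraph s).deleteEdges (F : Set D.E)) = Fᶜ.card := by
    have : E((D.stateGraph s).deleteEdges (F : Set D.E)) = ((Fᶜ : Finset D.E) : Set D.E) := by
      ext e
      simp [stateGraph]
    rw [this, Nat.card_coe_set_eq, Set.ncard_coe_finset]
  rw [hE] at h
  exact h

/-- The number of boundary components of a ribbon surface in the plane is the number of its
components plus the number of its holes. -/
theorem numComponents_ribbonState_compl (hD : D.IsPlane) (F : Finset D.E) :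
    D.barDiagram.numComponents (D.ribbonState s Fᶜ) =
      ((D.stateGraph s).deleteEdges (F : Set D.E)).numComponents +
        ((D.stateGraph s).deleteEdges (F : Set D.E)).bettiOne := by
  have h1 := numComponents_ribbonState (s := s) hD Fᶜ
  have h2 := bettiOne_deleteEdges_stateGraph (s := s) F
  have h3 := numComponents_deleteEdges_stateGraph (s := s) F
  omega

end DiagramData

/-! ### Comparison of the two polynomials -/

namespace DiagramData

variable {D : DiagramData} {K : Type*} [Field K]

/-- A smoothed crossing contributes two marking vertices and a crossing in state `0` only one. -/
theorem card_vertexSet_stateGraph (s : D.C → SignType) :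
    Nat.card V(D.stateGraph s) + (Finset.univ.filter fun c => s c = 0).card =
      Fintype.card D.V + 2 * Fintype.card D.C := by
  have h := Set.ncard_add_ncard_compl V(D.stateGraph s)
  have h1 : V(D.stateGraph s)ᶜ =
      (fun c => (Sum.inr (c, true) : D.V ⊕ (D.C × Bool))) ''
        ((Finset.univ.filter fun c => s c = 0 : Finset D.C) : Set D.C) := by
    ext x
    simp only [stateGraph, Set.mem_compl_iff, Set.mem_ofPred_eq, Set.mem_image,
      Finset.coe_filter, Finset.mem_univ, true_and]
    push Not
    constructor
    · rintro ⟨c, rfl, h⟩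
      exact ⟨c, h, rfl⟩
    · rintro ⟨c, h, rfl⟩
      exact ⟨c, rfl, h⟩
  rw [h1, Set.ncard_image_of_injective _ (fun c c' h => by simpa using h),
    Set.ncard_coe_finset, Nat.card_eq_fintype_card, Fintype.card_sum, Fintype.card_prod,
    Fintype.card_bool] at h
  rw [Nat.card_coe_set_eq]
  omega

/-- The ports are counted twice: there are two for each arc, and there are four at each crossing and
two at vertices for each edge of the spatial graph. -/
theorem card_eq_card_strand_add
    (h : ∀ q : D.Strand, ∃ p p', p ≠ p' ∧ D.endPorts q = {p, p'}) :
    Fintype.card D.E = Nat.card D.Strand + 2 * Fintype.card D.C := by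
  classical
  have : Finite D.Strand := inferInstanceAs (Finite (Quot _))
  let _ : Fintype D.Strand := Fintype.ofFinite _
  have h1 := Fintype.card_congr D.attach
  rw [Fintype.card_prod, Fintype.card_bool, Fintype.card_sum, Fintype.card_prod,
    Fintype.card_fin] at h1
  let f : (Σ v, Fin (D.deg v)) → D.Strand := fun p => D.strand (D.attach.symm (Sum.inl p)).1
  have h2 : Fintype.card (Σ v, Fin (D.deg v)) = ∑ q : D.Strand, 2 := by
    rw [← Finset.card_univ, Finset.card_eq_sum_card_fiberwise (f := f) (t := Finset.univ)
      fun _ _ => Finset.mem_coe.2 (Finset.mem_univ _)]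
    refine Finset.sum_congr rfl fun q _ => ?_
    obtain ⟨p, p', hne, hq⟩ := h q
    have : (Finset.univ.filter fun p => f p = q) = {p, p'} := by
      ext x
      have := Set.ext_iff.1 hq x
      simpa [endPorts] using this
    rw [this, Finset.card_pair hne]
  rw [Finset.sum_const, Finset.card_univ, smul_eq_mul] at h2
  rw [Nat.card_eq_fintype_card]
  omega

/-- The terms agree for each set `F` of deleted edges, which are the cut strips. With `d = A² +
A⁻²`, both sides equal `(-1)^(μ+β) d^(2β)`. -/
theorem hPoly_stateGraph (hD : D.IsPlane) (s : D.C → SignType) {A : K}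
    (hA : A ≠ 0) (hA2 : A ^ 4 ≠ -1) :
    (D.stateGraph s).hPoly (-1) (-A ^ 4 - 2 - (A ^ 4)⁻¹) =
      -(A ^ 2 + (A ^ 2)⁻¹) ^ ((Fintype.card D.E : ℤ) - Nat.card V(D.stateGraph s) + 1) *
        D.stripSum A fun c => quadrants (s c) := by
  have hd := LinkProjection.loopValue_ne_zero hA hA2
  have hy : -A ^ 4 - 2 - (A ^ 4)⁻¹ = -(A ^ 2 + (A ^ 2)⁻¹) ^ 2 := by
    field_simp
    ring
  rw [hy]
  generalize hdd : A ^ 2 + (A ^ 2)⁻¹ = d at hd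
  have hE : (Set.toFinite E(D.stateGraph s)).toFinset = Finset.univ := by
    ext e
    simp [stateGraph]
  let f : Finset D.E ≃ (D.E → Bool) :=
    { toFun := fun F e => decide (e ∈ Fᶜ)
      invFun := fun b => Finset.univ.filter fun e => b e = false
      left_inv := fun F => by ext e; simp
      right_inv := fun b => by
        funext e
        cases h : b e <;> simp [h] }
  rw [Graph.hPoly, hE, Finset.powerset_univ, stripSum, ← f.sum_comp, Finset.mul_sum]
  refine Finset.sum_congr rfl fun F _ => ?_
  have hN : D.barDiagram.numComponents (D.smoothState (fun c => quadrants (s c)) (f F)) = _ :=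
    numComponents_ribbonState_compl (s := s) hD F
  have hβ := bettiOne_deleteEdges_stateGraph (s := s) F
  have hF := F.card_add_card_compl
  have hw : ∏ e, stripWeight A (f F e) = d ^ (-(F.card : ℤ)) := by
    have : ∀ e, stripWeight A (f F e) = if e ∈ F then d⁻¹ else 1 := by
      intro e
      by_cases he : e ∈ F <;> simp [stripWeight, f, he, hdd]
    rw [Finset.prod_congr rfl fun e _ => this e, Finset.prod_ite_mem, Finset.univ_inter,
      Finset.prod_const, zpow_neg, zpow_natCast, inv_pow]
  rw [hN, hw, hdd]
  generalize ((D.stateGraph s).deleteEdges (F : Set D.E)).numComponents = μ at hβ ⊢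
  generalize ((D.stateGraph s).deleteEdges (F : Set D.E)).bettiOne = β at hβ ⊢
  generalize Nat.card V(D.stateGraph s) = v at hβ ⊢
  have h1 : (-d) ^ (((μ + β : ℕ) : ℤ) - 1) =
      (-1) * (-1) ^ μ * (-1) ^ β * d ^ ((μ : ℤ) + β - 1) := by
    rw [neg_eq_neg_one_mul, mul_zpow, zpow_sub₀ (neg_ne_zero.2 one_ne_zero), zpow_natCast, pow_add,
      Nat.cast_add]
    field_simp
  -- The Euler relation turns the total exponent into `2β`.
  have h2 : d ^ ((Fintype.card D.E : ℤ) - v + 1) * d ^ (-(F.card : ℤ)) * d ^ ((μ : ℤ) + β - 1) =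
      (d ^ 2) ^ β := by
    rw [← zpow_add₀ hd, ← zpow_add₀ hd, ← pow_mul, ← zpow_natCast]
    congr 1
    push_cast
    have h3 : (F.card : ℤ) + Fᶜ.card = Fintype.card D.E := by exact_mod_cast hF
    have h4 : (β : ℤ) + v = Fᶜ.card + μ := by exact_mod_cast hβ
    linarith
  rw [h1, neg_neg, one_zpow, one_mul, neg_pow (d ^ 2) β, ← h2]
  ring

theorem prod_crossingWeight (s : D.C → SignType) {A : K} (hA : A ≠ 0) :
    ∏ c, crossingWeight A (s c) =
      (A ^ 4) ^ (((Finset.univ.filter fun c => s c = 1).card : ℤ) -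
        ((Finset.univ.filter fun c => s c = -1).card : ℤ)) *
      (A ^ 2 + (A ^ 2)⁻¹) ^ (Finset.univ.filter fun c => s c = 0).card := by
  have h : ∀ t, crossingWeight A t = (if t = 1 then A ^ 4 else 1) *
      (if t = -1 then (A ^ 4)⁻¹ else 1) * (if t = 0 then A ^ 2 + (A ^ 2)⁻¹ else 1) := by
    intro t
    cases t
    · rw [if_neg (by decide), if_neg (by decide), if_pos (by decide)]
      simp [crossingWeight]
    · rw [if_neg (by decide), if_pos (by decide), if_neg (by decide), one_mul, mul_one]
      exact (zpow_neg A 4).trans (congrArg _ (zpow_natCast A 4))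
    · rw [if_pos (by decide), if_neg (by decide), if_neg (by decide), mul_one, mul_one]
      exact zpow_natCast A 4
  rw [Finset.prod_congr rfl fun c _ => h (s c), Finset.prod_mul_distrib, Finset.prod_mul_distrib,
    ← Finset.prod_filter, ← Finset.prod_filter, ← Finset.prod_filter, Finset.prod_const,
    Finset.prod_const, Finset.prod_const, zpow_sub₀ (pow_ne_zero 4 hA), zpow_natCast, zpow_natCast,
    inv_pow, div_eq_mul_inv]

end DiagramData

theorem proposition1 {α β : Type*} (G : Graph α β) (D : SpatialGraphDiagram)
    (hD : D.IsDiagramOf G) {K : Type*} [Field K] (A : K) (hA : A ≠ 0) (hA1 : A ^ 4 ≠ 1)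
    (hA2 : A ^ 4 ≠ -1) :
    D.yamada (A ^ 4) =
      -(A ^ 2 + (A ^ 2)⁻¹) ^ ((E(G).ncard : ℤ) - (V(G).ncard : ℤ) + 1) * D.jaegerYamada A := by
  have hd := LinkProjection.loopValue_ne_zero hA hA2
  obtain ⟨φ, ψ, h⟩ := hD
  have hV : V(G).ncard = Fintype.card D.V := by
    rw [← Nat.card_coe_set_eq, ← Nat.card_congr φ, Nat.card_eq_fintype_card]
  have hE : E(G).ncard = Nat.card D.Strand := by
    rw [← Nat.card_coe_set_eq, ← Nat.card_congr ψ]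
  have hs := DiagramData.card_eq_card_strand_add (D := D.toDiagramData) fun q =>
    let ⟨p, p', hne, hq, _⟩ := h q
    ⟨p, p', hne, hq⟩
  rw [DiagramData.jaegerYamada_eq_sum_states _ D.isPlane hA hA1 hA2, DiagramData.yamada,
    Finset.mul_sum]
  refine Finset.sum_congr rfl fun s _ => ?_
  rw [DiagramData.hPoly_stateGraph D.isPlane s hA hA2, DiagramData.prod_crossingWeight s hA]
  have hc := DiagramData.card_vertexSet_stateGraph s
  -- Each crossing adds two arcs to the edges and two vertices, or only one in state `0`. The
  -- surplus exponent is the number of crossings in state `0`, matching the factor in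
  -- `prod_crossingWeight`.
  have hexp : (Fintype.card D.E : ℤ) - Nat.card V(D.stateGraph s) + 1 =
      ((E(G).ncard : ℤ) - (V(G).ncard : ℤ) + 1) +
        (Finset.univ.filter fun c => s c = 0).card := by
    rw [hE, hV]
    omega
  rw [hexp, zpow_add₀ hd, zpow_natCast]
  ring
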